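/- Let $M$ be a compact complex manifold of dimension $n$, $\overline M$ the conjugate manifold, $\Delta_M=\{(x,\bar x)\}\subset M\times\overline M$ the diagonal, and let $L$, $L'$ be Hermitian holomorphic line bundles on $M$ with real-analytic metrics, $L$ being positive. Let $\mu=\omega^n/n!$ be the Liouville measure, where $\omega=i\sum G_{ij}\,dz_i\wedge d\bar z_j$ is the curvature form of $L$; here $G_{ij}=\partial^2\varphi/\partial z_i\partial\bar z_j$ if $|s|^2=e^{-\varphi}$ for a local holomorphic frame $s$ of $L$. Let $f,g$ be real-analytic complex-valued functions on $M$. Let $W$ be an open neighbourhood of $\Delta_M$ on which there are holomorphic extensions $E$, $E'$ of the canonical sections $(x,\bar x)\mapsto |u|^{-2}u\otimes\bar u$ of $L\boxtimes\overline L$ and $L'\boxtimes\overline{L'}$ over $\Delta_M$, with $|E|<1$ on $W\setminus\Delta_M$, and holomorphic extensions $\tilde f$, $\tilde g$ of $f$, $g$ (that is, $\tilde f(x,\bar x)=f(x)$, $\tilde g(x,\bar x)=g(x)$). Let $\rho:M\times\overline M\to\mathbb R$ be a smooth function with compact support contained in $W$, equal to $1$ near $\Delta_M$. For $k\ge 1$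 let $S_k$, $T_k$ be the operators on sections of $L^k\otimes L'$ with Schwartz kernels $$S_k(x,\bar y)=\rho\,\Bigl(\frac{k}{2\pi}\Bigr)^{n}E^k\otimes E'\,\tilde f\,(x,\bar y),\qquad T_k(x,\bar y)=\rho\,\Bigl(\frac{k}{2\pi}\Bigr)^{n}E^k\otimes E'\,\tilde g\,(x,\bar y),$$ and let $r_k(x)=\int_M S_k(x,\bar y)\cdot T_k(y,\bar x)\,d\mu(y)$ be the restriction to the diagonal of the kernel of $S_k\circ T_k$ (a function on $M$, through the identification $(L^k\otimes L')_x\otimes\overline{(L^k\otimes L')_x}\simeq\mathbb C$ given by the metrics). Then there are functions $A_\ell(f,g)$ on $M$ such that, for every $N$, uniformly on $M$, $$r_k(x)=\Bigl(\frac{k}{2\pi}\Bigr)^n\sum_{\ell=0}^N k^{-\ell}A_\ell(f,g)(x)+\mathcal O(k^{n-N-1}),$$ and these coefficients are given locally as follows. Let $U\subset M$ be a connected open set that is the domain of a holomorphic chart, with $U\times\overline U\subset W$, and identify $U$ with an open subset of $\mathbb C^n$. Let $s,s'$ be holomorphic frames of $L,L'$ over $U$, $|s|^2=e^{-\varphi}$,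 $|s'|^2=e^{-\varphi'}$, such that $\varphi,\varphi'$ have holomorphic extensions $\tilde\varphi,\tilde\varphi'$ to $U\times\overline U$. Put $\psi(x,y)=-\tilde\varphi(x,\bar y)-\tilde\varphi(y,\bar x)+\tilde\varphi(x,\bar x)+\tilde\varphi(y,\bar y)$, define $\psi'$ in the same way from $\tilde\varphi'$, and let $\delta=\det(G_{ij})$, which is the density of $\mu$ with respect to the measure $\prod_j i\,dz_j\wedge d\bar z_j$ ($2^n$ times the standard Lebesgue measure). Then for all $\ell\ge 0$ and $x\in U$ $$A_\ell(f,g)(x)=b(x)\sum_{m=0}^{2\ell}\frac{\Delta^{\ell+m}(c^m\,d\,c')}{m!\,(\ell+m)!}(x,0),$$ where, for $u\in\mathbb C^n$ small, $b(x)=\det(G_{ij}(x))^{-1}$, $$c(x,u)=\sum_{i,j}G_{ij}(x)u_i\bar u_j-\psi(x,x+u),\quad d(x,u)=\tilde f(x,\bar x+\bar u)\,\tilde g(x+u,\bar x),\quad c'(x,u)=e^{-\psi'(x,x+u)}\delta(x+u),$$ and $\Delta=\sum_{i,j}G^{ij}(x)\,\partial_{u_i}\partial_{\bar u_j}$ acts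 on the variable $u$, $(G^{ij})$ being the contravariant inverse of $(G_{ij})$, i.e. $\sum_jG^{ij}G_{kj}=\delta_{ik}$ (Kronecker delta). -/

import Mathlib

open scoped Manifold ContDiff Topology TensorProduct ComplexOrder

noncomputable section

namespace BerezinToeplitz

/-! ### Calculus on `ℂⁿ` -/

/-- The Wirtinger derivative `∂F/∂zᵢ`. -/
def dz {n : ℕ} (i : Fin n) (F : (Fin n → ℂ) → ℂ) (z : Fin n → ℂ) : ℂ :=
  (1 / 2) * (fderiv ℝ F z (Pi.single i 1) - Complex.I * fderiv ℝ F z (Pi.single i Complex.I))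

/-- The Wirtinger derivative `∂F/∂z̄ᵢ`. -/
def dzbar {n : ℕ} (i : Fin n) (F : (Fin n → ℂ) → ℂ) (z : Fin n → ℂ) : ℂ :=
  (1 / 2) * (fderiv ℝ F z (Pi.single i 1) + Complex.I * fderiv ℝ F z (Pi.single i Complex.I))

/-- The matrix `Gᵢⱼ(z) = ∂²φ/∂zᵢ∂z̄ⱼ (z)`. -/
def leviMatrix {n : ℕ} (φ : (Fin n → ℂ) → ℂ) (z : Fin n → ℂ) : Matrix (Fin n) (Fin n) ℂ :=
  Matrix.of fun i j => dz i (dzbar j φ) z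

/-- The constant coefficient operator `Δ = ∑ᵢⱼ Gⁱʲ ∂_{uᵢ} ∂_{ūⱼ}`, where `(Gⁱʲ)` is the
contravariant inverse of `G`, that is `∑ⱼ Gⁱʲ Gₖⱼ = δᵢₖ`; as a matrix it is `(Gᵀ)⁻¹`. -/
def laplace {n : ℕ} (G : Matrix (Fin n) (Fin n) ℂ) (F : (Fin n → ℂ) → ℂ) :
    (Fin n → ℂ) → ℂ :=
  fun u => ∑ i, ∑ j, (G.transpose)⁻¹ i j * dz i (dzbar j F) u

/-- `ψ(z, w) = - φ̃(z, w̄) - φ̃(w, z̄) + φ̃(z, z̄) + φ̃(w, w̄)`. Here and below `F z w` stands for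
the value at `(z, w̄)` of a function `F` of a point of `ℂⁿ` and a conjugate point. -/
def diastasis {n : ℕ} (φt : (Fin n → ℂ) → (Fin n → ℂ) → ℂ) (z w : Fin n → ℂ) : ℂ :=
  -φt z w - φt w z + φt z z + φt w w

/-- `b(x) = det (Gᵢⱼ(x))⁻¹`. -/
def bFun {n : ℕ} (φ : (Fin n → ℂ) → ℂ) (x : Fin n → ℂ) : ℂ :=
  ((leviMatrix φ x).det)⁻¹

/-- `c(x, u) = ∑ᵢⱼ Gᵢⱼ(x) uᵢ ūⱼ - ψ(x, x + u)`. -/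
def cFun {n : ℕ} (φ : (Fin n → ℂ) → ℂ) (φt : (Fin n → ℂ) → (Fin n → ℂ) → ℂ)
    (x u : Fin n → ℂ) : ℂ :=
  ∑ i, ∑ j, leviMatrix φ x i j * u i * star (u j) - diastasis φt x (x + u)

/-- `d(x, u) = f̃(x, x̄ + ū) g̃(x + u, x̄)`. -/
def dFun {n : ℕ} (ft gt : (Fin n → ℂ) → (Fin n → ℂ) → ℂ) (x u : Fin n → ℂ) : ℂ :=
  ft x (x + u) * gt (x + u) x

/-- The density `δ = det (Gᵢⱼ)` of the Liouville measure with respect to the measure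
`∏ⱼ (i dzⱼ ∧ dz̄ⱼ) = 2ⁿ ∏ⱼ dxⱼ dyⱼ` of `ℂⁿ`. -/
def liouvilleDensity {n : ℕ} (φ : (Fin n → ℂ) → ℂ) (z : Fin n → ℂ) : ℂ :=
  (leviMatrix φ z).det

/-- `c'(x, u) = exp (- ψ'(x, x + u)) δ(x + u)`. -/
def cFun' {n : ℕ} (φ : (Fin n → ℂ) → ℂ) (φt' : (Fin n → ℂ) → (Fin n → ℂ) → ℂ)
    (x u : Fin n → ℂ) : ℂ :=
  Complex.exp (-diastasis φt' x (x + u)) * liouvilleDensity φ (x + u)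

/-- `b(x) ∑_{m=0}^{2ℓ} Δ^{ℓ+m} (cᵐ d c') (x, 0) / (m! (ℓ+m)!)`. -/
def localCoeff {n : ℕ} (φ : (Fin n → ℂ) → ℂ)
    (φt φt' ft gt : (Fin n → ℂ) → (Fin n → ℂ) → ℂ) (l : ℕ) (x : Fin n → ℂ) : ℂ :=
  bFun φ x * ∑ m ∈ Finset.range (2 * l + 1),
    ((laplace (leviMatrix φ x))^[l + m]
        (fun u => cFun φ φt x u ^ m * dFun ft gt x u * cFun' φ φt' x u)) 0
      / ((m.factorial : ℂ) * ((l + m).factorial : ℂ))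

/-! ### Complex manifolds and Hermitian line bundles -/

section Manifold

variable (n : ℕ) {M : Type*} [TopologicalSpace M] [ChartedSpace (Fin n → ℂ) M]

/-- A function `F` on `M × M`, seen as a function on `M × M̄`, is holomorphic on the open set `W`:
for all holomorphic charts `e`, `e'` of `M`, its expression in the charts `e` of `M` and
`conj ∘ e'` of `M̄` is holomorphic. -/
def SesquiHolOn (W : Set (M × M)) (F : M × M → ℂ) : Prop :=
  ∀ e ∈ IsManifold.maximalAtlas 𝓘(ℂ, Fin n → ℂ) ω M,
  ∀ e' ∈ IsManifold.maximalAtlas 𝓘(ℂ, Fin n → ℂ) ω M,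
    AnalyticOnNhd ℂ
      (fun p : (Fin n → ℂ) × (Fin n → ℂ) => F (e.symm p.1, e'.symm (star p.2)))
      {p | p.1 ∈ e.target ∧ star p.2 ∈ e'.target ∧ (e.symm p.1, e'.symm (star p.2)) ∈ W}

variable (L : M → Type*) [∀ x, NormedAddCommGroup (L x)] [∀ x, InnerProductSpace ℂ (L x)]

/-- `s` is a holomorphic frame of the line bundle `L` over the open set `U`. -/
def IsHolFrameOn [TopologicalSpace (Bundle.TotalSpace ℂ L)] [FiberBundle ℂ L]
    (U : Set M) (s : ∀ x, L x) : Prop :=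
  ContMDiffOn 𝓘(ℂ, Fin n → ℂ) (𝓘(ℂ, Fin n → ℂ).prod 𝓘(ℂ, ℂ)) ω
    (fun x => Bundle.TotalSpace.mk' ℂ x (s x)) U ∧ ∀ x ∈ U, s x ≠ 0

/-- The weight `φ = - log |s|²` of the metric of `L` in the frame `s`. -/
def weight (s : ∀ x, L x) (x : M) : ℂ := ((-Real.log (‖s x‖ ^ 2) : ℝ) : ℂ)

/-- The weight in the chart `e`. -/
def weightIn (e : OpenPartialHomeomorph M (Fin n → ℂ)) (s : ∀ x, L x) (z : Fin n → ℂ) : ℂ :=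
  weight L s (e.symm z)

/-- The Hermitian line bundle `L` is positive: its curvature, whose coefficients in a holomorphic
chart are the `∂²φ/∂zᵢ∂z̄ⱼ`, is positive definite. -/
def IsPositive [TopologicalSpace (Bundle.TotalSpace ℂ L)] [FiberBundle ℂ L] : Prop :=
  ∀ e ∈ IsManifold.maximalAtlas 𝓘(ℂ, Fin n → ℂ) ω M, ∀ s : ∀ x, L x,
    IsHolFrameOn n L e.source s → ∀ z ∈ e.target, (leviMatrix (weightIn n L e s) z).PosDef

/-- The Liouville measure `ωⁿ / n!` of `M`, with `ω = i ∑ Gᵢⱼ dzᵢ ∧ dz̄ⱼ` the curvature form of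
`L`. In every holomorphic chart over which `L` has a holomorphic frame, `ωⁿ / n!` is
`2ⁿ det (Gᵢⱼ)` times Lebesgue measure; the measure of `M` obtained by gluing these compatible
local measures is the smallest one which is larger than each of them. -/
def liouvilleMeasure [TopologicalSpace (Bundle.TotalSpace ℂ L)] [FiberBundle ℂ L]
    [MeasurableSpace M] : MeasureTheory.Measure M :=
  ⨆ (e : OpenPartialHomeomorph M (Fin n → ℂ))
    (_ : e ∈ IsManifold.maximalAtlas 𝓘(ℂ, Fin n → ℂ) ω M)
    (s : ∀ x, L x) (_ : IsHolFrameOn n L e.source s),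
    ((((2 : ENNReal) ^ n • MeasureTheory.volume).restrict e.target).withDensity
      (fun z => ENNReal.ofReal (liouvilleDensity (weightIn n L e s) z).re)).map e.symm

/-- Sections of `L ⊠ L̄`. The fibre `L_x ⊗ L̄_y` over `(x, ȳ)` is identified with
`Hom (L_y, L_x)` through the metric, `u ⊗ v̄` being the rank one map `w ↦ ⟨v, w⟩ u`.
In this identification
* the norm of `L_x ⊗ L̄_y` is the operator norm,
* the scalar product `(L_x ⊗ L̄_y) × (L_y ⊗ L̄_z) → L_x ⊗ L̄_z` in the middle factors is the
  composition of maps,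
* the identification `L_x ⊗ L̄_x ≃ ℂ` given by the metric is the trace,
* the canonical section `|u|⁻² u ⊗ ū` over the diagonal is the identity. -/
abbrev Kernel : Type _ := ∀ x y : M, L y →L[ℂ] L x

/-- The section `E` of `L ⊠ L̄` is holomorphic on the open set `W ⊆ M × M̄`: in the frames
`s ⊠ t̄`, with `s`, `t` local holomorphic frames of `L`, its coefficient is holomorphic. -/
def IsHolKernelOn [TopologicalSpace (Bundle.TotalSpace ℂ L)] [FiberBundle ℂ L]
    (W : Set (M × M)) (E : Kernel L) : Prop :=
  ∀ (U V : Set M) (s t : ∀ x, L x), IsOpen U → IsOpen V →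
    IsHolFrameOn n L U s → IsHolFrameOn n L V t →
    ∃ a : M × M → ℂ, SesquiHolOn n (W ∩ U ×ˢ V) a ∧
      ∀ x y, (x, y) ∈ W ∩ U ×ˢ V → E x y = a (x, y) • InnerProductSpace.rankOne ℂ (s x) (t y)

/-- `E` is a holomorphic extension to `W` of the canonical section `(x, x̄) ↦ |u|⁻² u ⊗ ū` of
`L ⊠ L̄` over the diagonal. -/
def IsCanonicalExtension [TopologicalSpace (Bundle.TotalSpace ℂ L)] [FiberBundle ℂ L]
    (W : Set (M × M)) (E : Kernel L) : Prop :=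
  IsHolKernelOn n L W E ∧ ∀ x, E x x = ContinuousLinearMap.id ℂ (L x)

variable (L' : M → Type*) [∀ x, NormedAddCommGroup (L' x)] [∀ x, InnerProductSpace ℂ (L' x)]

/-- The fibre of `Lᵏ ⊗ L'` at `x`. -/
abbrev PowFiber (k : ℕ) (x : M) : Type _ := (⨂[ℂ] _ : Fin k, L x) ⊗[ℂ] L' x

variable {L L'}

/-- The Schwartz kernel `ρ(x, ȳ) (k / 2π)ⁿ Eᵏ(x, ȳ) ⊗ E'(x, ȳ) F(x, ȳ)`, a section of
`(Lᵏ ⊗ L') ⊠ conj (Lᵏ ⊗ L')`, with fibres again seen as spaces of linear maps. -/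
def toeplitzKernel (ρ : M × M → ℝ) (E : Kernel L) (E' : Kernel L') (F : M × M → ℂ)
    (k : ℕ) (x y : M) : PowFiber L L' k y →ₗ[ℂ] PowFiber L L' k x :=
  ((ρ (x, y) : ℂ) * ((k : ℂ) / (2 * (Real.pi : ℂ))) ^ n * F (x, y)) •
    TensorProduct.map (PiTensorProduct.map fun _ : Fin k => (E x y : L y →ₗ[ℂ] L x))
      (E' x y : L' y →ₗ[ℂ] L' x)

/-- The restriction to the diagonal of the Schwartz kernel of the composition `S ∘ T` of the
operators with kernels `S`, `T`: the function `x ↦ ∫ S(x, ȳ) · T(y, x̄) dμ(y)`, where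
`S(x, ȳ) · T(y, x̄)` in `(Lᵏ ⊗ L')_x ⊗ conj (Lᵏ ⊗ L')_x` is seen as a complex number through
the metric. -/
def compDiag [MeasurableSpace M] (μ : MeasureTheory.Measure M) (k : ℕ)
    (S T : ∀ x y : M, PowFiber L L' k y →ₗ[ℂ] PowFiber L L' k x) (x : M) : ℂ :=
  ∫ y, LinearMap.trace ℂ (PowFiber L L' k x) (S x y ∘ₗ T y x) ∂μ

/-- `r_k = (k / 2π)ⁿ ∑_{ℓ=0}^N k^{-ℓ} A_ℓ + O(k^{n-N-1})` for every `N`, uniformly on `M`. -/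
def HasDiagExpansion (r : ℕ → M → ℂ) (A : ℕ → M → ℂ) : Prop :=
  ∀ N : ℕ, ∃ C : ℝ, ∀ k : ℕ, 1 ≤ k → ∀ x : M,
    ‖r k x - ((k : ℂ) / (2 * (Real.pi : ℂ))) ^ n *
        ∑ l ∈ Finset.range (N + 1), (k : ℂ) ^ (-(l : ℤ)) * A l x‖
      ≤ C * (k : ℝ) ^ ((n : ℤ) - N - 1)

/-- The expression in the chart `e` of a function on `M × M̄`. -/
def inChart (e : OpenPartialHomeomorph M (Fin n → ℂ)) (F : M × M → ℂ) (z w : Fin n → ℂ) : ℂ :=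
  F (e.symm z, e.symm w)

end Manifold

end BerezinToeplitz

end

/-!
Both kernels are seen as families of linear maps between lines, so that the trace which defines
`r_k(x)` is a product of scalars: up to the factor `(k / 2π)²ⁿ`, the integrand is
`ρ(x, ȳ) ρ(y, x̄) f̃(x, ȳ) g̃(y, x̄) τ(x, y)ᵏ τ'(x, y)`, where `τ(x, y)` is the contraction of
`E(x, ȳ)` with `E(y, x̄)` (`kernelTrace`, `trace_toeplitzKernel_comp`). On the
support of the cutoff factors, `τ` is continuous and of modulus `< 1` off the diagonal, so that for
`x` near a given point everything outside a coordinate ball centred at `x` contributes `O(k²ⁿ qᵏ)`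
with `q < 1`.

Near the diagonal, `τ = exp (-ψ)`. Indeed in the frame `s` the coefficient of `E` and `exp φ̃` are
both holomorphic in `(x, ȳ)` and both equal `|s|⁻²` on the diagonal, and a holomorphic function of
`(x, ȳ)` which vanishes on the diagonal vanishes near it (`eventually_eq_zero_of_comp_star`,
`eventually_kernelTrace_eq`). Conversely the logarithm of the coefficient of `E` provides an
extension of the weight near any point (`exists_potential`).

This leaves the Laplace integral over a ball of `exp (-k ψ(x, x + u)) d(x, u) c'(x, u)`, with
`ψ = Q - c`, where `Q = ∑ Gᵢⱼ uᵢ ūⱼ` is positive definite and `c = O(|u|³)`. Expanding `exp (k c)`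
gives integrals of `cᵐ d c'` against the Gaussian `exp (-k Q)`. For `h = k^{-1/2}`, differentiating
`∫ exp (-Q v) F(h v) dv` in `h` and integrating by parts produces the powers of `Δ`, hence the
expansion `∑ h²ᵖ Δᵖ F(0) / p!` times `πⁿ / det G`. The powers `p < 3m/2` do not contribute to the
term `F = cᵐ d c'`: this follows from `F = O(|u|^{3m})` by comparing asymptotics. Everything is
uniform in `x` (`laplace_expansion_uniform`, `local_expansion`).

The Liouville measure is a supremum of measures given in charts. They agree on overlaps:
`Q` is the second order part of `1 - τ`, which involves neither a chart nor a frame, so `Q` is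
transported by the differentials of the changes of charts, and comparing Gaussian integrals shows
that `det G` is multiplied by their Jacobians (`quad_leviMatrix_chartChange`,
`det_leviMatrix_chartChange`, `liouvilleMeasure_restrict_source`).

Thus each point has a neighbourhood with a uniform expansion, whose coefficients are computed in
any chart with any frames and extensions (`exists_nhds_compDiag_expansion`). As the coefficients of
an expansion are unique (`expansion_coeff_unique`), they define functions on `M`, and compactness
makes the expansion uniform.
-/

namespace BerezinToeplitz

open MeasureTheory Filter Set

/-! ### Wirtinger calculus -/

section Wirtinger

variable {n : ℕ}

theorem dz_eventuallyEq {F F' : (Fin n → ℂ) → ℂ} {z : Fin n → ℂ} (i : Fin n)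
    (h : F =ᶠ[𝓝 z] F') : dz i F =ᶠ[𝓝 z] dz i F' := by
  filter_upwards [h.fderiv (𝕜 := ℝ)] with w hw
  simp only [dz, hw]

theorem dzbar_eventuallyEq {F F' : (Fin n → ℂ) → ℂ} {z : Fin n → ℂ} (i : Fin n)
    (h : F =ᶠ[𝓝 z] F') : dzbar i F =ᶠ[𝓝 z] dzbar i F' := by
  filter_upwards [h.fderiv (𝕜 := ℝ)] with w hw
  simp only [dzbar, hw]

theorem leviMatrix_congr {F F' : (Fin n → ℂ) → ℂ} {z : Fin n → ℂ}
    (h : F =ᶠ[𝓝 z] F') : leviMatrix F z = leviMatrix F' z := by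
  ext i j
  exact (dz_eventuallyEq i (dzbar_eventuallyEq j h)).self_of_nhds

theorem laplace_eventuallyEq {F F' : (Fin n → ℂ) → ℂ} {z : Fin n → ℂ}
    (G : Matrix (Fin n) (Fin n) ℂ) (h : F =ᶠ[𝓝 z] F') :
    laplace G F =ᶠ[𝓝 z] laplace G F' := by
  have : ∀ᶠ w in 𝓝 z, ∀ i j, dz i (dzbar j F) w = dz i (dzbar j F') w := by
    rw [eventually_all]; intro i
    rw [eventually_all]; intro j
    exact dz_eventuallyEq i (dzbar_eventuallyEq j h)
  filter_upwards [this] with w hw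
  simp only [laplace, hw]

theorem iterate_laplace_eventuallyEq {F F' : (Fin n → ℂ) → ℂ} {z : Fin n → ℂ}
    (G : Matrix (Fin n) (Fin n) ℂ) (h : F =ᶠ[𝓝 z] F') (p : ℕ) :
    (laplace G)^[p] F =ᶠ[𝓝 z] (laplace G)^[p] F' := by
  induction p with
  | zero => simpa using h
  | succ p ih =>
    rw [Function.iterate_succ_apply', Function.iterate_succ_apply']
    exact laplace_eventuallyEq G ih

section Joint

variable {Z : Type*} [NormedAddCommGroup Z] [NormedSpace ℝ Z]

/-- Here and in the next lemmas, a function of `u` depends smoothly on a parameter `z`, and the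
smoothness is joint. -/
theorem contDiffAt_fderiv_snd {F : Z → (Fin n → ℂ) → ℂ} {p : Z × (Fin n → ℂ)}
    (h : ContDiffAt ℝ ∞ (Function.uncurry F) p) (v : Fin n → ℂ) :
    ContDiffAt ℝ ∞ (fun q : Z × (Fin n → ℂ) => fderiv ℝ (F q.1) q.2 v) p := by
  have h1 : ContDiffAt ℝ ∞ (Function.uncurry fun q : Z × (Fin n → ℂ) => F q.1) (p, p.2) := by
    have : ContDiffAt ℝ ∞ (fun x : (Z × (Fin n → ℂ)) × (Fin n → ℂ) => (x.1.1, x.2)) (p, p.2) := by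
      fun_prop
    exact ContDiffAt.comp (f := fun x : (Z × (Fin n → ℂ)) × (Fin n → ℂ) => (x.1.1, x.2))
      (p, p.2) (by simpa using h) this
  have h2 := ContDiffAt.fderiv (n := ∞) (m := ∞) h1 contDiffAt_snd (by simp)
  exact h2.clm_apply contDiffAt_const

theorem contDiffAt_dz {F : Z → (Fin n → ℂ) → ℂ} {p : Z × (Fin n → ℂ)}
    (h : ContDiffAt ℝ ∞ (Function.uncurry F) p) (i : Fin n) :
    ContDiffAt ℝ ∞ (Function.uncurry fun z => dz i (F z)) p := by
  have h1 := contDiffAt_fderiv_snd h (Pi.single i 1)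
  have h2 := contDiffAt_fderiv_snd h (Pi.single i Complex.I)
  exact contDiffAt_const.mul (h1.sub (contDiffAt_const.mul h2))

theorem contDiffAt_dzbar {F : Z → (Fin n → ℂ) → ℂ} {p : Z × (Fin n → ℂ)}
    (h : ContDiffAt ℝ ∞ (Function.uncurry F) p) (i : Fin n) :
    ContDiffAt ℝ ∞ (Function.uncurry fun z => dzbar i (F z)) p := by
  have h1 := contDiffAt_fderiv_snd h (Pi.single i 1)
  have h2 := contDiffAt_fderiv_snd h (Pi.single i Complex.I)
  exact contDiffAt_const.mul (h1.add (contDiffAt_const.mul h2))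

theorem contDiffAt_leviMatrix {φ : (Fin n → ℂ) → ℂ} {z : Fin n → ℂ}
    (h : ContDiffAt ℝ ∞ φ z) (i j : Fin n) :
    ContDiffAt ℝ ∞ (fun z => leviMatrix φ z i j) z := by
  have h0 : ContDiffAt ℝ ∞ (fun p : ℝ × (Fin n → ℂ) => p.2) ((0 : ℝ), z) := contDiffAt_snd
  have h1 : ContDiffAt ℝ ∞ (Function.uncurry fun _ : ℝ => φ) ((0 : ℝ), z) :=
    ContDiffAt.comp (g := φ) ((0 : ℝ), z) h h0
  have h2 : ContDiffAt ℝ ∞ (fun p : ℝ × (Fin n → ℂ) => leviMatrix φ p.2 i j) ((0 : ℝ), z) :=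
    contDiffAt_dz (F := fun _ : ℝ => dzbar j φ) (contDiffAt_dzbar (F := fun _ : ℝ => φ) h1 j) i
  have h3 : ContDiffAt ℝ ∞ (fun z : Fin n → ℂ => ((0 : ℝ), z)) z :=
    contDiffAt_const.prodMk contDiffAt_id
  exact ContDiffAt.comp z h2 h3

/-- Joint smoothness in the parameter and the variable is preserved by `Δ`, when the coefficients
of `Δ` are smooth functions of the parameter. -/
theorem contDiffAt_laplace {G : Z → Matrix (Fin n) (Fin n) ℂ} {F : Z → (Fin n → ℂ) → ℂ}
    {p : Z × (Fin n → ℂ)} (hG : ∀ i j, ContDiffAt ℝ ∞ (fun z => (G z).transpose⁻¹ i j) p.1)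
    (h : ContDiffAt ℝ ∞ (Function.uncurry F) p) :
    ContDiffAt ℝ ∞ (Function.uncurry fun z => laplace (G z) (F z)) p := by
  change ContDiffAt ℝ ∞ (fun q : Z × (Fin n → ℂ) =>
    ∑ i, ∑ j, (G q.1).transpose⁻¹ i j * dz i (dzbar j (F q.1)) q.2) p
  refine ContDiffAt.sum fun i _ => ContDiffAt.sum fun j _ => ?_
  have h1 : ContDiffAt ℝ ∞ (fun q : Z × (Fin n → ℂ) => (G q.1).transpose⁻¹ i j) p :=
    ContDiffAt.comp (f := fun q : Z × (Fin n → ℂ) => q.1) p (hG i j) contDiffAt_fst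
  exact h1.mul (contDiffAt_dz (F := fun z => dzbar j (F z)) (contDiffAt_dzbar h j) i)

theorem contDiffAt_iterate_laplace {G : Z → Matrix (Fin n) (Fin n) ℂ} {F : Z → (Fin n → ℂ) → ℂ}
    {p : Z × (Fin n → ℂ)} (hG : ∀ i j, ContDiffAt ℝ ∞ (fun z => (G z).transpose⁻¹ i j) p.1)
    (h : ContDiffAt ℝ ∞ (Function.uncurry F) p) (m : ℕ) :
    ContDiffAt ℝ ∞ (Function.uncurry fun z => (laplace (G z))^[m] (F z)) p := by
  induction m with
  | zero => simpa using h
  | succ m ih =>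
    simp only [Function.iterate_succ_apply']
    exact contDiffAt_laplace hG ih

end Joint

theorem contDiff_dz {F : (Fin n → ℂ) → ℂ} (h : ContDiff ℝ ∞ F) (i : Fin n) :
    ContDiff ℝ ∞ (dz i F) := by
  have h1 := h.fderiv_right (m := ∞) (by simp)
  exact contDiff_const.mul ((h1.clm_apply contDiff_const).sub
    (contDiff_const.mul (h1.clm_apply contDiff_const)))

theorem contDiff_dzbar {F : (Fin n → ℂ) → ℂ} (h : ContDiff ℝ ∞ F) (i : Fin n) :
    ContDiff ℝ ∞ (dzbar i F) := by
  have h1 := h.fderiv_right (m := ∞) (by simp)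
  exact contDiff_const.mul ((h1.clm_apply contDiff_const).add
    (contDiff_const.mul (h1.clm_apply contDiff_const)))

theorem contDiff_laplace {F : (Fin n → ℂ) → ℂ} (G : Matrix (Fin n) (Fin n) ℂ)
    (h : ContDiff ℝ ∞ F) : ContDiff ℝ ∞ (laplace G F) :=
  ContDiff.sum fun _ _ => ContDiff.sum fun _ _ =>
    contDiff_const.mul (contDiff_dz (contDiff_dzbar h _) _)

theorem hasCompactSupport_dz {F : (Fin n → ℂ) → ℂ} (h : HasCompactSupport F) (i : Fin n) :
    HasCompactSupport (dz i F) :=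
  (h.fderiv (𝕜 := ℝ)).mono' fun z hz => by
    contrapose! hz
    have h0 : fderiv ℝ F z = 0 := image_eq_zero_of_notMem_tsupport hz
    simp [dz, h0]

theorem hasCompactSupport_dzbar {F : (Fin n → ℂ) → ℂ} (h : HasCompactSupport F) (i : Fin n) :
    HasCompactSupport (dzbar i F) :=
  (h.fderiv (𝕜 := ℝ)).mono' fun z hz => by
    contrapose! hz
    have h0 : fderiv ℝ F z = 0 := image_eq_zero_of_notMem_tsupport hz
    simp [dzbar, h0]

theorem hasCompactSupport_finsetSum {X ι : Type*} [TopologicalSpace X] (s : Finset ι)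
    {f : ι → X → ℂ} (h : ∀ i ∈ s, HasCompactSupport (f i)) :
    HasCompactSupport (fun x => ∑ i ∈ s, f i x) := by
  classical
  induction s using Finset.induction_on with
  | empty =>
    simp only [Finset.sum_empty]
    exact HasCompactSupport.zero
  | insert a s ha ih =>
    simp only [Finset.sum_insert ha]
    exact (h a (by simp)).add (ih fun i hi => h i (by simp [hi]))

theorem hasCompactSupport_laplace {F : (Fin n → ℂ) → ℂ} (G : Matrix (Fin n) (Fin n) ℂ)
    (h : HasCompactSupport F) : HasCompactSupport (laplace G F) :=
  hasCompactSupport_finsetSum _ fun i _ => hasCompactSupport_finsetSum _ fun j _ =>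
    (hasCompactSupport_dz (hasCompactSupport_dzbar h j) i).mul_left

/-- A real derivative in terms of the Wirtinger derivatives. -/
theorem fderiv_eq_sum_dz (F : (Fin n → ℂ) → ℂ) (w v : Fin n → ℂ) :
    fderiv ℝ F w v = ∑ i, (v i * dz i F w + star (v i) * dzbar i F w) := by
  have hv : v = ∑ i, ((v i).re • (Pi.single i 1 : Fin n → ℂ)
      + (v i).im • (Pi.single i Complex.I : Fin n → ℂ)) := by
    ext j
    simp [Finset.sum_apply, Pi.single_apply, Finset.sum_add_distrib, Complex.re_add_im]
  conv_lhs => rw [hv]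
  rw [map_sum]
  refine Finset.sum_congr rfl fun i _ => ?_
  rw [map_add, map_smul, map_smul]
  set a := fderiv ℝ F w (Pi.single i 1)
  set b := fderiv ℝ F w (Pi.single i Complex.I)
  have h1 : v i = (v i).re + (v i).im * Complex.I := (Complex.re_add_im _).symm
  have h2 : star (v i) = (v i).re - (v i).im * Complex.I := by
    apply Complex.ext <;> simp
  simp only [dz, dzbar, Complex.real_smul, h2]
  linear_combination (-(1 / 2) * (a - Complex.I * b)) * h1 + ((v i).im * b) * Complex.I_sq

theorem fderiv_comp_star {H : (Fin n → ℂ) × (Fin n → ℂ) → ℂ} {z : Fin n → ℂ}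
    (h : DifferentiableAt ℂ H (z, star z)) (v : Fin n → ℂ) :
    fderiv ℝ (fun z => H (z, star z)) z v = fderiv ℂ H (z, star z) (v, star v) := by
  have h1 : HasFDerivAt (fun z : Fin n → ℂ => (z, star z))
      ((ContinuousLinearMap.id ℝ (Fin n → ℂ)).prod
        (((starL' ℝ : (Fin n → ℂ) ≃L[ℝ] (Fin n → ℂ)) : (Fin n → ℂ) →L[ℝ] (Fin n → ℂ)).comp
          (ContinuousLinearMap.id ℝ (Fin n → ℂ)))) z :=
    (hasFDerivAt_id z).prodMk (hasFDerivAt_id z).star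
  have h2 := (h.hasFDerivAt.restrictScalars ℝ).comp z h1
  have h3 := h2.fderiv
  simp only [Function.comp_def] at h3
  rw [h3]
  rfl

/-- For `H` holomorphic, `∂/∂zᵢ` of `z ↦ H(z, z̄)` is the `i`-th derivative in the first
variable. -/
theorem dz_comp_star {H : (Fin n → ℂ) × (Fin n → ℂ) → ℂ} {z : Fin n → ℂ} (i : Fin n)
    (h : DifferentiableAt ℂ H (z, star z)) :
    dz i (fun z => H (z, star z)) z = fderiv ℂ H (z, star z) (Pi.single i 1, 0) := by
  have e1 : ((Pi.single i 1, star (Pi.single i 1)) : (Fin n → ℂ) × (Fin n → ℂ))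
      = (Pi.single i 1, 0) + (0, Pi.single i 1) := by
    simp
  have e2 : ((Pi.single i Complex.I, star (Pi.single i Complex.I)) : (Fin n → ℂ) × (Fin n → ℂ))
      = Complex.I • (Pi.single i 1, 0) - Complex.I • (0, Pi.single i 1) := by
    simp [← Pi.single_smul, ← Pi.single_neg]
  simp only [dz, fderiv_comp_star h, e1, e2, map_add, map_sub, map_smul, smul_eq_mul]
  linear_combination (-(1 / 2) * (fderiv ℂ H (z, star z) (Pi.single i 1, 0)
    - fderiv ℂ H (z, star z) (0, Pi.single i 1))) * Complex.I_sq

theorem dzbar_comp_star {H : (Fin n → ℂ) × (Fin n → ℂ) → ℂ} {z : Fin n → ℂ} (i : Fin n)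
    (h : DifferentiableAt ℂ H (z, star z)) :
    dzbar i (fun z => H (z, star z)) z = fderiv ℂ H (z, star z) (0, Pi.single i 1) := by
  have e1 : ((Pi.single i 1, star (Pi.single i 1)) : (Fin n → ℂ) × (Fin n → ℂ))
      = (Pi.single i 1, 0) + (0, Pi.single i 1) := by
    simp
  have e2 : ((Pi.single i Complex.I, star (Pi.single i Complex.I)) : (Fin n → ℂ) × (Fin n → ℂ))
      = Complex.I • (Pi.single i 1, 0) - Complex.I • (0, Pi.single i 1) := by
    simp [← Pi.single_smul, ← Pi.single_neg]
  simp only [dzbar, fderiv_comp_star h, e1, e2, map_add, map_sub, map_smul, smul_eq_mul]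
  linear_combination ((1 / 2) * (fderiv ℂ H (z, star z) (Pi.single i 1, 0)
    - fderiv ℂ H (z, star z) (0, Pi.single i 1))) * Complex.I_sq

end Wirtinger

/-! ### Gaussian integrals -/

section Gaussian

variable {n : ℕ}

/-- The bilinear form `∑ᵢⱼ Gᵢⱼ pᵢ qⱼ`. -/
noncomputable def bilin (G : Matrix (Fin n) (Fin n) ℂ) (p q : Fin n → ℂ) : ℂ :=
  ∑ i, ∑ j, G i j * p i * q j

/-- The form `∑ᵢⱼ Gᵢⱼ uᵢ ūⱼ`. -/
noncomputable def quad (G : Matrix (Fin n) (Fin n) ℂ) (u : Fin n → ℂ) : ℂ :=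
  ∑ i, ∑ j, G i j * u i * star (u j)

theorem quad_eq_bilin (G : Matrix (Fin n) (Fin n) ℂ) (u : Fin n → ℂ) :
    quad G u = bilin G u (star u) := rfl

theorem norm_bilin_le (G : Matrix (Fin n) (Fin n) ℂ) (p q : Fin n → ℂ) :
    ‖bilin G p q‖ ≤ (∑ i, ∑ j, ‖G i j‖) * ‖p‖ * ‖q‖ := by
  rw [bilin, Finset.sum_mul, Finset.sum_mul]
  refine (norm_sum_le _ _).trans (Finset.sum_le_sum fun i _ => ?_)
  rw [Finset.sum_mul, Finset.sum_mul]
  refine (norm_sum_le _ _).trans (Finset.sum_le_sum fun j _ => ?_)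
  rw [norm_mul, norm_mul]
  gcongr
  · exact norm_le_pi_norm p i
  · exact norm_le_pi_norm q j

theorem isBoundedBilinearMap_bilin (G : Matrix (Fin n) (Fin n) ℂ) :
    IsBoundedBilinearMap ℂ
      (fun p : (Fin n → ℂ) × (Fin n → ℂ) => bilin G p.1 p.2) where
  add_left p p' q := by
    simp only [bilin, ← Finset.sum_add_distrib, Pi.add_apply]
    exact Finset.sum_congr rfl fun i _ => Finset.sum_congr rfl fun j _ => by ring
  smul_left c p q := by
    simp only [bilin, Finset.mul_sum, Pi.smul_apply, smul_eq_mul]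
    exact Finset.sum_congr rfl fun i _ => Finset.sum_congr rfl fun j _ => by ring
  add_right p q q' := by
    simp only [bilin, ← Finset.sum_add_distrib, Pi.add_apply]
    exact Finset.sum_congr rfl fun i _ => Finset.sum_congr rfl fun j _ => by ring
  smul_right c p q := by
    simp only [bilin, Finset.mul_sum, Pi.smul_apply, smul_eq_mul]
    exact Finset.sum_congr rfl fun i _ => Finset.sum_congr rfl fun j _ => by ring
  bound := ⟨(∑ i, ∑ j, ‖G i j‖) + 1, by positivity, fun p q =>
    (norm_bilin_le G p q).trans (by gcongr; linarith)⟩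

theorem quad_smul (G : Matrix (Fin n) (Fin n) ℂ) (t : ℝ) (u : Fin n → ℂ) :
    quad G (t • u) = (t : ℂ) ^ 2 * quad G u := by
  simp only [quad, Finset.mul_sum]
  refine Finset.sum_congr rfl fun i _ => Finset.sum_congr rfl fun j _ => ?_
  simp
  ring

@[fun_prop]
theorem continuous_quad (G : Matrix (Fin n) (Fin n) ℂ) : Continuous (quad G) := by
  unfold quad; fun_prop

theorem bilin_single_left (G : Matrix (Fin n) (Fin n) ℂ) (i : Fin n) (q : Fin n → ℂ) :
    bilin G (Pi.single i 1) q = ∑ j, G i j * q j := by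
  rw [bilin, Finset.sum_eq_single i]
  · simp
  · intro k _ hk
    simp [hk]
  · simp

theorem bilin_single_right (G : Matrix (Fin n) (Fin n) ℂ) (j : Fin n) (p : Fin n → ℂ) :
    bilin G p (Pi.single j 1) = ∑ i, G i j * p i := by
  rw [bilin]
  refine Finset.sum_congr rfl fun i _ => ?_
  rw [Finset.sum_eq_single j]
  · simp
  · intro k _ hk
    simp [hk]
  · simp

theorem hasFDerivAt_exp_bilin (G : Matrix (Fin n) (Fin n) ℂ) (p : (Fin n → ℂ) × (Fin n → ℂ)) :
    HasFDerivAt (fun p : (Fin n → ℂ) × (Fin n → ℂ) => Complex.exp (-bilin G p.1 p.2))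
      (Complex.exp (-bilin G p.1 p.2) • -(isBoundedBilinearMap_bilin G).deriv p) p :=
  ((isBoundedBilinearMap_bilin G).hasFDerivAt p).neg.cexp

theorem fderiv_exp_quad (G : Matrix (Fin n) (Fin n) ℂ) (v w : Fin n → ℂ) :
    fderiv ℝ (fun v => Complex.exp (-quad G v)) v w
      = Complex.exp (-quad G v) * -(bilin G v (star w) + bilin G w (star v)) := by
  have h := hasFDerivAt_exp_bilin G (v, star v)
  have := fderiv_comp_star (z := v) h.differentiableAt w
  simp only [quad_eq_bilin]
  rw [this, h.fderiv]
  simp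
  ring

theorem differentiable_exp_quad (G : Matrix (Fin n) (Fin n) ℂ) :
    Differentiable ℝ (fun v => Complex.exp (-quad G v)) := by
  unfold quad
  fun_prop

/-- Gaussian decay beats any power: `exp x ≥ xᵐ / m!` at `κ (2 + x²)`. -/
theorem exists_exp_mul_pow_le {κ : ℝ} (hκ : 0 < κ) (m : ℕ) :
    ∃ C : ℝ, 0 ≤ C ∧ ∀ x : ℝ, 0 ≤ x → Real.exp (-(κ * x ^ 2)) * (1 + x) ^ m ≤ C := by
  refine ⟨m.factorial / κ ^ m * Real.exp (2 * κ), by positivity, fun x hx => ?_⟩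
  have h1 : 1 + x ≤ 2 + x ^ 2 := by nlinarith [sq_nonneg (x - 1)]
  have h2 : (κ * (2 + x ^ 2)) ^ m / m.factorial ≤ Real.exp (κ * (2 + x ^ 2)) :=
    Real.pow_div_factorial_le_exp _ (by positivity) m
  have h3 : (1 + x) ^ m ≤ m.factorial / κ ^ m * Real.exp (κ * (2 + x ^ 2)) := by
    calc (1 + x) ^ m ≤ (2 + x ^ 2) ^ m := by gcongr
      _ = m.factorial / κ ^ m * ((κ * (2 + x ^ 2)) ^ m / m.factorial) := by
        rw [mul_pow]; field_simp
      _ ≤ _ := by gcongr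
  calc Real.exp (-(κ * x ^ 2)) * (1 + x) ^ m
      ≤ Real.exp (-(κ * x ^ 2)) * (m.factorial / κ ^ m * Real.exp (κ * (2 + x ^ 2))) := by gcongr
    _ = m.factorial / κ ^ m * (Real.exp (-(κ * x ^ 2)) * Real.exp (κ * (2 + x ^ 2))) := by ring
    _ = _ := by rw [← Real.exp_add]; ring_nf

theorem integrable_exp_mul_one_add_pow {κ : ℝ} (hκ : 0 < κ) (j : ℕ) :
    Integrable (fun v : Fin n → ℂ => Real.exp (-(κ * ‖v‖ ^ 2)) * (1 + ‖v‖) ^ j) := by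
  set r : ℕ := Module.finrank ℝ (Fin n → ℂ) + 1
  obtain ⟨C, hC0, hC⟩ := exists_exp_mul_pow_le hκ (j + r)
  have h1 : Integrable (fun v : Fin n → ℂ => (1 + ‖v‖) ^ (-(r : ℝ))) :=
    integrable_one_add_norm (by simp [r])
  refine (h1.const_mul C).mono' ?_ (Eventually.of_forall fun v => ?_)
  · exact Continuous.aestronglyMeasurable (by fun_prop)
  · have hv : 0 ≤ ‖v‖ := norm_nonneg v
    have := hC ‖v‖ hv
    rw [Real.norm_of_nonneg (by positivity), Real.rpow_neg (by positivity), Real.rpow_natCast,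
      ← div_eq_mul_inv, le_div_iff₀ (by positivity), mul_assoc, ← pow_add]
    exact this

theorem norm_exp_neg_quad_le {G : Matrix (Fin n) (Fin n) ℂ} {κ : ℝ}
    (hG : ∀ u, κ * ‖u‖ ^ 2 ≤ (quad G u).re) (v : Fin n → ℂ) :
    ‖Complex.exp (-quad G v)‖ ≤ Real.exp (-(κ * ‖v‖ ^ 2)) := by
  rw [Complex.norm_exp]
  simpa using hG v

theorem integrable_exp_quad_mul {G : Matrix (Fin n) (Fin n) ℂ} {κ : ℝ} (hκ : 0 < κ)
    (hG : ∀ u, κ * ‖u‖ ^ 2 ≤ (quad G u).re) {f : (Fin n → ℂ) → ℂ} (hf : Continuous f) {C : ℝ}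
    {j : ℕ} (hC : ∀ v, ‖f v‖ ≤ C * (1 + ‖v‖) ^ j) :
    Integrable (fun v => Complex.exp (-quad G v) * f v) := by
  refine ((integrable_exp_mul_one_add_pow (n := n) hκ j).const_mul C).mono'
    (Continuous.aestronglyMeasurable (by fun_prop)) (Eventually.of_forall fun v => ?_)
  rw [norm_mul]
  calc _ ≤ Real.exp (-(κ * ‖v‖ ^ 2)) * (C * (1 + ‖v‖) ^ j) := by
        gcongr
        · exact norm_exp_neg_quad_le hG v
        · exact hC v
    _ = _ := by ring

/-- The Gaussian average `∫ exp (-∑ Gᵢⱼ vᵢ v̄ⱼ) F(hv) dv`. -/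
noncomputable def gaussAvg (G : Matrix (Fin n) (Fin n) ℂ) (F : (Fin n → ℂ) → ℂ) (h : ℝ) : ℂ :=
  ∫ v, Complex.exp (-quad G v) * F (h • v)

theorem exists_bound_of_compactSupport {E : Type*} [NormedAddCommGroup E]
    {F : (Fin n → ℂ) → E} (hF : Continuous F) (hc : HasCompactSupport F) :
    ∃ C : ℝ, 0 ≤ C ∧ ∀ v, ‖F v‖ ≤ C := by
  obtain ⟨C, hC⟩ := hc.exists_bound_of_continuous hF
  exact ⟨C, (norm_nonneg _).trans (hC 0), hC⟩

section IBP

variable {G : Matrix (Fin n) (Fin n) ℂ} {κ : ℝ}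

theorem integrable_exp_quad_mul_comp (hκ : 0 < κ) (hG : ∀ u, κ * ‖u‖ ^ 2 ≤ (quad G u).re)
    {g : (Fin n → ℂ) → ℂ} (hg : Continuous g) (hc : HasCompactSupport g) (h : ℝ) :
    Integrable (fun v => Complex.exp (-quad G v) * g (h • v)) := by
  obtain ⟨C, hC0, hC⟩ := exists_bound_of_compactSupport hg hc
  exact integrable_exp_quad_mul (j := 0) hκ hG (by fun_prop) (C := C) (by simpa using fun v => hC _)

theorem integrable_exp_quad_mul_fderiv (hκ : 0 < κ) (hG : ∀ u, κ * ‖u‖ ^ 2 ≤ (quad G u).re)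
    {g : (Fin n → ℂ) → ℂ} (hg : ContDiff ℝ ∞ g) (hc : HasCompactSupport g) (h : ℝ)
    (w : Fin n → ℂ) :
    Integrable (fun v => Complex.exp (-quad G v) * fderiv ℝ g (h • v) w) :=
  integrable_exp_quad_mul_comp hκ hG (g := fun v => fderiv ℝ g v w)
    ((hg.continuous_fderiv (by simp)).clm_apply continuous_const)
    (hc.fderiv_apply (𝕜 := ℝ) w) h

theorem integrable_exp_quad_mul_mul (hκ : 0 < κ) (hG : ∀ u, κ * ‖u‖ ^ 2 ≤ (quad G u).re)
    {f g : (Fin n → ℂ) → ℂ} (hf : Continuous f) {D : ℝ} (hD : ∀ v, ‖f v‖ ≤ D * ‖v‖)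
    (hg : Continuous g) (hc : HasCompactSupport g) (h : ℝ) :
    Integrable (fun v => Complex.exp (-quad G v) * (f v * g (h • v))) := by
  obtain ⟨C, hC0, hC⟩ := exists_bound_of_compactSupport hg hc
  refine integrable_exp_quad_mul (j := 1) hκ hG (by fun_prop) (C := |D| * C) fun v => ?_
  rw [norm_mul]
  calc _ ≤ |D| * ‖v‖ * C := by
        gcongr
        · exact (hD v).trans (by gcongr; exact le_abs_self D)
        · exact hC _
    _ = |D| * C * ‖v‖ := by ring
    _ ≤ _ := by gcongr; simp

theorem norm_bilin_add_bilin_le (v w : Fin n → ℂ) :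
    ‖bilin G v (star w) + bilin G w (star v)‖ ≤ (2 * (∑ i, ∑ j, ‖G i j‖) * ‖w‖) * ‖v‖ := by
  have h1 := norm_bilin_le G v (star w)
  have h2 := norm_bilin_le G w (star v)
  rw [norm_star] at h1 h2
  calc _ ≤ (∑ i, ∑ j, ‖G i j‖) * ‖v‖ * ‖w‖ + (∑ i, ∑ j, ‖G i j‖) * ‖w‖ * ‖v‖ :=
        (norm_add_le _ _).trans (add_le_add h1 h2)
    _ = _ := by ring

@[fun_prop]
theorem continuous_bilin_add_bilin (w : Fin n → ℂ) :
    Continuous fun v : Fin n → ℂ => bilin G v (star w) + bilin G w (star v) := by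
  unfold bilin; fun_prop

/-- Integration by parts against the Gaussian weight, in the real direction `w`. -/
theorem integral_exp_quad_mul_fderiv (hκ : 0 < κ) (hG : ∀ u, κ * ‖u‖ ^ 2 ≤ (quad G u).re)
    {g : (Fin n → ℂ) → ℂ} (hg : ContDiff ℝ ∞ g) (hc : HasCompactSupport g) (h : ℝ)
    (w : Fin n → ℂ) :
    (h : ℂ) * ∫ v, Complex.exp (-quad G v) * fderiv ℝ g (h • v) w
      = ∫ v, Complex.exp (-quad G v) * ((bilin G v (star w) + bilin G w (star v)) * g (h • v)) := by
  have hd : ∀ v, HasFDerivAt (fun v => g (h • v)) (h • fderiv ℝ g (h • v)) v := by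
    intro v
    have h1 := (hg.differentiable (by simp) (h • v)).hasFDerivAt
    have h2 : HasFDerivAt (fun v : Fin n → ℂ => h • v)
        (h • ContinuousLinearMap.id ℝ (Fin n → ℂ)) v := (hasFDerivAt_id v).const_smul h
    exact (HasFDerivAt.comp v h1 h2).congr_fderiv (by ext u; simp)
  have hfd : ∀ v, fderiv ℝ (fun v => g (h • v)) v w = h * fderiv ℝ g (h • v) w := by
    intro v
    rw [(hd v).fderiv]; simp
  have key := integral_mul_fderiv_eq_neg_fderiv_mul_of_integrable (μ := volume)
    (f := fun v => Complex.exp (-quad G v)) (g := fun v => g (h • v)) (v := w)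
    ?_ ?_ ?_ (fun v _ => differentiable_exp_quad G v) (fun v _ => (hd v).differentiableAt)
  · simp only [hfd, fderiv_exp_quad] at key
    rw [← integral_const_mul]
    calc _ = ∫ v, Complex.exp (-quad G v) * (h * fderiv ℝ g (h • v) w) := by
          congr 1; ext v; ring
      _ = _ := key
      _ = _ := by rw [← integral_neg]; congr 1; ext v; ring
  · simp only [fderiv_exp_quad, mul_assoc]
    refine integrable_exp_quad_mul_mul hκ hG (f := fun v => -(bilin G v (star w)
      + bilin G w (star v))) (by fun_prop) (D := 2 * (∑ i, ∑ j, ‖G i j‖) * ‖w‖)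
      (fun v => ?_) hg.continuous hc h
    rw [norm_neg]
    exact norm_bilin_add_bilin_le v w
  · simp only [hfd]
    refine ((integrable_exp_quad_mul_fderiv hκ hG hg hc h w).const_mul (h : ℂ)).congr
      (Eventually.of_forall fun v => ?_)
    simp only
    ring
  · exact integrable_exp_quad_mul_comp hκ hG hg.continuous hc h

theorem star_single_I (i : Fin n) :
    star (Pi.single i Complex.I : Fin n → ℂ) = -(Complex.I • Pi.single i 1) := by
  simp [← Pi.single_smul, ← Pi.single_neg]

theorem bilin_smul_left (c : ℂ) (p q : Fin n → ℂ) : bilin G (c • p) q = c * bilin G p q :=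
  (isBoundedBilinearMap_bilin G).smul_left c p q

theorem bilin_smul_right (c : ℂ) (p q : Fin n → ℂ) : bilin G p (c • q) = c * bilin G p q :=
  (isBoundedBilinearMap_bilin G).smul_right c p q

theorem bilin_single_I (v : Fin n → ℂ) (i : Fin n) :
    bilin G v (star (Pi.single i Complex.I : Fin n → ℂ))
        + bilin G (Pi.single i Complex.I) (star v)
      = Complex.I * ((∑ j, G i j * star (v j)) - ∑ k, G k i * v k) := by
  have h1 : (Pi.single i Complex.I : Fin n → ℂ) = Complex.I • Pi.single i 1 := by
    simp [← Pi.single_smul]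
  rw [star_single_I, h1, ← neg_smul, bilin_smul_right, bilin_smul_left, bilin_single_left,
    bilin_single_right]
  simp only [Pi.star_apply]
  ring

theorem bilin_single_one (v : Fin n → ℂ) (i : Fin n) :
    bilin G v (star (Pi.single i 1 : Fin n → ℂ)) + bilin G (Pi.single i 1) (star v)
      = (∑ j, G i j * star (v j)) + ∑ k, G k i * v k := by
  have h1 : star (Pi.single i 1 : Fin n → ℂ) = Pi.single i 1 := by simp
  rw [h1, bilin_single_left, bilin_single_right]
  simp only [Pi.star_apply]
  ring

/-- Integration by parts against the Gaussian weight for `∂/∂zᵢ`, obtained from the real directions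
`eᵢ` and `i eᵢ`. -/
theorem integral_exp_quad_mul_dz (hκ : 0 < κ) (hG : ∀ u, κ * ‖u‖ ^ 2 ≤ (quad G u).re)
    {g : (Fin n → ℂ) → ℂ} (hg : ContDiff ℝ ∞ g) (hc : HasCompactSupport g) (h : ℝ) (i : Fin n) :
    (h : ℂ) * ∫ v, Complex.exp (-quad G v) * dz i g (h • v)
      = ∫ v, Complex.exp (-quad G v) * ((∑ j, G i j * star (v j)) * g (h • v)) := by
  have h1 := integral_exp_quad_mul_fderiv hκ hG hg hc h (Pi.single i 1)
  have h2 := integral_exp_quad_mul_fderiv hκ hG hg hc h (Pi.single i Complex.I)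
  have i1 := integrable_exp_quad_mul_fderiv hκ hG hg hc h (Pi.single i 1)
  have i2 := integrable_exp_quad_mul_fderiv hκ hG hg hc h (Pi.single i Complex.I)
  have j1 := integrable_exp_quad_mul_mul hκ hG (continuous_bilin_add_bilin (G := G) _)
    (fun v => norm_bilin_add_bilin_le (G := G) v (Pi.single i 1)) hg.continuous hc h
  have j2 := integrable_exp_quad_mul_mul hκ hG (continuous_bilin_add_bilin (G := G) _)
    (fun v => norm_bilin_add_bilin_le (G := G) v (Pi.single i Complex.I)) hg.continuous hc h
  calc _ = (h : ℂ) * ∫ v, (1 / 2) * (Complex.exp (-quad G v) * fderiv ℝ g (h • v) (Pi.single i 1)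
        - Complex.I * (Complex.exp (-quad G v) * fderiv ℝ g (h • v) (Pi.single i Complex.I))) := by
        congr 2; ext v; simp only [dz]; ring
    _ = (1 / 2) * ((∫ v, Complex.exp (-quad G v) *
          ((bilin G v (star (Pi.single i 1)) + bilin G (Pi.single i 1) (star v)) * g (h • v)))
        - Complex.I * ∫ v, Complex.exp (-quad G v) *
          ((bilin G v (star (Pi.single i Complex.I))
            + bilin G (Pi.single i Complex.I) (star v)) * g (h • v))) := by
        rw [← h1, ← h2, integral_const_mul, integral_sub i1 (i2.const_mul _), integral_const_mul]
        ring
    _ = _ := by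
        rw [← integral_const_mul Complex.I, ← integral_sub j1 (j2.const_mul _),
          ← integral_const_mul]
        congr 1; ext v
        rw [bilin_single_I, bilin_single_one]
        linear_combination (-(1 / 2) * Complex.exp (-quad G v) * g (h • v)
          * ((∑ j, G i j * star (v j)) - ∑ k, G k i * v k)) * Complex.I_sq

theorem integral_exp_quad_mul_dzbar (hκ : 0 < κ) (hG : ∀ u, κ * ‖u‖ ^ 2 ≤ (quad G u).re)
    {g : (Fin n → ℂ) → ℂ} (hg : ContDiff ℝ ∞ g) (hc : HasCompactSupport g) (h : ℝ) (i : Fin n) :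
    (h : ℂ) * ∫ v, Complex.exp (-quad G v) * dzbar i g (h • v)
      = ∫ v, Complex.exp (-quad G v) * ((∑ k, G k i * v k) * g (h • v)) := by
  have h1 := integral_exp_quad_mul_fderiv hκ hG hg hc h (Pi.single i 1)
  have h2 := integral_exp_quad_mul_fderiv hκ hG hg hc h (Pi.single i Complex.I)
  have i1 := integrable_exp_quad_mul_fderiv hκ hG hg hc h (Pi.single i 1)
  have i2 := integrable_exp_quad_mul_fderiv hκ hG hg hc h (Pi.single i Complex.I)
  have j1 := integrable_exp_quad_mul_mul hκ hG (continuous_bilin_add_bilin (G := G) _)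
    (fun v => norm_bilin_add_bilin_le (G := G) v (Pi.single i 1)) hg.continuous hc h
  have j2 := integrable_exp_quad_mul_mul hκ hG (continuous_bilin_add_bilin (G := G) _)
    (fun v => norm_bilin_add_bilin_le (G := G) v (Pi.single i Complex.I)) hg.continuous hc h
  calc _ = (h : ℂ) * ∫ v, (1 / 2) * (Complex.exp (-quad G v) * fderiv ℝ g (h • v) (Pi.single i 1)
        + Complex.I * (Complex.exp (-quad G v) * fderiv ℝ g (h • v) (Pi.single i Complex.I))) := by
        congr 2; ext v; simp only [dzbar]; ring
    _ = (1 / 2) * ((∫ v, Complex.exp (-quad G v) *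
          ((bilin G v (star (Pi.single i 1)) + bilin G (Pi.single i 1) (star v)) * g (h • v)))
        + Complex.I * ∫ v, Complex.exp (-quad G v) *
          ((bilin G v (star (Pi.single i Complex.I))
            + bilin G (Pi.single i Complex.I) (star v)) * g (h • v))) := by
        rw [← h1, ← h2, integral_const_mul, integral_add i1 (i2.const_mul _), integral_const_mul]
        ring
    _ = _ := by
        rw [← integral_const_mul Complex.I, ← integral_add j1 (j2.const_mul _),
          ← integral_const_mul]
        congr 1; ext v
        rw [bilin_single_I, bilin_single_one]
        linear_combination ((1 / 2) * Complex.exp (-quad G v) * g (h • v)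
          * ((∑ j, G i j * star (v j)) - ∑ k, G k i * v k)) * Complex.I_sq

/-- Multiplication by `vᵢ` against the Gaussian weight, with `Gⁱʲ` the contravariant inverse. -/
theorem integral_exp_quad_mul_coord (hκ : 0 < κ) (hG : ∀ u, κ * ‖u‖ ^ 2 ≤ (quad G u).re)
    (hdet : IsUnit G.det)
    {g : (Fin n → ℂ) → ℂ} (hg : ContDiff ℝ ∞ g) (hc : HasCompactSupport g) (h : ℝ) (i : Fin n) :
    ∫ v, Complex.exp (-quad G v) * (v i * g (h • v))
      = h * ∑ j, G.transpose⁻¹ i j * ∫ v, Complex.exp (-quad G v) * dzbar j g (h • v) := by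
  have hinv : G.transpose⁻¹ * G.transpose = 1 :=
    Matrix.nonsing_inv_mul _ (by rwa [Matrix.det_transpose])
  have hI : ∀ k, Integrable fun v => Complex.exp (-quad G v) * ((∑ l, G l k * v l) * g (h • v)) :=
    fun k => integrable_exp_quad_mul_mul hκ hG (by fun_prop) (D := ∑ l, ‖G l k‖) (fun v => by
      rw [Finset.sum_mul]
      refine (norm_sum_le _ _).trans (Finset.sum_le_sum fun l _ => ?_)
      rw [norm_mul]; gcongr; exact norm_le_pi_norm v l) hg.continuous hc h
  rw [Finset.mul_sum]
  calc _ = ∫ v, ∑ j, G.transpose⁻¹ i j *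
        (Complex.exp (-quad G v) * ((∑ l, G l j * v l) * g (h • v))) := by
        congr 1; ext v
        have : v i = ∑ j, G.transpose⁻¹ i j * ∑ l, G l j * v l := by
          have h2 := congrFun (congrArg (fun A : Matrix (Fin n) (Fin n) ℂ => A.mulVec v) hinv) i
          simp only [← Matrix.mulVec_mulVec, Matrix.one_mulVec] at h2
          rw [← h2]
          simp [Matrix.mulVec, dotProduct]
        conv_lhs => rw [this]
        rw [Finset.sum_mul, Finset.mul_sum]
        exact Finset.sum_congr rfl fun j _ => by ring
    _ = ∑ j, G.transpose⁻¹ i j *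
        ∫ v, Complex.exp (-quad G v) * ((∑ l, G l j * v l) * g (h • v)) := by
        rw [integral_finsetSum _ fun j _ => (hI j).const_mul _]
        simp_rw [integral_const_mul]
    _ = _ := Finset.sum_congr rfl fun j _ => by
        rw [← integral_exp_quad_mul_dzbar hκ hG hg hc h j]; ring

theorem integral_exp_quad_mul_star_coord (hκ : 0 < κ) (hG : ∀ u, κ * ‖u‖ ^ 2 ≤ (quad G u).re)
    (hdet : IsUnit G.det)
    {g : (Fin n → ℂ) → ℂ} (hg : ContDiff ℝ ∞ g) (hc : HasCompactSupport g) (h : ℝ) (j : Fin n) :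
    ∫ v, Complex.exp (-quad G v) * (star (v j) * g (h • v))
      = h * ∑ i, G.transpose⁻¹ i j * ∫ v, Complex.exp (-quad G v) * dz i g (h • v) := by
  have hinv : G.transpose * G.transpose⁻¹ = 1 :=
    Matrix.mul_nonsing_inv _ (by rwa [Matrix.det_transpose])
  have hI : ∀ k, Integrable fun v =>
      Complex.exp (-quad G v) * ((∑ l, G k l * star (v l)) * g (h • v)) :=
    fun k => integrable_exp_quad_mul_mul hκ hG (by fun_prop) (D := ∑ l, ‖G k l‖) (fun v => by
      rw [Finset.sum_mul]
      refine (norm_sum_le _ _).trans (Finset.sum_le_sum fun l _ => ?_)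
      rw [norm_mul, norm_star]; gcongr; exact norm_le_pi_norm v l) hg.continuous hc h
  rw [Finset.mul_sum]
  calc _ = ∫ v, ∑ i, G.transpose⁻¹ i j *
        (Complex.exp (-quad G v) * ((∑ l, G i l * star (v l)) * g (h • v))) := by
        congr 1; ext v
        have : star (v j) = ∑ i, G.transpose⁻¹ i j * ∑ l, G i l * star (v l) := by
          have h2 := congrFun (congrArg
            (fun A : Matrix (Fin n) (Fin n) ℂ => A.vecMul (star v)) hinv) j
          simp only [← Matrix.vecMul_vecMul, Matrix.vecMul_one] at h2
          rw [← Pi.star_apply, ← h2]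
          simp [Matrix.vecMul, dotProduct, mul_comm]
        conv_lhs => rw [this]
        rw [Finset.sum_mul, Finset.mul_sum]
        exact Finset.sum_congr rfl fun j _ => by ring
    _ = ∑ i, G.transpose⁻¹ i j *
        ∫ v, Complex.exp (-quad G v) * ((∑ l, G i l * star (v l)) * g (h • v)) := by
        rw [integral_finsetSum _ fun j _ => (hI j).const_mul _]
        simp_rw [integral_const_mul]
    _ = _ := Finset.sum_congr rfl fun j _ => by
        rw [← integral_exp_quad_mul_dz hκ hG hg hc h j]; ring

end IBP

end Gaussian

section Heat

variable {n : ℕ} {G : Matrix (Fin n) (Fin n) ℂ} {κ : ℝ}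

theorem fderiv_fderiv_apply {F : (Fin n → ℂ) → ℂ} (hF : ContDiff ℝ ∞ F) (a b z : Fin n → ℂ) :
    fderiv ℝ (fun z => fderiv ℝ F z a) z b = fderiv ℝ (fderiv ℝ F) z b a := by
  have h1 : DifferentiableAt ℝ (fderiv ℝ F) z :=
    (hF.fderiv_right (m := ∞) (by simp)).differentiable (by simp) z
  rw [fderiv_clm_apply h1 (by fun_prop)]
  simp

theorem dz_dzbar_comm {F : (Fin n → ℂ) → ℂ} (hF : ContDiff ℝ ∞ F) (i j : Fin n) :
    dz i (dzbar j F) = dzbar j (dz i F) := by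
  have hd : ∀ a, Differentiable ℝ fun z => fderiv ℝ F z a := fun a =>
    ((hF.fderiv_right (m := ∞) (by simp)).clm_apply contDiff_const).differentiable (by simp)
  have hsymm : ∀ z a b, fderiv ℝ (fderiv ℝ F) z a b = fderiv ℝ (fderiv ℝ F) z b a := fun z a b =>
    (hF.contDiffAt.isSymmSndFDerivAt (by
      rw [minSmoothness_of_isRCLikeNormedField]; exact WithTop.coe_le_coe.2 le_top)) a b
  have e1 : ∀ z b, fderiv ℝ (dz i F) z b = (1 / 2) * (fderiv ℝ (fderiv ℝ F) z b (Pi.single i 1)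
      - Complex.I * fderiv ℝ (fderiv ℝ F) z b (Pi.single i Complex.I)) := by
    intro z b
    have := (((hd (Pi.single i 1)) z).hasFDerivAt.sub
      (((hd (Pi.single i Complex.I)) z).hasFDerivAt.const_mul Complex.I)).const_mul (1 / 2)
    change fderiv ℝ (fun z => (1 / 2) * (fderiv ℝ F z (Pi.single i 1)
      - Complex.I * fderiv ℝ F z (Pi.single i Complex.I))) z b = _
    erw [this.fderiv]
    simp [fderiv_fderiv_apply hF]
  have e2 : ∀ z b, fderiv ℝ (dzbar j F) z b = (1 / 2) * (fderiv ℝ (fderiv ℝ F) z b (Pi.single j 1)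
      + Complex.I * fderiv ℝ (fderiv ℝ F) z b (Pi.single j Complex.I)) := by
    intro z b
    have := (((hd (Pi.single j 1)) z).hasFDerivAt.add
      (((hd (Pi.single j Complex.I)) z).hasFDerivAt.const_mul Complex.I)).const_mul (1 / 2)
    change fderiv ℝ (fun z => (1 / 2) * (fderiv ℝ F z (Pi.single j 1)
      + Complex.I * fderiv ℝ F z (Pi.single j Complex.I))) z b = _
    erw [this.fderiv]
    simp [fderiv_fderiv_apply hF]
    ring
  ext z
  rw [dz, dzbar, e1, e1, e2, e2, hsymm z (Pi.single j 1), hsymm z (Pi.single j 1),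
    hsymm z (Pi.single j Complex.I), hsymm z (Pi.single j Complex.I)]
  ring

/-- The Gaussian average, as a function of the scale, satisfies the heat equation: the derivative
of `F(hv)` in `h` is `∑ (vᵢ ∂F/∂zᵢ + v̄ᵢ ∂F/∂z̄ᵢ)(hv)`, and integrating by parts each of the two
sums gives the average of `h ΔF`. -/
theorem hasDerivAt_gaussAvg (hκ : 0 < κ) (hG : ∀ u, κ * ‖u‖ ^ 2 ≤ (quad G u).re)
    (hdet : IsUnit G.det) {F : (Fin n → ℂ) → ℂ} (hF : ContDiff ℝ ∞ F) (hc : HasCompactSupport F)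
    (h : ℝ) : HasDerivAt (gaussAvg G F) (2 * h * gaussAvg G (laplace G F) h) h := by
  have hF' : Continuous (fderiv ℝ F) := hF.continuous_fderiv (by simp)
  obtain ⟨D, hD0, hD⟩ := exists_bound_of_compactSupport hF' (hc.fderiv (𝕜 := ℝ))
  have key := (hasDerivAt_integral_of_dominated_loc_of_deriv_le (μ := volume) (x₀ := h)
    (F := fun (h : ℝ) (v : Fin n → ℂ) => Complex.exp (-quad G v) * F (h • v))
    (F' := fun (h : ℝ) (v : Fin n → ℂ) => Complex.exp (-quad G v) * fderiv ℝ F (h • v) v)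
    (bound := fun v => D * (Real.exp (-(κ * ‖v‖ ^ 2)) * (1 + ‖v‖) ^ 1)) (s := univ) univ_mem
    (Eventually.of_forall fun t =>
      (integrable_exp_quad_mul_comp hκ hG hF.continuous hc t).aestronglyMeasurable)
    (integrable_exp_quad_mul_comp hκ hG hF.continuous hc h)
    (Continuous.aestronglyMeasurable (by fun_prop))
    (Eventually.of_forall fun v t _ => ?_)
    ((integrable_exp_mul_one_add_pow hκ 1).const_mul D)
    (Eventually.of_forall fun v t _ => ?_)).2
  · refine HasDerivAt.congr_deriv (f := gaussAvg G F) key (Eq.symm ?_)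
    have hz : ∀ i, Integrable fun v => Complex.exp (-quad G v) * (v i * dz i F (h • v)) :=
      fun i => integrable_exp_quad_mul_mul hκ hG (by fun_prop) (D := 1)
        (fun v => by rw [one_mul]; exact norm_le_pi_norm v i) (contDiff_dz hF i).continuous
        (hasCompactSupport_dz hc i) h
    have hzb : ∀ i, Integrable fun v =>
        Complex.exp (-quad G v) * (star (v i) * dzbar i F (h • v)) :=
      fun i => integrable_exp_quad_mul_mul hκ hG (by fun_prop) (D := 1)
        (fun v => by rw [one_mul, norm_star]; exact norm_le_pi_norm v i)
        (contDiff_dzbar hF i).continuous (hasCompactSupport_dzbar hc i) h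
    have hzz : ∀ i j, Integrable fun v => Complex.exp (-quad G v) * dz i (dzbar j F) (h • v) :=
      fun i j => integrable_exp_quad_mul_comp hκ hG
        (contDiff_dz (contDiff_dzbar hF j) i).continuous
        (hasCompactSupport_dz (hasCompactSupport_dzbar hc j) i) h
    obtain ⟨H, hH⟩ : ∃ H : Fin n → Fin n → ℂ, H = G.transpose⁻¹ := ⟨_, rfl⟩
    have e1 : gaussAvg G (laplace G F) h = ∑ i, ∑ j, H i j *
        ∫ v, Complex.exp (-quad G v) * dz i (dzbar j F) (h • v) := by
      have : ∀ v, Complex.exp (-quad G v) * laplace G F (h • v) = ∑ i, ∑ j,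
          H i j * (Complex.exp (-quad G v) * dz i (dzbar j F) (h • v)) := by
        intro v
        simp only [laplace, Finset.mul_sum, hH]
        exact Finset.sum_congr rfl fun i _ => Finset.sum_congr rfl fun j _ => by ring
      simp only [gaussAvg, this]
      rw [integral_finsetSum Finset.univ fun i _ => integrable_finsetSum Finset.univ
        fun j _ => (hzz i j).const_mul (H i j)]
      refine Finset.sum_congr rfl fun i _ => ?_
      rw [integral_finsetSum Finset.univ fun j _ => (hzz i j).const_mul (H i j)]
      exact Finset.sum_congr rfl fun j _ => integral_const_mul _ _
    have e2 : ∀ i, ∫ v, Complex.exp (-quad G v) * (v i * dz i F (h • v)) = h * ∑ j,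
        H i j * ∫ v, Complex.exp (-quad G v) * dz i (dzbar j F) (h • v) := by
      intro i
      rw [integral_exp_quad_mul_coord hκ hG hdet (contDiff_dz hF i) (hasCompactSupport_dz hc i), hH]
      simp only [dz_dzbar_comm hF]
    have e3 : ∀ j, ∫ v, Complex.exp (-quad G v) * (star (v j) * dzbar j F (h • v)) = h * ∑ i,
        H i j * ∫ v, Complex.exp (-quad G v) * dz i (dzbar j F) (h • v) := by
      intro j
      rw [hH]
      exact integral_exp_quad_mul_star_coord hκ hG hdet (contDiff_dzbar hF j)
        (hasCompactSupport_dzbar hc j) h j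
    calc 2 * h * gaussAvg G (laplace G F) h
        = (∑ i, ∫ v, Complex.exp (-quad G v) * (v i * dz i F (h • v)))
          + ∑ i, ∫ v, Complex.exp (-quad G v) * (star (v i) * dzbar i F (h • v)) := by
          rw [Finset.sum_congr rfl fun i _ => e2 i, Finset.sum_congr rfl fun j _ => e3 j,
            ← Finset.mul_sum, ← Finset.mul_sum, Finset.sum_comm (s := Finset.univ)
            (t := Finset.univ) (f := fun j i => H i j *
              ∫ v, Complex.exp (-quad G v) * dz i (dzbar j F) (h • v)), ← e1]
          ring
      _ = ∫ v, ∑ i, (Complex.exp (-quad G v) * (v i * dz i F (h • v))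
            + Complex.exp (-quad G v) * (star (v i) * dzbar i F (h • v))) := by
          have := integral_finsetSum (μ := volume) Finset.univ
            fun i (_ : i ∈ Finset.univ) => (hz i).add (hzb i)
          simp only [Pi.add_apply] at this
          rw [← Finset.sum_add_distrib, this]
          exact Finset.sum_congr rfl fun i _ => (integral_add (hz i) (hzb i)).symm
      _ = _ := by
          congr 1; ext v
          rw [fderiv_eq_sum_dz, Finset.mul_sum]
          exact Finset.sum_congr rfl fun i _ => by ring
  · rw [norm_mul]
    calc _ ≤ Real.exp (-(κ * ‖v‖ ^ 2)) * (D * ‖v‖) := by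
          gcongr
          · exact norm_exp_neg_quad_le hG v
          · exact (ContinuousLinearMap.le_opNorm _ _).trans (by gcongr; exact hD _)
      _ = D * (Real.exp (-(κ * ‖v‖ ^ 2)) * ‖v‖) := by ring
      _ ≤ _ := by gcongr; simp
  · have h1 := (hF.differentiable (by simp) (t • v)).hasFDerivAt
    have h2 : HasDerivAt (fun t : ℝ => t • v) v t := by
      simpa using (hasDerivAt_id t).smul_const v
    exact (h1.comp_hasDerivAt t h2).const_mul _

/-- Expansion of a Gaussian average in powers of the scale: iterate the heat equation. -/
theorem norm_gaussAvg_sub_le (hκ : 0 < κ) (hG : ∀ u, κ * ‖u‖ ^ 2 ≤ (quad G u).re)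
    (hdet : IsUnit G.det) {F : (Fin n → ℂ) → ℂ} (hF : ContDiff ℝ ∞ F) (hc : HasCompactSupport F)
    (P : ℕ) {B : ℝ} (hB : ∀ u, ‖(laplace G)^[P] F u‖ ≤ B) {h : ℝ} (hh : 0 ≤ h) :
    ‖gaussAvg G F h - (∫ v, Complex.exp (-quad G v)) *
        ∑ p ∈ Finset.range P, (h : ℂ) ^ (2 * p) * ((laplace G)^[p] F 0 / p.factorial)‖
      ≤ (∫ v : Fin n → ℂ, Real.exp (-(κ * ‖v‖ ^ 2))) * B * h ^ (2 * P) / P.factorial := by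
  induction P generalizing F h with
  | zero =>
    simp only [Finset.range_zero, Finset.sum_empty, mul_zero, sub_zero, pow_zero, mul_one,
      Nat.factorial_zero, Nat.cast_one, div_one]
    have hi : Integrable fun v : Fin n → ℂ => Real.exp (-(κ * ‖v‖ ^ 2)) := by
      simpa using integrable_exp_mul_one_add_pow (n := n) hκ 0
    rw [gaussAvg, ← integral_mul_const]
    refine norm_integral_le_of_norm_le (hi.mul_const B) (Eventually.of_forall fun v => ?_)
    rw [norm_mul]
    gcongr
    · exact norm_exp_neg_quad_le hG v
    · exact hB _
  | succ P ih =>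
    set Z := ∫ v, Complex.exp (-quad G v)
    set Y := ∫ v : Fin n → ℂ, Real.exp (-(κ * ‖v‖ ^ 2))
    have ih' := fun {t : ℝ} (ht : 0 ≤ t) => ih (contDiff_laplace G hF)
      (hasCompactSupport_laplace G hc)
      (fun u => by rw [← Function.iterate_succ_apply]; exact hB u) ht
    set D : ℝ → ℂ := fun t => gaussAvg G F t - Z *
        ∑ p ∈ Finset.range (P + 1), (t : ℂ) ^ (2 * p) * ((laplace G)^[p] F 0 / p.factorial)
    have hD : ∀ t, HasDerivAt D (2 * t * (gaussAvg G (laplace G F) t - Z *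
        ∑ p ∈ Finset.range P, (t : ℂ) ^ (2 * p) *
          ((laplace G)^[p] (laplace G F) 0 / p.factorial))) t := by
      intro t
      have h1 := hasDerivAt_gaussAvg hκ hG hdet hF hc t
      have h2 : HasDerivAt (fun t : ℝ => ∑ p ∈ Finset.range (P + 1),
          (t : ℂ) ^ (2 * p) * ((laplace G)^[p] F 0 / p.factorial))
          (∑ p ∈ Finset.range (P + 1), (((2 * p : ℕ) : ℂ) * (t : ℂ) ^ (2 * p - 1))
            * ((laplace G)^[p] F 0 / p.factorial)) t := by
        refine HasDerivAt.fun_sum fun p _ => HasDerivAt.mul_const ?_ _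
        have := (hasDerivAt_id t).ofReal_comp.fun_pow (2 * p)
        simp only [id, mul_one, Complex.ofReal_one] at this
        exact this
      refine (h1.sub (h2.const_mul Z)).congr_deriv ?_
      rw [Finset.sum_range_succ', mul_sub]
      congr 1
      simp only [mul_zero, Nat.cast_zero, zero_mul, add_zero]
      rw [Finset.mul_sum, Finset.mul_sum, Finset.mul_sum]
      refine Finset.sum_congr rfl fun p _ => ?_
      rw [Function.iterate_succ_apply, Nat.factorial_succ,
        show 2 * (p + 1) - 1 = 2 * p + 1 by omega]
      have : ((p : ℂ) + 1) ≠ 0 := Nat.cast_add_one_ne_zero p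
      have : ((p.factorial : ℕ) : ℂ) ≠ 0 := by exact_mod_cast p.factorial_ne_zero
      push_cast
      field_simp
      ring
    have hY : ∀ t : ℝ, HasDerivAt (fun t : ℝ => Y * B * t ^ (2 * (P + 1)) / (P + 1).factorial)
        (2 * t * (Y * B * t ^ (2 * P) / P.factorial)) t := by
      intro t
      have := (((hasDerivAt_id t).pow (2 * (P + 1))).const_mul (Y * B)).div_const
        ((P + 1).factorial : ℝ)
      refine this.congr_deriv ?_
      rw [Nat.factorial_succ, show 2 * (P + 1) - 1 = 2 * P + 1 by omega]
      have : ((P : ℝ) + 1) ≠ 0 := Nat.cast_add_one_ne_zero P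
      have : ((P.factorial : ℕ) : ℝ) ≠ 0 := by exact_mod_cast P.factorial_ne_zero
      simp only [id]
      push_cast
      field_simp
      ring
    have h0 : D 0 = 0 := by
      simp only [D]
      rw [Finset.sum_range_succ']
      simp [gaussAvg, Z, integral_mul_const]
    exact image_norm_le_of_norm_deriv_right_le_deriv_boundary (f := D) (a := 0) (b := h)
      (fun t _ => (hD t).continuousAt.continuousWithinAt)
      (fun t _ => (hD t).hasDerivWithinAt) (by simp [h0]) hY
      (fun t ht => by
        rw [norm_mul, norm_mul, Complex.norm_real, Complex.norm_ofNat, Real.norm_of_nonneg ht.1]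
        exact mul_le_mul_of_nonneg_left (ih' ht.1) (by linarith [ht.1])) ⟨hh, le_rfl⟩

end Heat

section GaussianValue

variable {n : ℕ}

open scoped MatrixOrder Matrix.Norms.L2Operator in
theorem exists_conjTranspose_mul_self {A : Matrix (Fin n) (Fin n) ℂ} (hA : A.PosDef) :
    ∃ B : Matrix (Fin n) (Fin n) ℂ, A = B.conjTranspose * B := by
  have h : 0 ≤ A := hA.posSemidef.nonneg
  obtain ⟨B, hB⟩ := CStarAlgebra.nonneg_iff_eq_star_mul_self.1 h
  exact ⟨B, hB⟩

theorem quad_eq_dotProduct (G : Matrix (Fin n) (Fin n) ℂ) (u : Fin n → ℂ) :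
    quad G u = dotProduct (star (star u)) (G.mulVec (star u)) := by
  simp only [quad, dotProduct, Matrix.mulVec, star_star, Finset.mul_sum, Pi.star_apply]
  exact Finset.sum_congr rfl fun i _ => Finset.sum_congr rfl fun j _ => by ring

theorem quad_re_pos {G : Matrix (Fin n) (Fin n) ℂ} (hG : G.PosDef) {u : Fin n → ℂ} (hu : u ≠ 0) :
    0 < (quad G u).re := by
  have h := hG.dotProduct_mulVec_pos (x := star u) (by simpa using hu)
  rw [← quad_eq_dotProduct] at h
  exact (Complex.pos_iff.1 h).1

/-- Positive definite forms depending continuously on a parameter in a compact set are uniformly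
positive definite. -/
theorem exists_quad_lower_bound {Z : Type*} [TopologicalSpace Z] {K : Set Z} (hK : IsCompact K)
    {G : Z → Matrix (Fin n) (Fin n) ℂ} (hc : ∀ i j, ContinuousOn (fun z => G z i j) K)
    (hG : ∀ z ∈ K, (G z).PosDef) :
    ∃ κ : ℝ, 0 < κ ∧ ∀ z ∈ K, ∀ u, κ * ‖u‖ ^ 2 ≤ (quad (G z) u).re := by
  have hcont : ContinuousOn (fun p : Z × (Fin n → ℂ) => (quad (G p.1) p.2).re)
      (K ×ˢ Metric.sphere 0 1) := by
    refine Complex.continuous_re.comp_continuousOn ?_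
    unfold quad
    refine continuousOn_finsetSum _ fun i _ => continuousOn_finsetSum _ fun j _ => ?_
    refine ((?_ : ContinuousOn _ _).mul (by fun_prop)).mul (by fun_prop)
    exact (hc i j).comp continuousOn_fst fun p hp => hp.1
  obtain ⟨κ, hκ, h⟩ := (hK.prod (isCompact_sphere (0 : Fin n → ℂ) 1)).exists_forall_le' hcont
    (a := 0) fun p hp => quad_re_pos (hG _ hp.1) (by
      have := hp.2
      intro h0
      simp [h0] at this)
  refine ⟨κ, hκ, fun z hz u => ?_⟩
  by_cases hu : u = 0
  · simp [hu, quad]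
  have hu' : 0 < ‖u‖ := norm_pos_iff.2 hu
  have h1 := h (z, ‖u‖⁻¹ • u) ⟨hz, by simp [norm_smul, hu'.ne']⟩
  have h2 : quad (G z) u = ((‖u‖ : ℝ) : ℂ) ^ 2 * quad (G z) (‖u‖⁻¹ • u) := by
    rw [← quad_smul, smul_smul, mul_inv_cancel₀ hu'.ne', one_smul]
  rw [h2, ← Complex.ofReal_pow, Complex.re_ofReal_mul, mul_comm]
  gcongr

theorem integral_comp_linearMap {f : (Fin n → ℂ) →ₗ[ℝ] (Fin n → ℂ)} (hf : LinearMap.det f ≠ 0)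
    {g : (Fin n → ℂ) → ℂ} (hg : Continuous g) :
    ∫ v, g (f v) = ((|LinearMap.det f|⁻¹ : ℝ) : ℂ) * ∫ v, g v := by
  have h := Measure.map_linearMap_addHaar_eq_smul_addHaar (volume : Measure (Fin n → ℂ)) hf
  rw [← integral_map (f := g) (LinearMap.continuous_of_finiteDimensional f).measurable.aemeasurable
    hg.aestronglyMeasurable, h, integral_smul_measure, ENNReal.toReal_ofReal (abs_nonneg _),
    abs_inv, Complex.real_smul]

theorem integral_complex_exp_neg_normSq :
    ∫ z : ℂ, Complex.exp (-(z * star z)) = Real.pi := by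
  have h1 : ∀ z : ℂ, Complex.exp (-(z * star z)) = ((Real.exp (-‖z‖ ^ (2 : ℝ)) : ℝ) : ℂ) := by
    intro z
    have : z * star z = ((‖z‖ ^ 2 : ℝ) : ℂ) := by
      simpa using Complex.mul_conj' z
    rw [this, Complex.ofReal_exp]
    simp
  simp_rw [h1]
  rw [integral_complex_ofReal, Complex.integral_exp_neg_rpow (by norm_num)]
  norm_num [Real.Gamma_two]

/-- The value of the Gaussian integral. The change of variables `w = B v`, with `Gᵀ = Bᴴ B`, has
real Jacobian `|det B|² = det G`. -/
theorem integral_exp_neg_quad {G : Matrix (Fin n) (Fin n) ℂ} (hG : G.PosDef) :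
    ∫ v, Complex.exp (-quad G v) = (Real.pi : ℂ) ^ n / G.det := by
  obtain ⟨B, hB⟩ := exists_conjTranspose_mul_self hG.transpose
  have hdet : G.det = ((Complex.normSq B.det : ℝ) : ℂ) := by
    rw [← Matrix.det_transpose, hB, Matrix.det_mul, Matrix.det_conjTranspose,
      Complex.normSq_eq_conj_mul_self]
    rfl
  have hB0 : Complex.normSq B.det ≠ 0 := by
    intro h0
    have := hG.det_pos
    rw [hdet, h0] at this
    simp at this
  set f : (Fin n → ℂ) →ₗ[ℝ] (Fin n → ℂ) := (Matrix.toLin' B).restrictScalars ℝ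
  have hf : LinearMap.det f = Complex.normSq B.det := by
    rw [LinearMap.det_restrictScalars, LinearMap.det_toLin', Algebra.norm_complex_apply]
  have hq : ∀ v, Complex.exp (-quad G v)
      = (fun w : Fin n → ℂ => ∏ i, Complex.exp (-(w i * star (w i)))) (f v) := by
    intro v
    simp only
    rw [← Complex.exp_sum]
    congr 1
    rw [Finset.sum_neg_distrib, neg_inj]
    have : quad G v = dotProduct (star v) (G.transpose.mulVec v) := by
      simp only [quad, dotProduct, Matrix.mulVec, Finset.mul_sum, Pi.star_apply,
        Matrix.transpose_apply]
      rw [Finset.sum_comm]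
      exact Finset.sum_congr rfl fun i _ => Finset.sum_congr rfl fun j _ => by ring
    rw [this, hB, ← Matrix.mulVec_mulVec, Matrix.dotProduct_mulVec, ← Matrix.star_mulVec]
    simp [dotProduct, f, mul_comm]
  rw [integral_congr_ae (Eventually.of_forall hq), integral_comp_linearMap (f := f)
    (g := fun w : Fin n → ℂ => ∏ i, Complex.exp (-(w i * star (w i))))
    (by rw [hf]; exact hB0) (by fun_prop), hf,
    integral_fintype_prod_volume_eq_prod (𝕜 := ℂ) (E := fun _ : Fin n => ℂ)
      (fun _ z => Complex.exp (-(z * star z)))]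
  rw [Finset.prod_const, integral_complex_exp_neg_normSq, hdet,
    abs_of_nonneg (Complex.normSq_nonneg _)]
  simp [div_eq_inv_mul]

/-- A real linear map that carries one positive Hermitian form to another has the ratio of the
determinants as its real Jacobian: compare the two Gaussian integrals. -/
theorem det_eq_abs_det_mul_of_quad_comp {G G' : Matrix (Fin n) (Fin n) ℂ} (hG : G.PosDef)
    (hG' : G'.PosDef) {f : (Fin n → ℂ) →ₗ[ℝ] (Fin n → ℂ)} (hf : LinearMap.det f ≠ 0)
    (h : ∀ u, quad G u = quad G' (f u)) :
    G.det = ((|LinearMap.det f| : ℝ) : ℂ) * G'.det := by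
  have h1 := integral_exp_neg_quad hG
  have h2 := integral_exp_neg_quad hG'
  simp_rw [h] at h1
  rw [integral_comp_linearMap (g := fun v => Complex.exp (-quad G' v)) hf (by fun_prop), h2] at h1
  have hp : (Real.pi : ℂ) ^ n ≠ 0 := pow_ne_zero _ (by exact_mod_cast Real.pi_ne_zero)
  have hd : G.det ≠ 0 := hG.det_pos.ne'
  have hd' : G'.det ≠ 0 := hG'.det_pos.ne'
  have ha : ((|LinearMap.det f| : ℝ) : ℂ) ≠ 0 := by exact_mod_cast abs_ne_zero.2 hf
  rw [Complex.ofReal_inv] at h1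
  field_simp at h1
  exact h1

theorem finrank_real_pi_complex : Module.finrank ℝ (Fin n → ℂ) = 2 * n := by
  rw [Module.finrank_pi_fintype]
  simp [mul_comm]

theorem integral_scale {E : Type*} [NormedAddCommGroup E] [NormedSpace ℝ E]
    (f : (Fin n → ℂ) → E) {h : ℝ} (hh : 0 < h) :
    ∫ u, f u = h ^ (2 * n) • ∫ v, f (h • v) := by
  rw [Measure.integral_comp_smul, finrank_real_pi_complex, abs_of_nonneg (by positivity), smul_smul,
    mul_inv_cancel₀ (by positivity), one_smul]

theorem integral_exp_quad_scaled (G : Matrix (Fin n) (Fin n) ℂ) (F : (Fin n → ℂ) → ℂ) {k h : ℝ}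
    (hh : 0 < h) (hk : k * h ^ 2 = 1) :
    (k : ℂ) ^ n * ∫ u, Complex.exp (-(k * quad G u)) * F u = gaussAvg G F h := by
  rw [integral_scale _ hh, gaussAvg, Complex.real_smul, ← mul_assoc]
  have : (k : ℂ) ^ n * ((h ^ (2 * n) : ℝ) : ℂ) = 1 := by
    rw [pow_mul, ← Complex.ofReal_pow, ← Complex.ofReal_mul, ← mul_pow, hk]; simp
  rw [this, one_mul]
  congr 1; ext v
  rw [quad_smul, ← mul_assoc, ← Complex.ofReal_pow, ← Complex.ofReal_mul, hk]
  simp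

theorem integral_exp_norm_scaled (κ : ℝ) (j : ℕ) {k h : ℝ} (hh : 0 < h) (hk : k * h ^ 2 = 1) :
    k ^ n * ∫ u : Fin n → ℂ, Real.exp (-(k * (κ * ‖u‖ ^ 2))) * ‖u‖ ^ j
      = h ^ j * ∫ u : Fin n → ℂ, Real.exp (-(κ * ‖u‖ ^ 2)) * ‖u‖ ^ j := by
  rw [integral_scale _ hh, smul_eq_mul, ← mul_assoc]
  have : k ^ n * h ^ (2 * n) = 1 := by
    rw [pow_mul, ← mul_pow, hk]; simp
  rw [this, one_mul, ← integral_const_mul]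
  congr 1; ext v
  rw [norm_smul, Real.norm_of_nonneg hh.le]
  have : k * (κ * (h * ‖v‖) ^ 2) = (k * h ^ 2) * (κ * ‖v‖ ^ 2) := by ring
  rw [this, hk, one_mul]
  ring

theorem integrable_exp_norm_mul_pow {κ : ℝ} (hκ : 0 < κ) (j : ℕ) :
    Integrable fun u : Fin n → ℂ => Real.exp (-(κ * ‖u‖ ^ 2)) * ‖u‖ ^ j := by
  refine (integrable_exp_mul_one_add_pow hκ j).mono'
    (Continuous.aestronglyMeasurable (by fun_prop)) (Eventually.of_forall fun v => ?_)
  rw [Real.norm_of_nonneg (by positivity)]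
  gcongr
  simp

/-- The coefficients of an asymptotic expansion in powers of `h²` vanish up to the order of the
function that is expanded. -/
theorem coeff_eq_zero_of_isBigO {a : ℕ → ℂ} {P r : ℕ} {C : ℝ} {h : ℕ → ℝ} (h0 : ∀ i, 0 < h i)
    (hlim : Tendsto h atTop (𝓝 0))
    (H : ∀ i, ‖∑ p ∈ Finset.range P, (h i : ℂ) ^ (2 * p) * a p‖ ≤ C * h i ^ r)
    {p : ℕ} (hp : p < P) (hpr : 2 * p < r) : a p = 0 := by
  induction p using Nat.strong_induction_on with
  | _ p ih =>
    -- the quotient by `h²ᵖ` of what remains of the sum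
    set φ : ℝ → ℂ := fun t =>
      ∑ q ∈ Finset.range P, if q < p then 0 else (t : ℂ) ^ (2 * (q - p)) * a q
    have hφ : ∀ i, ‖φ (h i)‖ ≤ C * h i ^ (r - 2 * p) := by
      intro i
      have h1 : (h i : ℂ) ^ (2 * p) * φ (h i)
          = ∑ p ∈ Finset.range P, (h i : ℂ) ^ (2 * p) * a p := by
        simp only [φ]
        rw [Finset.mul_sum]
        refine Finset.sum_congr rfl fun q hq => ?_
        split_ifs with hqp
        · rw [ih q hqp (Finset.mem_range.1 hq) (by omega)]; simp
        · rw [← mul_assoc, ← pow_add]; congr 2; omega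
      have h2 := H i
      rw [← h1, norm_mul, norm_pow, Complex.norm_real, Real.norm_of_nonneg (h0 i).le] at h2
      have h3 : h i ^ r = h i ^ (2 * p) * h i ^ (r - 2 * p) := by rw [← pow_add]; congr 1; omega
      rw [h3] at h2
      have h4 : 0 < h i ^ (2 * p) := pow_pos (h0 i) _
      refine le_of_mul_le_mul_left ?_ h4
      linarith
    have hcont : Continuous φ := by
      refine continuous_finsetSum _ fun q _ => ?_
      split_ifs <;> fun_prop
    have hφ0 : φ 0 = a p := by
      simp only [φ]
      rw [Finset.sum_eq_single p]
      · simp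
      · intro q _ hq
        split_ifs with hqp
        · rfl
        · have : 2 * (q - p) ≠ 0 := by omega
          simp [this]
      · intro h; exact absurd (Finset.mem_range.2 hp) h
    have l1 : Tendsto (fun i => ‖φ (h i)‖) atTop (𝓝 ‖a p‖) := by
      rw [← hφ0]
      exact ((hcont.tendsto 0).comp hlim).norm
    have l2 : Tendsto (fun i => C * h i ^ (r - 2 * p)) atTop (𝓝 0) := by
      have := (hlim.pow (r - 2 * p)).const_mul C
      rwa [zero_pow (by omega), mul_zero] at this
    exact norm_le_zero_iff.1 (le_of_tendsto_of_tendsto' l1 l2 hφ)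

end GaussianValue

/-! ### Laplace's method, uniformly in a parameter -/

section LaplaceMethod

variable {n : ℕ} {Z : Type*} [NormedAddCommGroup Z] [NormedSpace ℝ Z] {O K : Set Z}
  {G : Z → Matrix (Fin n) (Fin n) ℂ}

theorem contDiffAt_det {z : Z} (hG : ∀ i j, ContDiffAt ℝ ∞ (fun z => G z i j) z) :
    ContDiffAt ℝ ∞ (fun z => (G z).det) z := by
  simp only [Matrix.det_apply]
  refine ContDiffAt.sum fun σ _ => ContDiffAt.const_smul _ (contDiffAt_prod fun i _ => hG _ _)

/-- The entries of the inverse are given by Cramer's rule. -/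
theorem contDiffAt_transpose_inv {z : Z} (hG : ∀ i j, ContDiffAt ℝ ∞ (fun z => G z i j) z)
    (hdet : (G z).det ≠ 0) (i j : Fin n) :
    ContDiffAt ℝ ∞ (fun z => (G z).transpose⁻¹ i j) z := by
  have h1 : (fun z => (G z).transpose⁻¹ i j)
      = fun z => ((G z).det)⁻¹ * ((G z).transpose.updateRow j (Pi.single i 1)).det := by
    ext z
    rw [Matrix.inv_def, Matrix.smul_apply, Matrix.adjugate_apply, Matrix.det_transpose,
      Ring.inverse_eq_inv', smul_eq_mul]
  rw [h1]
  refine ((contDiffAt_det hG).inv hdet).mul (contDiffAt_det fun k l => ?_)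
  by_cases hk : k = j
  · subst hk
    simpa using contDiffAt_const
  · simpa [Matrix.updateRow_apply, hk] using hG l k

theorem iterate_laplace_eq_zero {G : Matrix (Fin n) (Fin n) ℂ} {F : (Fin n → ℂ) → ℂ} {R : ℝ}
    (hF : ∀ u, R < ‖u‖ → F u = 0) (P : ℕ) {u : Fin n → ℂ} (hu : R < ‖u‖) :
    (laplace G)^[P] F u = 0 := by
  have h0 : ∀ G : Matrix (Fin n) (Fin n) ℂ, (laplace G)^[P] 0 = 0 := by
    intro G
    induction P with
    | zero => rfl
    | succ P ih =>
      rw [Function.iterate_succ_apply', ih]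
      ext u
      have : ∀ i : Fin n, dzbar i (0 : (Fin n → ℂ) → ℂ) = 0 := fun i => by
        ext u; simp [dzbar]
      simp only [laplace, this]
      simp [dz]
  have h1 : F =ᶠ[𝓝 u] 0 := by
    filter_upwards [(isOpen_lt continuous_const continuous_norm).mem_nhds hu] with w hw
    exact hF w hw
  rw [(iterate_laplace_eventuallyEq G h1 P).self_of_nhds, h0]
  rfl

/-- `norm_gaussAvg_sub_le`, uniformly in a parameter in a compact set `K`. The support of `F z` is
in a fixed ball, so that `Δᴾ (F z)` is bounded by compactness. -/
theorem gaussAvg_expansion_uniform (hK : IsCompact K) (hKO : K ⊆ O)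
    (hGs : ∀ z ∈ O, ∀ i j, ContDiffAt ℝ ∞ (fun z => G z i j) z) (hG : ∀ z ∈ O, (G z).PosDef)
    {κ : ℝ} (hκ : 0 < κ) (hquad : ∀ z ∈ K, ∀ u, κ * ‖u‖ ^ 2 ≤ (quad (G z) u).re)
    {F : Z → (Fin n → ℂ) → ℂ} (hF : ∀ z ∈ O, ∀ u, ContDiffAt ℝ ∞ (Function.uncurry F) (z, u))
    {R : ℝ} (hR : ∀ z u, R < ‖u‖ → F z u = 0) (P : ℕ) :
    ∃ C : ℝ, ∀ s : ℝ, 0 ≤ s → ∀ z ∈ K,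
      ‖gaussAvg (G z) (F z) s - (Real.pi : ℂ) ^ n / (G z).det *
        ∑ p ∈ Finset.range P, (s : ℂ) ^ (2 * p) * ((laplace (G z))^[p] (F z) 0 / p.factorial)‖
      ≤ C * s ^ (2 * P) := by
  have hinv : ∀ z ∈ O, ∀ i j, ContDiffAt ℝ ∞ (fun z => (G z).transpose⁻¹ i j) z :=
    fun z hz => contDiffAt_transpose_inv (hGs z hz) (hG z hz).det_pos.ne'
  have hcont : ContinuousOn (Function.uncurry fun z => (laplace (G z))^[P] (F z))
      (K ×ˢ Metric.closedBall 0 R) := fun p hp =>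
    (contDiffAt_iterate_laplace (p := p) (hinv _ (hKO hp.1))
      (hF _ (hKO hp.1) _) P).continuousAt.continuousWithinAt
  obtain ⟨B, hB⟩ := (hK.prod (isCompact_closedBall (0 : Fin n → ℂ) R)).exists_bound_of_continuousOn
    hcont
  have hB' : ∀ z ∈ K, ∀ u, ‖(laplace (G z))^[P] (F z) u‖ ≤ |B| := by
    intro z hz u
    by_cases hu : R < ‖u‖
    · rw [iterate_laplace_eq_zero (hR z) P hu]; simp
    · exact (hB (z, u) ⟨hz, by simpa using hu⟩).trans (le_abs_self B)
  refine ⟨(∫ v : Fin n → ℂ, Real.exp (-(κ * ‖v‖ ^ 2))) * |B| / P.factorial, fun s hs z hz => ?_⟩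
  have hsm : ContDiff ℝ ∞ (F z) := by
    rw [contDiff_iff_contDiffAt]
    intro u
    have h2 : ContDiffAt ℝ ∞ (fun u : Fin n → ℂ => (z, u)) u :=
      contDiffAt_const.prodMk contDiffAt_id
    exact ContDiffAt.comp (f := fun u : Fin n → ℂ => (z, u)) u (hF z (hKO hz) u) h2
  have hcs : HasCompactSupport (F z) := by
    refine HasCompactSupport.of_support_subset_isCompact
      (isCompact_closedBall (0 : Fin n → ℂ) R) fun u hu => ?_
    by_contra hu'
    exact hu (hR z u (by simpa using hu'))
  have h := norm_gaussAvg_sub_le hκ (hquad z hz)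
    (isUnit_iff_ne_zero.2 (hG z (hKO hz)).det_pos.ne') hsm hcs P (hB' z hz) hs
  rw [integral_exp_neg_quad (hG z (hKO hz))] at h
  refine h.trans (le_of_eq ?_)
  ring

/-- A function which vanishes to order `r` at the origin, `r > 2p`, is annihilated by `Δᵖ` at the
origin: its Gaussian averages are too small for the expansion to have a term of order `2p`. -/
theorem iterate_laplace_eq_zero_of_norm_le (hK : IsCompact K) (hKO : K ⊆ O)
    (hGs : ∀ z ∈ O, ∀ i j, ContDiffAt ℝ ∞ (fun z => G z i j) z) (hG : ∀ z ∈ O, (G z).PosDef)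
    {κ : ℝ} (hκ : 0 < κ) (hquad : ∀ z ∈ K, ∀ u, κ * ‖u‖ ^ 2 ≤ (quad (G z) u).re)
    {F : Z → (Fin n → ℂ) → ℂ} (hF : ∀ z ∈ O, ∀ u, ContDiffAt ℝ ∞ (Function.uncurry F) (z, u))
    {R : ℝ} (hR : ∀ z u, R < ‖u‖ → F z u = 0) {r : ℕ} {C : ℝ}
    (hC : ∀ z ∈ K, ∀ u, ‖F z u‖ ≤ C * ‖u‖ ^ r) {z : Z} (hz : z ∈ K) {p : ℕ} (hp : 2 * p < r) :
    (laplace (G z))^[p] (F z) 0 = 0 := by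
  obtain ⟨D, hD⟩ := gaussAvg_expansion_uniform hK hKO hGs hG hκ hquad hF hR r
  have hA : ∀ s : ℝ, 0 ≤ s → ‖gaussAvg (G z) (F z) s‖
      ≤ (C * ∫ v : Fin n → ℂ, Real.exp (-(κ * ‖v‖ ^ 2)) * ‖v‖ ^ r) * s ^ r := by
    intro s hs
    have hi := integrable_exp_norm_mul_pow (n := n) hκ r
    rw [gaussAvg]
    refine (norm_integral_le_of_norm_le (hi.const_mul (C * s ^ r))
      (Eventually.of_forall fun v => ?_)).trans (le_of_eq ?_)
    · rw [norm_mul]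
      calc _ ≤ Real.exp (-(κ * ‖v‖ ^ 2)) * (C * ‖s • v‖ ^ r) := by
            gcongr
            · exact norm_exp_neg_quad_le (hquad z hz) v
            · exact hC z hz _
        _ = _ := by rw [norm_smul, Real.norm_of_nonneg hs]; ring
    · rw [integral_const_mul]; ring
  set A := C * ∫ v : Fin n → ℂ, Real.exp (-(κ * ‖v‖ ^ 2)) * ‖v‖ ^ r
  have hdet := (hG z (hKO hz)).det_pos.ne'
  have hpi : (Real.pi : ℂ) ≠ 0 := by exact_mod_cast Real.pi_ne_zero
  have key := coeff_eq_zero_of_isBigO (P := r) (r := r) (C := |D| + |A|)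
    (a := fun p => (Real.pi : ℂ) ^ n / (G z).det *
      ((laplace (G z))^[p] (F z) 0 / p.factorial)) (h := fun i : ℕ => 1 / ((i : ℝ) + 1))
    (fun i => by positivity) tendsto_one_div_add_atTop_nhds_zero_nat ?_ (p := p) (by omega) hp
  · have h1 : ((p.factorial : ℕ) : ℂ) ≠ 0 := by exact_mod_cast p.factorial_ne_zero
    simpa [hdet, hpi, h1] using key
  · intro i
    set s : ℝ := 1 / ((i : ℝ) + 1)
    have hs : 0 ≤ s := by positivity
    have hs1 : s ≤ 1 := by
      rw [div_le_one (by positivity)]; linarith [(Nat.cast_nonneg i : (0 : ℝ) ≤ i)]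
    have h1 := hD s hs z hz
    have h2 := hA s hs
    have h3 : s ^ (2 * r) ≤ s ^ r := pow_le_pow_of_le_one hs hs1 (by omega)
    have e : ∑ p ∈ Finset.range r, (s : ℂ) ^ (2 * p) * ((Real.pi : ℂ) ^ n / (G z).det *
        ((laplace (G z))^[p] (F z) 0 / p.factorial)) = (Real.pi : ℂ) ^ n / (G z).det *
        ∑ p ∈ Finset.range r, (s : ℂ) ^ (2 * p) * ((laplace (G z))^[p] (F z) 0 / p.factorial) := by
      rw [Finset.mul_sum]
      exact Finset.sum_congr rfl fun q _ => by ring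
    rw [e]
    calc _ ≤ ‖gaussAvg (G z) (F z) s‖ + ‖gaussAvg (G z) (F z) s - (Real.pi : ℂ) ^ n / (G z).det *
        ∑ p ∈ Finset.range r, (s : ℂ) ^ (2 * p) *
          ((laplace (G z))^[p] (F z) 0 / p.factorial)‖ := by
          have := norm_sub_le (gaussAvg (G z) (F z) s) (gaussAvg (G z) (F z) s -
            (Real.pi : ℂ) ^ n / (G z).det * ∑ p ∈ Finset.range r, (s : ℂ) ^ (2 * p) *
              ((laplace (G z))^[p] (F z) 0 / p.factorial))
          rwa [sub_sub_cancel] at this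
      _ ≤ A * s ^ r + D * s ^ (2 * r) := add_le_add h2 h1
      _ ≤ |A| * s ^ r + |D| * s ^ r := by gcongr <;> exact le_abs_self _
      _ = _ := by ring

end LaplaceMethod

section LaplaceMethod

variable {n : ℕ}

/-- Rearrangement of the double expansion, in powers `kᵐ` of the exponential and in powers of
`s² = k⁻¹` of the Gaussian averages, by total degree `m - p = -l`. The terms with `p < m`, which
would contribute positive powers of `k`, vanish, and so do those with `m > 2 l` in the degree `-l`. -/
theorem sum_rearrange {k s : ℂ} (hk : k * s ^ 2 = 1) (N : ℕ) {D : ℕ → ℕ → ℂ}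
    (hD : ∀ m p, 2 * p < 3 * m → D m p = 0) :
    ∑ m ∈ Finset.range (2 * (N + 1)), k ^ m / m.factorial *
        ∑ p ∈ Finset.range (m + (N + 1)), s ^ (2 * p) * (D m p / p.factorial)
      = ∑ l ∈ Finset.range (N + 1), k ^ (-(l : ℤ)) *
        ∑ m ∈ Finset.range (2 * l + 1), D m (l + m) / (m.factorial * (l + m).factorial) := by
  have hk0 : k ≠ 0 := by rintro rfl; simp at hk
  have h1 : ∀ m, k ^ m / m.factorial *
        ∑ p ∈ Finset.range (m + (N + 1)), s ^ (2 * p) * (D m p / p.factorial)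
      = ∑ l ∈ Finset.range (N + 1), k ^ (-(l : ℤ)) *
        (D m (l + m) / (m.factorial * (l + m).factorial)) := by
    intro m
    rw [Finset.sum_range_add, Finset.sum_eq_zero, zero_add, Finset.mul_sum]
    · refine Finset.sum_congr rfl fun l _ => ?_
      have e1 : k ^ m * s ^ (2 * (m + l)) = k ^ (-(l : ℤ)) := by
        have : s ^ 2 = k⁻¹ := eq_inv_of_mul_eq_one_right hk
        rw [pow_mul, this, pow_add, ← mul_assoc, ← mul_pow, mul_inv_cancel₀ hk0, one_pow, one_mul,
          zpow_neg, zpow_natCast, inv_pow]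
      rw [← e1, add_comm m l]
      field_simp
    · intro p hp
      have := Finset.mem_range.1 hp
      rw [hD m p (by omega)]; simp
  rw [Finset.sum_congr rfl fun m _ => h1 m, Finset.sum_comm]
  refine Finset.sum_congr rfl fun l hl => ?_
  have := Finset.mem_range.1 hl
  rw [← Finset.mul_sum]
  congr 1
  symm
  refine Finset.sum_subset (Finset.range_mono (by omega)) fun m _ hm => ?_
  rw [Finset.mem_range, not_lt] at hm
  rw [hD m _ (by omega)]; simp

/-- Pointwise bound for the error in replacing `exp(kc)` by its Taylor polynomial, cut off. -/
theorem norm_exp_mul_sub_cutoff_le {k κ x C₃ ε χ : ℝ} {c : ℂ} (hk : 0 ≤ k)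
    (hC₃ : 0 ≤ C₃) (hx : 0 ≤ x)
    (hc3 : ‖c‖ ≤ C₃ * x ^ 3) (hc2 : ‖c‖ ≤ κ / 2 * x ^ 2) (hχ0 : 0 ≤ χ) (hχ1 : χ ≤ 1)
    (hε : 0 < ε) (hχ : x ≤ ε → χ = 1) (M : ℕ) :
    ‖Complex.exp (k * c) - χ * ∑ m ∈ Finset.range M, (k * c) ^ m / m.factorial‖
      ≤ Real.exp (k * (κ / 2 * x ^ 2)) * (ε⁻¹ ^ M * x ^ M + C₃ ^ M * (k ^ M * x ^ (3 * M))) := by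
  have e1 : ‖(k : ℂ) * c‖ ≤ k * (κ / 2 * x ^ 2) := by
    rw [norm_mul, Complex.norm_real, Real.norm_of_nonneg hk]; gcongr
  have e2 : ‖(k : ℂ) * c‖ ^ M ≤ C₃ ^ M * (k ^ M * x ^ (3 * M)) := by
    calc _ ≤ (k * (C₃ * x ^ 3)) ^ M := by
          rw [norm_mul, Complex.norm_real, Real.norm_of_nonneg hk]; gcongr
      _ = _ := by rw [mul_pow, mul_pow, ← pow_mul]; ring
  have e3 : ‖Complex.exp (k * c)‖ ≤ Real.exp (k * (κ / 2 * x ^ 2)) :=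
    (Complex.norm_exp_le_exp_norm _).trans (Real.exp_le_exp.2 e1)
  have e4 : 1 - χ ≤ ε⁻¹ ^ M * x ^ M := by
    by_cases h : x ≤ ε
    · rw [hχ h, sub_self]; positivity
    · have h1 : 1 ≤ ε⁻¹ * x := by
        rw [inv_mul_eq_div, le_div_iff₀ hε]; linarith
      rw [← mul_pow]
      exact (by linarith : 1 - χ ≤ 1).trans (one_le_pow₀ h1)
  have e5 := Complex.norm_exp_sub_sum_le_norm_mul_exp ((k : ℂ) * c) M
  have e6 : Complex.exp (k * c) - χ * ∑ m ∈ Finset.range M, (k * c) ^ m / m.factorial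
      = ((1 - χ : ℝ) : ℂ) * Complex.exp (k * c) + (χ : ℂ) *
        (Complex.exp (k * c) - ∑ m ∈ Finset.range M, (k * c) ^ m / m.factorial) := by
    push_cast; ring
  rw [e6]
  calc _ ≤ (1 - χ) * ‖Complex.exp (k * c)‖ + χ *
        ‖Complex.exp (k * c) - ∑ m ∈ Finset.range M, (k * c) ^ m / m.factorial‖ := by
        refine (norm_add_le _ _).trans (le_of_eq ?_)
        rw [norm_mul, norm_mul, Complex.norm_real, Complex.norm_real, Real.norm_of_nonneg hχ0,
          Real.norm_of_nonneg (by linarith)]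
    _ ≤ (ε⁻¹ ^ M * x ^ M) * Real.exp (k * (κ / 2 * x ^ 2)) + 1 *
        ((C₃ ^ M * (k ^ M * x ^ (3 * M))) * Real.exp (k * (κ / 2 * x ^ 2))) := by
        gcongr
        exact e5.trans (by gcongr)
    _ = _ := by ring

variable {Z : Type*} [NormedAddCommGroup Z] [NormedSpace ℝ Z] {O K : Set Z}
  {G : Z → Matrix (Fin n) (Fin n) ℂ}

/-- **Laplace's method**: the asymptotic expansion of
`(k / 2π)ⁿ 2ⁿ ∫ exp (-k (∑ Gᵢⱼ uᵢ ūⱼ - c(u))) a(u) du`, where `c` is of the third order, uniformly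
with respect to a parameter in a compact set. -/
theorem laplace_expansion_uniform (hK : IsCompact K) (hKO : K ⊆ O)
    (hGs : ∀ z ∈ O, ∀ i j, ContDiffAt ℝ ∞ (fun z => G z i j) z) (hG : ∀ z ∈ O, (G z).PosDef)
    {κ : ℝ} (hκ : 0 < κ) (hquad : ∀ z ∈ K, ∀ u, κ * ‖u‖ ^ 2 ≤ (quad (G z) u).re)
    {c a : Z → (Fin n → ℂ) → ℂ} {ε : ℝ} (hε : 0 < ε)
    (hc : ∀ z ∈ O, ∀ u, ‖u‖ < ε → ContDiffAt ℝ ∞ (Function.uncurry c) (z, u))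
    (ha : ∀ z ∈ O, ∀ u, ‖u‖ < ε → ContDiffAt ℝ ∞ (Function.uncurry a) (z, u))
    {C₃ A : ℝ} (hc3 : ∀ z ∈ K, ∀ u, ‖u‖ < ε → ‖c z u‖ ≤ C₃ * ‖u‖ ^ 3)
    (hc2 : ∀ z ∈ K, ∀ u, ‖u‖ < ε → ‖c z u‖ ≤ κ / 2 * ‖u‖ ^ 2)
    (hA : ∀ z ∈ K, ∀ u, ‖u‖ < ε → ‖a z u‖ ≤ A) (N : ℕ) :
    ∃ C : ℝ, ∀ k : ℕ, 1 ≤ k → ∀ z ∈ K,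
      ‖(2 : ℂ) ^ n * ((k : ℂ) / (2 * (Real.pi : ℂ))) ^ n *
          (∫ u in Metric.ball 0 ε, Complex.exp (-(k * (quad (G z) u - c z u))) * a z u)
        - ((G z).det)⁻¹ * ∑ l ∈ Finset.range (N + 1), (k : ℂ) ^ (-(l : ℤ)) *
          ∑ m ∈ Finset.range (2 * l + 1),
            (laplace (G z))^[l + m] (fun u => c z u ^ m * a z u) 0
              / ((m.factorial : ℂ) * ((l + m).factorial : ℂ))‖
      ≤ C * (k : ℝ) ^ (-(N : ℤ) - 1) := by
  wlog hC₃ : 0 ≤ C₃ generalizing C₃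
  · exact this (C₃ := |C₃|) (fun z hz u hu => (hc3 z hz u hu).trans
      (by gcongr; exact le_abs_self _)) (abs_nonneg _)
  wlog hA0 : 0 ≤ A generalizing A
  · exact this (A := |A|) (fun z hz u hu => (hA z hz u hu).trans (le_abs_self _)) (abs_nonneg _)
  -- a cutoff function, which makes Gaussian averages of `cᵐ a` over the whole space meaningful
  let χ : ContDiffBump (0 : Fin n → ℂ) := ⟨ε / 4, ε / 2, by positivity, by linarith⟩
  have hχ1 : ∀ u : Fin n → ℂ, ‖u‖ ≤ ε / 4 → χ u = 1 := fun u hu =>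
    χ.one_of_mem_closedBall (by simpa using hu)
  have hχ0 : ∀ u : Fin n → ℂ, ε / 2 < ‖u‖ → χ u = 0 := fun u hu =>
    χ.zero_of_le_dist (by simpa using hu.le)
  set F : ℕ → Z → (Fin n → ℂ) → ℂ := fun m z u => (χ u : ℂ) * (c z u ^ m * a z u) with hFdef
  have hF0 : ∀ m z u, ε / 2 < ‖u‖ → F m z u = 0 := fun m z u hu => by simp [F, hχ0 u hu]
  have hFs : ∀ m, ∀ z ∈ O, ∀ u, ContDiffAt ℝ ∞ (Function.uncurry (F m)) (z, u) := by
    intro m z hz u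
    by_cases hu : ‖u‖ < ε
    · have h1 : ContDiffAt ℝ ∞ (fun p : Z × (Fin n → ℂ) => ((χ p.2 : ℝ) : ℂ)) (z, u) := by
        have : ContDiff ℝ ∞ fun p : Z × (Fin n → ℂ) => ((χ p.2 : ℝ) : ℂ) :=
          Complex.ofRealCLM.contDiff.comp (χ.contDiff.comp contDiff_snd)
        exact this.contDiffAt
      exact h1.mul (((hc z hz u hu).pow m).mul (ha z hz u hu))
    · have hu' : ε / 2 < ‖u‖ := by linarith
      have : Function.uncurry (F m) =ᶠ[𝓝 (z, u)] fun _ => 0 := by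
        have ho : IsOpen {p : Z × (Fin n → ℂ) | ε / 2 < ‖p.2‖} :=
          isOpen_lt continuous_const (by fun_prop)
        filter_upwards [ho.mem_nhds hu'] with p hp
        exact hF0 m p.1 p.2 hp
      exact contDiffAt_const.congr_of_eventuallyEq this
  have hFb : ∀ m, ∀ z ∈ K, ∀ u, ‖F m z u‖ ≤ (C₃ ^ m * A) * ‖u‖ ^ (3 * m) := by
    intro m z hz u
    by_cases hu : ‖u‖ < ε
    · simp only [F]
      rw [norm_mul, norm_mul, norm_pow, Complex.norm_real, Real.norm_of_nonneg χ.nonneg]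
      calc _ ≤ 1 * ((C₃ * ‖u‖ ^ 3) ^ m * A) := by
            gcongr
            · exact χ.le_one
            · exact hc3 z hz u hu
            · exact hA z hz u hu
        _ = _ := by rw [mul_pow, ← pow_mul]; ring
    · rw [hF0 m z u (by linarith), norm_zero]; positivity
  have hvan : ∀ z ∈ K, ∀ m p, 2 * p < 3 * m → (laplace (G z))^[p] (F m z) 0 = 0 :=
    fun z hz m p hp => iterate_laplace_eq_zero_of_norm_le hK hKO hGs hG hκ hquad (hFs m) (hF0 m)
      (hFb m) hz hp
  have hgerm : ∀ z m p, (laplace (G z))^[p] (F m z) 0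
      = (laplace (G z))^[p] (fun u => c z u ^ m * a z u) 0 := by
    intro z m p
    refine (iterate_laplace_eventuallyEq (G z) ?_ p).self_of_nhds
    filter_upwards [Metric.ball_mem_nhds (0 : Fin n → ℂ) (by positivity : 0 < ε / 4)] with u hu
    have hu' : ‖u‖ < ε / 4 := by simpa using hu
    simp [F, hχ1 u hu'.le]
  -- the factor `kᵐ` costs `m` powers of `k⁻¹`, hence the order `m + N + 1`
  choose D hD using fun m => gaussAvg_expansion_uniform hK hKO hGs hG hκ hquad (hFs m) (hF0 m)
    (m + (N + 1))
  -- each factor `k c` has size `k^{-1/2}`, so that `2 (N + 1)` terms of `exp (k c)` are needed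
  set M := 2 * (N + 1) with hM
  set I : ℕ → ℝ := fun j => ∫ u : Fin n → ℂ, Real.exp (-(κ / 2 * ‖u‖ ^ 2)) * ‖u‖ ^ j with hI
  set R : ℝ := A * ((ε / 4)⁻¹ ^ M * I M + C₃ ^ M * I (3 * M)) with hRdef
  refine ⟨(Real.pi ^ n)⁻¹ * (R + ∑ m ∈ Finset.range M, D m / m.factorial), fun k hk z hz => ?_⟩
  have hk0 : (0 : ℝ) < k := by exact_mod_cast hk
  set s : ℝ := (√k)⁻¹ with hs
  have hs0 : 0 < s := by positivity
  have hks : (k : ℝ) * s ^ 2 = 1 := by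
    rw [hs, inv_pow, Real.sq_sqrt hk0.le, mul_inv_cancel₀ hk0.ne']
  have hksC : (k : ℂ) * (s : ℂ) ^ 2 = 1 := by exact_mod_cast hks
  have hsM : s ^ M = (k : ℝ) ^ (-(N : ℤ) - 1) := by
    have : s ^ 2 = (k : ℝ)⁻¹ := eq_inv_of_mul_eq_one_right hks
    rw [hM, pow_mul, this, show -(N : ℤ) - 1 = -((N + 1 : ℕ) : ℤ) by push_cast; ring, zpow_neg,
      zpow_natCast, inv_pow]
  have hkM : (k : ℝ) ^ M * s ^ (3 * M) = s ^ M := by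
    have : s ^ (3 * M) = (s ^ 2) ^ M * s ^ M := by rw [← pow_mul, ← pow_add]; congr 1; omega
    rw [this, ← mul_assoc, ← mul_pow, hks, one_pow, one_mul]
  -- the remainder of the Taylor expansion of the exponential
  have hrem : ‖(k : ℂ) ^ n *
        (∫ u in Metric.ball 0 ε, Complex.exp (-(k * (quad (G z) u - c z u))) * a z u)
      - ∑ m ∈ Finset.range M, (k : ℂ) ^ m / m.factorial * gaussAvg (G z) (F m z) s‖
      ≤ R * s ^ M := by
    have hcont : ∀ m, Continuous (F m z) := fun m => by
      rw [continuous_iff_continuousAt]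
      intro u
      exact ContinuousAt.comp (g := Function.uncurry (F m)) (f := fun u : Fin n → ℂ => (z, u))
        (hFs m z (hKO hz) u).continuousAt (by fun_prop)
    have hcs : ∀ m, HasCompactSupport (F m z) := fun m =>
      HasCompactSupport.of_support_subset_isCompact
        (isCompact_closedBall (0 : Fin n → ℂ) (ε / 2)) fun u hu => by
          by_contra hu'
          exact hu (hF0 m z u (by simpa using hu'))
    have hiF : ∀ m, Integrable fun u : Fin n → ℂ =>
        (k : ℂ) ^ m / m.factorial * (Complex.exp (-(((k : ℝ) : ℂ) * quad (G z) u)) * F m z u) :=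
      fun m => ((Continuous.integrable_of_hasCompactSupport (by have := hcont m; fun_prop)
        ((hcs m).mul_left)).const_mul _)
    have hQ : ∀ u, ‖Complex.exp (-((k : ℂ) * quad (G z) u))‖
        ≤ Real.exp (-(k * (κ * ‖u‖ ^ 2))) := by
      intro u
      rw [Complex.norm_exp, Real.exp_le_exp, Complex.neg_re, neg_le_neg_iff,
        ← Complex.ofReal_natCast, Complex.re_ofReal_mul]
      exact mul_le_mul_of_nonneg_left (hquad z hz u) hk0.le
    set f : (Fin n → ℂ) → ℂ := fun u => Complex.exp (-(k * (quad (G z) u - c z u))) * a z u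
    have hf : ∀ u, f u = Complex.exp (-((k : ℂ) * quad (G z) u)) *
        (Complex.exp (((k : ℝ) : ℂ) * c z u) * a z u) := by
      intro u
      simp only [f]
      rw [← mul_assoc, ← Complex.exp_add]
      congr 2
      push_cast; ring
    have hbound : ∀ u, ‖(Metric.ball 0 ε).indicator f u - ∑ m ∈ Finset.range M,
        (k : ℂ) ^ m / m.factorial * (Complex.exp (-(((k : ℝ) : ℂ) * quad (G z) u)) * F m z u)‖
        ≤ A * ((ε / 4)⁻¹ ^ M * (Real.exp (-(k * (κ / 2 * ‖u‖ ^ 2))) * ‖u‖ ^ M)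
          + C₃ ^ M * k ^ M * (Real.exp (-(k * (κ / 2 * ‖u‖ ^ 2))) * ‖u‖ ^ (3 * M))) := by
      intro u
      by_cases hu : ‖u‖ < ε
      · have h1 := norm_exp_mul_sub_cutoff_le (χ := χ u) hk0.le hC₃ (norm_nonneg u)
          (hc3 z hz u hu) (hc2 z hz u hu) χ.nonneg χ.le_one (by positivity : 0 < ε / 4) (hχ1 u) M
        have h2 : (Metric.ball 0 ε).indicator f u - ∑ m ∈ Finset.range M,
            (k : ℂ) ^ m / m.factorial * (Complex.exp (-(((k : ℝ) : ℂ) * quad (G z) u)) * F m z u)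
            = Complex.exp (-((k : ℂ) * quad (G z) u)) * (a z u *
              (Complex.exp (((k : ℝ) : ℂ) * c z u) - χ u *
                ∑ m ∈ Finset.range M, (((k : ℝ) : ℂ) * c z u) ^ m / m.factorial)) := by
          rw [indicator_of_mem (by simpa using hu), hf]
          simp only [F, Finset.mul_sum, mul_sub]
          congr 1
          · ring
          · refine Finset.sum_congr rfl fun m _ => ?_
            rw [mul_pow]; push_cast; ring
        rw [h2, norm_mul, norm_mul]
        have h3 : Real.exp (-(k * (κ * ‖u‖ ^ 2))) * Real.exp (k * (κ / 2 * ‖u‖ ^ 2))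
            = Real.exp (-(k * (κ / 2 * ‖u‖ ^ 2))) := by
          rw [← Real.exp_add]; congr 1; ring
        calc _ ≤ Real.exp (-(k * (κ * ‖u‖ ^ 2))) * (A * (Real.exp (k * (κ / 2 * ‖u‖ ^ 2)) *
              ((ε / 4)⁻¹ ^ M * ‖u‖ ^ M + C₃ ^ M * (k ^ M * ‖u‖ ^ (3 * M))))) := by
              gcongr
              · exact hQ u
              · exact hA z hz u hu
          _ = A * ((Real.exp (-(k * (κ * ‖u‖ ^ 2))) * Real.exp (k * (κ / 2 * ‖u‖ ^ 2))) *
              ((ε / 4)⁻¹ ^ M * ‖u‖ ^ M + C₃ ^ M * (k ^ M * ‖u‖ ^ (3 * M)))) := by ring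
          _ = _ := by rw [h3]; ring
      · rw [indicator_of_notMem (by simpa using hu), Finset.sum_eq_zero fun m _ => by
          rw [hF0 m z u (by linarith)]; simp]
        simp only [sub_zero, norm_zero]
        positivity
    have hif : Integrable ((Metric.ball 0 ε).indicator f) := by
      rw [integrable_indicator_iff measurableSet_ball]
      have : IsFiniteMeasure ((volume : Measure (Fin n → ℂ)).restrict (Metric.ball 0 ε)) :=
        ⟨by rw [Measure.restrict_apply_univ]; exact measure_ball_lt_top⟩
      refine Integrable.of_bound (C := A) ?_ ?_
      · refine ContinuousOn.aestronglyMeasurable (s := Metric.ball (0 : Fin n → ℂ) ε)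
          (f := f) (fun u hu => ?_) measurableSet_ball
        have hu' : ‖u‖ < ε := by simpa using hu
        have h1 : ContinuousAt (c z) u := ContinuousAt.comp (g := Function.uncurry c)
          (f := fun u : Fin n → ℂ => (z, u)) (hc z (hKO hz) u hu').continuousAt (by fun_prop)
        have h2 : ContinuousAt (a z) u := ContinuousAt.comp (g := Function.uncurry a)
          (f := fun u : Fin n → ℂ => (z, u)) (ha z (hKO hz) u hu').continuousAt (by fun_prop)
        have h3 : ContinuousAt (quad (G z)) u := (continuous_quad _).continuousAt
        exact (((continuousAt_const.mul (h3.sub h1)).neg.cexp).mul h2).continuousWithinAt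
      · refine (ae_restrict_iff' measurableSet_ball).2 (Eventually.of_forall fun u hu => ?_)
        have hu' : ‖u‖ < ε := by simpa using hu
        rw [hf, norm_mul, norm_mul, ← mul_assoc]
        have h3 : Real.exp (-(k * (κ * ‖u‖ ^ 2))) * Real.exp (k * (κ / 2 * ‖u‖ ^ 2)) ≤ 1 := by
          rw [← Real.exp_add, Real.exp_le_one_iff]
          nlinarith [mul_nonneg hk0.le (mul_nonneg hκ.le (sq_nonneg ‖u‖))]
        have h4 : ‖Complex.exp (((k : ℝ) : ℂ) * c z u)‖ ≤ Real.exp (k * (κ / 2 * ‖u‖ ^ 2)) := by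
          refine (Complex.norm_exp_le_exp_norm _).trans (Real.exp_le_exp.2 ?_)
          rw [norm_mul, Complex.norm_real, Real.norm_of_nonneg hk0.le]
          exact mul_le_mul_of_nonneg_left (hc2 z hz u hu') hk0.le
        calc _ ≤ (Real.exp (-(k * (κ * ‖u‖ ^ 2))) * Real.exp (k * (κ / 2 * ‖u‖ ^ 2))) * A := by
              gcongr
              · exact hQ u
              · exact hA z hz u hu'
          _ ≤ 1 * A := by gcongr
          _ = A := one_mul A
    have e1 : ∑ m ∈ Finset.range M, (k : ℂ) ^ m / m.factorial * gaussAvg (G z) (F m z) s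
        = (k : ℂ) ^ n * ∫ u, ∑ m ∈ Finset.range M, (k : ℂ) ^ m / m.factorial *
          (Complex.exp (-(((k : ℝ) : ℂ) * quad (G z) u)) * F m z u) := by
      rw [integral_finsetSum _ fun m _ => hiF m, Finset.mul_sum]
      refine Finset.sum_congr rfl fun m _ => ?_
      rw [← integral_exp_quad_scaled (G z) (F m z) hs0 hks, integral_const_mul]
      push_cast; ring
    rw [e1, ← mul_sub, ← integral_indicator measurableSet_ball,
      ← integral_sub hif (integrable_finsetSum _ fun m _ => hiF m), norm_mul, norm_pow,
      Complex.norm_natCast]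
    have hiE : ∀ j, Integrable fun u : Fin n → ℂ =>
        Real.exp (-(k * (κ / 2 * ‖u‖ ^ 2))) * ‖u‖ ^ j := by
      intro j
      have := integrable_exp_norm_mul_pow (n := n) (by positivity : 0 < k * (κ / 2)) j
      simpa only [mul_assoc] using this
    have hiE' := (((hiE M).const_mul ((ε / 4)⁻¹ ^ M)).add
      ((hiE (3 * M)).const_mul (C₃ ^ M * k ^ M))).const_mul A
    calc _ ≤ (k : ℝ) ^ n * ∫ u : Fin n → ℂ,
          A * ((ε / 4)⁻¹ ^ M * (Real.exp (-(k * (κ / 2 * ‖u‖ ^ 2))) * ‖u‖ ^ M)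
          + C₃ ^ M * k ^ M * (Real.exp (-(k * (κ / 2 * ‖u‖ ^ 2))) * ‖u‖ ^ (3 * M))) := by
          gcongr
          exact norm_integral_le_of_norm_le hiE' (Eventually.of_forall hbound)
      _ = A * ((ε / 4)⁻¹ ^ M * (k ^ n * ∫ u : Fin n → ℂ,
            Real.exp (-(k * (κ / 2 * ‖u‖ ^ 2))) * ‖u‖ ^ M)
          + C₃ ^ M * k ^ M * (k ^ n * ∫ u : Fin n → ℂ,
            Real.exp (-(k * (κ / 2 * ‖u‖ ^ 2))) * ‖u‖ ^ (3 * M))) := by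
          rw [integral_const_mul, integral_add ((hiE M).const_mul _) ((hiE (3 * M)).const_mul _),
            integral_const_mul, integral_const_mul]
          ring
      _ = A * ((ε / 4)⁻¹ ^ M * (s ^ M * I M) + C₃ ^ M * (k ^ M * s ^ (3 * M)) * I (3 * M)) := by
          rw [integral_exp_norm_scaled (κ / 2) M hs0 hks,
            integral_exp_norm_scaled (κ / 2) (3 * M) hs0 hks]
          ring
      _ = _ := by rw [hkM]; ring
  -- the remainders of the expansions of the Gaussian averages
  have hexp : ‖∑ m ∈ Finset.range M, (k : ℂ) ^ m / m.factorial * gaussAvg (G z) (F m z) s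
      - (Real.pi : ℂ) ^ n / (G z).det * ∑ m ∈ Finset.range M, (k : ℂ) ^ m / m.factorial *
        ∑ p ∈ Finset.range (m + (N + 1)), (s : ℂ) ^ (2 * p) *
          ((laplace (G z))^[p] (F m z) 0 / p.factorial)‖
      ≤ (∑ m ∈ Finset.range M, D m / m.factorial) * s ^ M := by
    rw [Finset.mul_sum, ← Finset.sum_sub_distrib, Finset.sum_mul]
    refine (norm_sum_le _ _).trans (Finset.sum_le_sum fun m _ => ?_)
    have h1 := hD m s hs0.le z hz
    have h2 : (k : ℝ) ^ m * s ^ (2 * (m + (N + 1))) = s ^ M := by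
      rw [mul_add, pow_add, pow_mul, ← mul_assoc, ← mul_pow, hks, one_pow, one_mul]
    rw [mul_left_comm, ← mul_sub, norm_mul, norm_div, norm_pow, Complex.norm_natCast,
      Complex.norm_natCast]
    calc _ ≤ (k : ℝ) ^ m / m.factorial * (D m * s ^ (2 * (m + (N + 1)))) := by gcongr
      _ = D m / m.factorial * ((k : ℝ) ^ m * s ^ (2 * (m + (N + 1)))) := by ring
      _ = _ := by rw [h2]
  rw [sum_rearrange hksC N (hvan z hz)] at hexp
  simp only [hgerm] at hexp
  have hpi : (Real.pi : ℂ) ≠ 0 := by exact_mod_cast Real.pi_ne_zero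
  have e1 : (2 : ℂ) ^ n * ((k : ℂ) / (2 * (Real.pi : ℂ))) ^ n
      = ((Real.pi : ℂ) ^ n)⁻¹ * (k : ℂ) ^ n := by
    rw [← mul_pow, ← inv_pow, ← mul_pow]; congr 1; field_simp
  have e2 : ((G z).det)⁻¹ = ((Real.pi : ℂ) ^ n)⁻¹ * ((Real.pi : ℂ) ^ n / (G z).det) := by
    field_simp
  rw [e1, e2, mul_assoc, mul_assoc, ← mul_sub, norm_mul, norm_inv, norm_pow, Complex.norm_real,
    Real.norm_of_nonneg Real.pi_pos.le, ← hsM, mul_assoc]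
  gcongr
  have := norm_add_le_of_le hrem hexp
  rw [sub_add_sub_cancel, ← add_mul] at this
  exact this

end LaplaceMethod

/-! ### Sesqui-holomorphic functions near the diagonal -/

section Sesqui

variable {n : ℕ}

/-- Local identity theorem: the set of the `(z, z̄)` is totally real of maximal dimension, so that a
holomorphic function which vanishes on it vanishes nearby. -/
theorem eventually_eq_zero_of_comp_star {H : (Fin n → ℂ) × (Fin n → ℂ) → ℂ} {z₀ : Fin n → ℂ}
    (hH : AnalyticAt ℂ H (z₀, star z₀)) (h0 : ∀ᶠ z in 𝓝 z₀, H (z, star z) = 0) :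
    ∀ᶠ p in 𝓝 (z₀, star z₀), H p = 0 := by
  obtain ⟨r, hr, hball⟩ := Metric.eventually_nhds_iff_ball.1
    (hH.eventually_analyticAt.and
      ((continuous_fst.tendsto (z₀, star z₀)).eventually h0))
  refine Metric.eventually_nhds_iff_ball.2 ⟨r, hr, fun p hp => ?_⟩
  -- a complex line through `p` whose real points are of the form `(z, z̄)`
  set v₁ : Fin n → ℂ := (1 / 2 : ℂ) • (p.1 + star p.2) with hv₁
  set v₂ : Fin n → ℂ := (-Complex.I / 2) • (p.1 - star p.2) with hv₂
  have hs1 : star v₁ = (1 / 2 : ℂ) • (star p.1 + p.2) := by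
    rw [hv₁]; ext i; simp; ring
  have hs2 : star v₂ = (Complex.I / 2) • (star p.1 - p.2) := by
    rw [hv₂]; ext i; simp
  set ℓ : ℂ → (Fin n → ℂ) × (Fin n → ℂ) := fun t => (v₁ + t • v₂, star v₁ + t • star v₂) with hℓ
  have hℓI : ℓ Complex.I = p := by
    have hI := Complex.I_mul_I
    ext i
    · simp only [hℓ, hv₁, hv₂, Pi.add_apply, Pi.smul_apply, Pi.sub_apply, smul_eq_mul]
      linear_combination (-(1 / 2) * (p.1 i - star p.2 i)) * hI
    · simp only [hℓ, hs1, hs2, Pi.add_apply, Pi.smul_apply, Pi.sub_apply, smul_eq_mul]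
      linear_combination ((1 / 2) * (star p.1 i - p.2 i)) * hI
  have hreal : ∀ t : ℝ, ℓ t = ((ℓ t).1, star (ℓ t).1) := by
    intro t
    simp only [hℓ, star_add]
    congr 2
    ext i; simp
  have hv₁b : ‖v₁ - z₀‖ < r := by
    have hp' := mem_ball_iff_norm.1 hp
    have h1 : ‖p.1 - z₀‖ < r := (norm_fst_le (p - (z₀, star z₀))).trans_lt hp'
    have h2 : ‖star p.2 - z₀‖ < r := by
      have : star p.2 - z₀ = star (p.2 - star z₀) := by simp
      rw [this, norm_star]
      exact (norm_snd_le (p - (z₀, star z₀))).trans_lt hp'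
    have h3 : v₁ - z₀ = (1 / 2 : ℂ) • ((p.1 - z₀) + (star p.2 - z₀)) := by
      rw [hv₁]; ext i; simp; ring
    rw [h3, norm_smul]
    have h4 := norm_add_le (p.1 - z₀) (star p.2 - z₀)
    have h5 : ‖(1 / 2 : ℂ)‖ = 1 / 2 := by norm_num
    rw [h5]; linarith
  have hℓ0 : ℓ 0 ∈ Metric.ball (z₀, star z₀) r := by
    rw [mem_ball_iff_norm]
    have : ℓ 0 - (z₀, star z₀) = (v₁ - z₀, star (v₁ - z₀)) := by simp [hℓ]
    rw [this, Prod.norm_mk, norm_star, max_self]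
    exact hv₁b
  have hℓc : Continuous ℓ := by fun_prop
  set S : Set ℂ := ℓ ⁻¹' Metric.ball (z₀, star z₀) r with hS
  have hSconv : Convex ℝ S := by
    intro x hx y hy a b ha hb hab
    have : ℓ (a • x + b • y) = a • ℓ x + b • ℓ y := by
      have hb' : b = 1 - a := by linarith
      subst hb'
      ext i
      · simp [hℓ]; ring
      · simp [hℓ]; ring
    rw [hS, mem_preimage, this]
    exact (convex_ball (z₀, star z₀) r) hx hy ha hb hab
  have han : AnalyticOnNhd ℂ (H ∘ ℓ) S := by
    intro t ht
    have h1 : AnalyticAt ℂ ℓ t := by fun_prop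
    exact (hball (ℓ t) ht).1.comp h1
  have hfreq : ∃ᶠ t in 𝓝[≠] (0 : ℂ), (H ∘ ℓ) t = 0 := by
    have hS0 : S ∈ 𝓝 (0 : ℂ) := hℓc.continuousAt.preimage_mem_nhds
      (Metric.isOpen_ball.mem_nhds hℓ0)
    have hlim : Tendsto (fun m : ℕ => ((1 / ((m : ℝ) + 1) : ℝ) : ℂ)) atTop (𝓝[≠] 0) := by
      refine tendsto_nhdsWithin_iff.2 ⟨?_, Eventually.of_forall fun m => ?_⟩
      · have := (Complex.continuous_ofReal.tendsto 0).comp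
          (tendsto_one_div_add_atTop_nhds_zero_nat (𝕜 := ℝ))
        rw [Complex.ofReal_zero] at this
        exact this
      · have : (1 / ((m : ℝ) + 1)) ≠ 0 := by positivity
        simpa only [mem_compl_iff, mem_singleton_iff, Complex.ofReal_eq_zero] using this
    refine hlim.frequently (Eventually.frequently ?_)
    filter_upwards [(hlim.mono_right nhdsWithin_le_nhds).eventually hS0] with m hm
    have h2 := (hball _ hm).2
    simp only [Function.comp_apply]
    rw [hreal]
    exact h2
  have h0S : (0 : ℂ) ∈ S := hℓ0
  have hIS : Complex.I ∈ S := by rw [hS, mem_preimage, hℓI]; exact hp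
  have := han.eqOn_zero_of_preconnected_of_frequently_eq_zero hSconv.isPreconnected h0S hfreq hIS
  simpa [hℓI] using this

/-- Taylor expansion to second order of a mixed difference. -/
theorem exists_norm_mixed_sub_le {Φ : (Fin n → ℂ) × (Fin n → ℂ) → ℂ}
    {p₀ : (Fin n → ℂ) × (Fin n → ℂ)}
    (hΦ : AnalyticAt ℂ Φ p₀) :
    ∃ r > 0, ∃ C : ℝ, ∀ p : (Fin n → ℂ) × (Fin n → ℂ), ‖p - p₀‖ < r → ∀ u v : Fin n → ℂ,
      ‖u‖ < r → ‖v‖ ≤ ‖u‖ →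
      ‖Φ (p.1 + u, p.2 + v) - Φ (p.1 + u, p.2) - Φ (p.1, p.2 + v) + Φ p
        - fderiv ℂ (fderiv ℂ Φ) p (u, 0) (0, v)‖ ≤ C * ‖u‖ ^ 3 := by
  have hΨ := hΦ.fderiv.fderiv
  obtain ⟨K, t, ht, hLip⟩ := (hΨ.contDiffAt (n := 1)).exists_lipschitzOnWith
  obtain ⟨r, hr, hball⟩ := Metric.mem_nhds_iff.1 (inter_mem ht (hΦ.eventually_analyticAt))
  have hmem : ∀ q, ‖q - p₀‖ < r → q ∈ t ∧ AnalyticAt ℂ Φ q := fun q hq =>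
    hball (mem_ball_iff_norm.2 hq)
  refine ⟨r / 2, by positivity, K, fun p hp u v hu hv => ?_⟩
  have hpr : ‖p - p₀‖ < r := by linarith
  have hin : ∀ a b : Fin n → ℂ, ‖a‖ ≤ ‖u‖ → ‖b‖ ≤ ‖u‖ → ‖(p.1 + a, p.2 + b) - p₀‖ < r := by
    intro a b ha hb
    have e : (p.1 + a, p.2 + b) - p₀ = (p - p₀) + (a, b) := by
      ext i <;> simp <;> ring
    rw [e]
    refine (norm_add_le _ _).trans_lt ?_
    have : ‖((a, b) : (Fin n → ℂ) × (Fin n → ℂ))‖ ≤ ‖u‖ := max_le ha hb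
    linarith
  set B := fderiv ℂ (fderiv ℂ Φ) p
  -- first order expansion of the derivative
  have step1 : ∀ b : Fin n → ℂ, ‖b‖ ≤ ‖u‖ →
      ‖fderiv ℂ Φ (p.1 + u, p.2 + b) - fderiv ℂ Φ (p.1, p.2 + b) - B (u, 0)‖
        ≤ K * ‖u‖ * ‖u‖ := by
    intro b hb
    have hd : ∀ x ∈ Metric.closedBall (0 : Fin n → ℂ) ‖u‖,
        HasFDerivWithinAt (fun a : Fin n → ℂ => fderiv ℂ Φ (p.1 + a, p.2 + b))
          ((fderiv ℂ (fderiv ℂ Φ) (p.1 + x, p.2 + b)).comp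
            (ContinuousLinearMap.inl ℂ (Fin n → ℂ) (Fin n → ℂ)))
          (Metric.closedBall (0 : Fin n → ℂ) ‖u‖) x := by
      intro x hx
      have hx' : ‖x‖ ≤ ‖u‖ := by simpa using hx
      have h1 := (hmem _ (hin x b hx' hb)).2.fderiv.differentiableAt.hasFDerivAt
      have h2 : HasFDerivAt (fun a : Fin n → ℂ => (p.1 + a, p.2 + b))
          (ContinuousLinearMap.inl ℂ (Fin n → ℂ) (Fin n → ℂ)) x :=
        ((hasFDerivAt_id x).const_add p.1).prodMk (hasFDerivAt_const _ _)
      exact (HasFDerivAt.comp x h1 h2).hasFDerivWithinAt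
    have h3 := Convex.norm_image_sub_le_of_norm_hasFDerivWithin_le'
      (φ := B.comp (ContinuousLinearMap.inl ℂ (Fin n → ℂ) (Fin n → ℂ))) (C := K * ‖u‖) hd
      (fun x hx => ?_) (convex_closedBall (0 : Fin n → ℂ) ‖u‖)
      (x := 0) (y := u) (by simp) (by simp)
    · simpa using h3
    · have hx' : ‖x‖ ≤ ‖u‖ := by simpa using hx
      rw [← ContinuousLinearMap.sub_comp]
      refine (ContinuousLinearMap.opNorm_comp_le _ _).trans ?_
      have h4 := hLip.norm_sub_le (hmem _ (hin x b hx' hb)).1 (hmem p hpr).1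
      have h5 : ‖(p.1 + x, p.2 + b) - p‖ ≤ ‖u‖ := by
        have : (p.1 + x, p.2 + b) - p = (x, b) := by ext i <;> simp
        rw [this]; exact max_le hx' hb
      calc _ ≤ (K * ‖u‖) * 1 := by
            gcongr
            · exact h4.trans (by gcongr)
            · exact ContinuousLinearMap.norm_inl_le_one ℂ _ _
        _ = _ := mul_one _
  have hd : ∀ x ∈ Metric.closedBall (0 : Fin n → ℂ) ‖u‖,
      HasFDerivWithinAt (fun b : Fin n → ℂ => Φ (p.1 + u, p.2 + b) - Φ (p.1, p.2 + b))
        ((fderiv ℂ Φ (p.1 + u, p.2 + x) - fderiv ℂ Φ (p.1, p.2 + x)).comp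
          (ContinuousLinearMap.inr ℂ (Fin n → ℂ) (Fin n → ℂ)))
        (Metric.closedBall (0 : Fin n → ℂ) ‖u‖) x := by
    intro x hx
    have hx' : ‖x‖ ≤ ‖u‖ := by simpa using hx
    have h2 : ∀ a : Fin n → ℂ, HasFDerivAt (fun b : Fin n → ℂ => (a, p.2 + b))
        (ContinuousLinearMap.inr ℂ (Fin n → ℂ) (Fin n → ℂ)) x := fun a =>
      (hasFDerivAt_const _ _).prodMk ((hasFDerivAt_id x).const_add p.2)
    have h1 := (hmem _ (hin u x le_rfl hx')).2.differentiableAt.hasFDerivAt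
    have h1' : HasFDerivAt Φ (fderiv ℂ Φ (p.1, p.2 + x)) (p.1, p.2 + x) := by
      have := (hmem _ (hin 0 x (by simp) hx')).2.differentiableAt.hasFDerivAt
      simpa using this
    exact ((HasFDerivAt.comp x h1 (h2 _)).sub (HasFDerivAt.comp x h1' (h2 _))).hasFDerivWithinAt
  have h3 := Convex.norm_image_sub_le_of_norm_hasFDerivWithin_le'
    (φ := (B (u, 0)).comp (ContinuousLinearMap.inr ℂ (Fin n → ℂ) (Fin n → ℂ)))
    (C := K * ‖u‖ * ‖u‖) hd (fun x hx => ?_) (convex_closedBall (0 : Fin n → ℂ) ‖u‖)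
    (x := 0) (y := v) (by simp) (by simpa using hv)
  · have e : Φ (p.1 + u, p.2 + v) - Φ (p.1 + u, p.2) - Φ (p.1, p.2 + v) + Φ p - B (u, 0) (0, v)
        = Φ (p.1 + u, p.2 + v) - Φ (p.1, p.2 + v) - (Φ (p.1 + u, p.2 + 0) - Φ (p.1, p.2 + 0))
          - (B (u, 0)).comp (ContinuousLinearMap.inr ℂ (Fin n → ℂ) (Fin n → ℂ)) (v - 0) := by
      simp; ring
    rw [e]
    refine h3.trans ?_
    rw [sub_zero]
    calc _ ≤ K * ‖u‖ * ‖u‖ * ‖u‖ := by gcongr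
      _ = _ := by ring
  · have hx' : ‖x‖ ≤ ‖u‖ := by simpa using hx
    rw [← ContinuousLinearMap.sub_comp]
    refine (ContinuousLinearMap.opNorm_comp_le _ _).trans ?_
    calc _ ≤ (K * ‖u‖ * ‖u‖) * 1 := by
          gcongr
          · exact step1 x hx'
          · exact ContinuousLinearMap.norm_inr_le_one ℂ _ _
      _ = _ := mul_one _

/-- The Levi form of `z ↦ Φ(z, z̄)` is the mixed second derivative of `Φ`. -/
theorem leviMatrix_eq_fderiv_fderiv {Φ : (Fin n → ℂ) × (Fin n → ℂ) → ℂ} {φ : (Fin n → ℂ) → ℂ}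
    {z : Fin n → ℂ} (hΦ : AnalyticAt ℂ Φ (z, star z)) (hφ : ∀ᶠ w in 𝓝 z, Φ (w, star w) = φ w)
    (i j : Fin n) :
    leviMatrix φ z i j = fderiv ℂ (fderiv ℂ Φ) (z, star z) (Pi.single i 1, 0)
      (0, Pi.single j 1) := by
  rw [← leviMatrix_congr (F := fun w => Φ (w, star w)) hφ]
  change dz i (dzbar j fun w => Φ (w, star w)) z = _
  have hc : Tendsto (fun w : Fin n → ℂ => (w, star w)) (𝓝 z) (𝓝 (z, star z)) :=
    (by fun_prop : Continuous fun w : Fin n → ℂ => (w, star w)).tendsto z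
  have h1 : dzbar j (fun w => Φ (w, star w))
      =ᶠ[𝓝 z] fun w => (fun p => fderiv ℂ Φ p (0, Pi.single j 1)) (w, star w) := by
    filter_upwards [hc.eventually hΦ.eventually_analyticAt] with w hw
    exact dzbar_comp_star j hw.differentiableAt
  rw [(dz_eventuallyEq i h1).self_of_nhds]
  have h2 : DifferentiableAt ℂ (fderiv ℂ Φ) (z, star z) := hΦ.fderiv.differentiableAt
  rw [dz_comp_star i (H := fun p => fderiv ℂ Φ p (0, Pi.single j 1))
    (h2.clm_apply (differentiableAt_const _)), fderiv_clm_apply h2 (differentiableAt_const _)]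
  simp

theorem quad_leviMatrix {Φ : (Fin n → ℂ) × (Fin n → ℂ) → ℂ} {φ : (Fin n → ℂ) → ℂ}
    {z : Fin n → ℂ} (hΦ : AnalyticAt ℂ Φ (z, star z)) (hφ : ∀ᶠ w in 𝓝 z, Φ (w, star w) = φ w)
    (u : Fin n → ℂ) :
    quad (leviMatrix φ z) u = fderiv ℂ (fderiv ℂ Φ) (z, star z) (u, 0) (0, star u) := by
  set B := fderiv ℂ (fderiv ℂ Φ) (z, star z)
  have h1 : ((u, 0) : (Fin n → ℂ) × (Fin n → ℂ)) = ∑ i, u i • (Pi.single i 1, 0) := by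
    ext k <;> simp [Prod.fst_sum, Prod.snd_sum, Finset.sum_apply, Pi.single_apply]
  have h2 : ((0, star u) : (Fin n → ℂ) × (Fin n → ℂ))
      = ∑ j, star (u j) • (0, Pi.single j 1) := by
    ext k <;> simp [Prod.fst_sum, Prod.snd_sum, Finset.sum_apply, Pi.single_apply]
  rw [h1, h2]
  simp only [map_sum, map_smul, sum_apply, smul_apply,
    smul_eq_mul, quad, Finset.mul_sum]
  rw [Finset.sum_comm]
  refine Finset.sum_congr rfl fun j _ => Finset.sum_congr rfl fun i _ => ?_
  rw [leviMatrix_eq_fderiv_fderiv hΦ hφ]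
  ring

end Sesqui

section LocalExpansion

variable {n : ℕ}

/-- `F(z, w̄)` is holomorphic in `(z, w̄)` for `z, w` in the set `Ω` of `ℂⁿ`. -/
def SesquiAnalyticOn (Ω : Set (Fin n → ℂ)) (F : (Fin n → ℂ) → (Fin n → ℂ) → ℂ) : Prop :=
  ∀ z ∈ Ω, ∀ w ∈ Ω, AnalyticAt ℂ
    (fun p : (Fin n → ℂ) × (Fin n → ℂ) => F p.1 (star p.2)) (z, star w)

theorem SesquiAnalyticOn.mono {Ω Ω' : Set (Fin n → ℂ)} {F : (Fin n → ℂ) → (Fin n → ℂ) → ℂ}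
    (h : SesquiAnalyticOn Ω F) (hΩ : Ω' ⊆ Ω) : SesquiAnalyticOn Ω' F :=
  fun z hz w hw => h z (hΩ hz) w (hΩ hw)

theorem SesquiAnalyticOn.contDiffAt_comp {Ω : Set (Fin n → ℂ)}
    {F : (Fin n → ℂ) → (Fin n → ℂ) → ℂ} (h : SesquiAnalyticOn Ω F)
    {X : Type*} [NormedAddCommGroup X] [NormedSpace ℝ X] {x : X} {f g : X → (Fin n → ℂ)}
    (hf : ContDiffAt ℝ ∞ f x) (hg : ContDiffAt ℝ ∞ g x) (hfx : f x ∈ Ω) (hgx : g x ∈ Ω) :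
    ContDiffAt ℝ ∞ (fun x => F (f x) (g x)) x := by
  have h1 := ((h (f x) hfx (g x) hgx).contDiffAt (n := ∞)).restrict_scalars ℝ
  have h2 : ContDiffAt ℝ ∞ (fun x => (f x, star (g x))) x :=
    hf.prodMk ((starL' ℝ : (Fin n → ℂ) ≃L[ℝ] (Fin n → ℂ)).contDiff.contDiffAt.comp x hg)
  have h3 := ContDiffAt.comp (f := fun x => (f x, star (g x))) x h1 h2
  simpa [Function.comp_def] using h3

variable {Ω : Set (Fin n → ℂ)} {φ : (Fin n → ℂ) → ℂ}
  {φt φt' ft gt : (Fin n → ℂ) → (Fin n → ℂ) → ℂ}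

theorem contDiffAt_of_diag (hΩ : IsOpen Ω) (hφt : SesquiAnalyticOn Ω φt)
    (hφ : ∀ z ∈ Ω, φt z z = φ z) {z : Fin n → ℂ} (hz : z ∈ Ω) : ContDiffAt ℝ ∞ φ z := by
  have h := hφt.contDiffAt_comp (x := z) contDiffAt_id contDiffAt_id hz hz
  refine h.congr_of_eventuallyEq ?_
  filter_upwards [hΩ.mem_nhds hz] with w hw
  exact (hφ w hw).symm

theorem contDiffAt_diastasis (hφt : SesquiAnalyticOn Ω φt) {z u : Fin n → ℂ} (hz : z ∈ Ω)
    (hzu : z + u ∈ Ω) :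
    ContDiffAt ℝ ∞ (Function.uncurry fun z u => diastasis φt z (z + u)) (z, u) := by
  have h1 : ContDiffAt ℝ ∞ (fun p : (Fin n → ℂ) × (Fin n → ℂ) => p.1) (z, u) := contDiffAt_fst
  have h2 : ContDiffAt ℝ ∞ (fun p : (Fin n → ℂ) × (Fin n → ℂ) => p.1 + p.2) (z, u) :=
    contDiffAt_fst.add contDiffAt_snd
  exact (((hφt.contDiffAt_comp h1 h2 hz hzu).neg.sub (hφt.contDiffAt_comp h2 h1 hzu hz)).add
    (hφt.contDiffAt_comp h1 h1 hz hz)).add (hφt.contDiffAt_comp h2 h2 hzu hzu)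

theorem contDiffAt_cFun (hΩ : IsOpen Ω) (hφt : SesquiAnalyticOn Ω φt)
    (hφ : ∀ z ∈ Ω, φt z z = φ z) {z u : Fin n → ℂ} (hz : z ∈ Ω) (hzu : z + u ∈ Ω) :
    ContDiffAt ℝ ∞ (Function.uncurry (cFun φ φt)) (z, u) := by
  have h1 : ContDiffAt ℝ ∞ (fun p : (Fin n → ℂ) × (Fin n → ℂ) =>
      ∑ i, ∑ j, leviMatrix φ p.1 i j * p.2 i * star (p.2 j)) (z, u) := by
    refine ContDiffAt.sum fun i _ => ContDiffAt.sum fun j _ => ?_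
    have h2 : ContDiffAt ℝ ∞ (fun p : (Fin n → ℂ) × (Fin n → ℂ) => leviMatrix φ p.1 i j) (z, u) :=
      ContDiffAt.comp (f := fun p : (Fin n → ℂ) × (Fin n → ℂ) => p.1) (z, u)
        (contDiffAt_leviMatrix (contDiffAt_of_diag hΩ hφt hφ hz) i j) contDiffAt_fst
    have h3 : ∀ i, ContDiffAt ℝ ∞ (fun p : (Fin n → ℂ) × (Fin n → ℂ) => p.2 i) (z, u) := by
      intro i; fun_prop
    exact (h2.mul (h3 i)).mul
      ((starL' ℝ : ℂ ≃L[ℝ] ℂ).contDiff.contDiffAt.comp (z, u) (h3 j))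
  exact h1.sub (contDiffAt_diastasis hφt hz hzu)

theorem contDiffAt_amplitude (hΩ : IsOpen Ω) (hφt : SesquiAnalyticOn Ω φt)
    (hφ : ∀ z ∈ Ω, φt z z = φ z) (hφt' : SesquiAnalyticOn Ω φt') (hft : SesquiAnalyticOn Ω ft)
    (hgt : SesquiAnalyticOn Ω gt) {z u : Fin n → ℂ} (hz : z ∈ Ω) (hzu : z + u ∈ Ω) :
    ContDiffAt ℝ ∞ (Function.uncurry fun z u => dFun ft gt z u * cFun' φ φt' z u) (z, u) := by
  have h1 : ContDiffAt ℝ ∞ (fun p : (Fin n → ℂ) × (Fin n → ℂ) => p.1) (z, u) := contDiffAt_fst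
  have h2 : ContDiffAt ℝ ∞ (fun p : (Fin n → ℂ) × (Fin n → ℂ) => p.1 + p.2) (z, u) :=
    contDiffAt_fst.add contDiffAt_snd
  have h3 : ContDiffAt ℝ ∞ (fun p : (Fin n → ℂ) × (Fin n → ℂ) =>
      liouvilleDensity φ (p.1 + p.2)) (z, u) :=
    ContDiffAt.comp (f := fun p : (Fin n → ℂ) × (Fin n → ℂ) => p.1 + p.2) (z, u)
      (contDiffAt_det fun i j => contDiffAt_leviMatrix (contDiffAt_of_diag hΩ hφt hφ hzu) i j) h2
  exact ((hft.contDiffAt_comp h1 h2 hz hzu).mul (hgt.contDiffAt_comp h2 h1 hzu hz)).mul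
    ((contDiffAt_diastasis hφt' hz hzu).neg.cexp.mul h3)

theorem SesquiAnalyticOn.eventually_diag (hΩ : IsOpen Ω) (hφ : ∀ z ∈ Ω, φt z z = φ z)
    {z : Fin n → ℂ} (hz : z ∈ Ω) : ∀ᶠ w in 𝓝 z,
      (fun p : (Fin n → ℂ) × (Fin n → ℂ) => φt p.1 (star p.2)) (w, star w) = φ w := by
  filter_upwards [hΩ.mem_nhds hz] with w hw
  simpa using hφ w hw

/-- The function `c` is of the third order: the diastasis and the Levi form agree to second
order. -/
theorem exists_norm_cFun_le (hΩ : IsOpen Ω) (hφt : SesquiAnalyticOn Ω φt)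
    (hφ : ∀ z ∈ Ω, φt z z = φ z) {z₀ : Fin n → ℂ} (hz₀ : z₀ ∈ Ω) :
    ∃ r > 0, ∃ C : ℝ, ∀ z, ‖z - z₀‖ < r → ∀ u, ‖u‖ < r → ‖cFun φ φt z u‖ ≤ C * ‖u‖ ^ 3 := by
  obtain ⟨r, hr, C, hC⟩ := exists_norm_mixed_sub_le (hφt z₀ hz₀ z₀ hz₀)
  obtain ⟨r', hr', hball⟩ := Metric.isOpen_iff.1 hΩ z₀ hz₀
  refine ⟨min r r', lt_min hr hr', C, fun z hz u hu => ?_⟩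
  have hzΩ : z ∈ Ω := hball (mem_ball_iff_norm.2 (hz.trans_le (min_le_right _ _)))
  have h1 := hC (z, star z) (by
    have : (z, star z) - (z₀, star z₀) = (z - z₀, star (z - z₀)) := by simp
    rw [this, Prod.norm_mk, norm_star, max_self]
    exact hz.trans_le (min_le_left _ _)) u (star u) (hu.trans_le (min_le_left _ _)) (by simp)
  rw [← quad_leviMatrix (hφt z hzΩ z hzΩ) (SesquiAnalyticOn.eventually_diag hΩ hφ hzΩ)] at h1
  rw [← norm_neg]
  refine le_trans (le_of_eq ?_) h1
  congr 1
  simp only [cFun, diastasis, quad, star_add, star_star]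
  ring

/-- The local form of the expansion, in an open subset of `ℂⁿ`. -/
theorem local_expansion (hΩ : IsOpen Ω) (hφt : SesquiAnalyticOn Ω φt)
    (hφ : ∀ z ∈ Ω, φt z z = φ z) (hφt' : SesquiAnalyticOn Ω φt') (hft : SesquiAnalyticOn Ω ft)
    (hgt : SesquiAnalyticOn Ω gt) (hpos : ∀ z ∈ Ω, (leviMatrix φ z).PosDef)
    {z₀ : Fin n → ℂ} (hz₀ : z₀ ∈ Ω) :
    ∃ r > 0, ∀ ε, 0 < ε → ε ≤ r → ∀ N : ℕ, ∃ C : ℝ, ∀ k : ℕ, 1 ≤ k → ∀ z ∈ Metric.closedBall z₀ ε,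
      ‖(2 : ℂ) ^ n * ((k : ℂ) / (2 * (Real.pi : ℂ))) ^ n *
          (∫ u in Metric.ball 0 ε, Complex.exp (-(k * diastasis φt z (z + u))) *
            (dFun ft gt z u * cFun' φ φt' z u))
        - ∑ l ∈ Finset.range (N + 1), (k : ℂ) ^ (-(l : ℤ)) * localCoeff φ φt φt' ft gt l z‖
      ≤ C * (k : ℝ) ^ (-(N : ℤ) - 1) := by
  obtain ⟨r₁, hr₁, hball⟩ := Metric.isOpen_iff.1 hΩ z₀ hz₀
  obtain ⟨r₂, hr₂, C₃, hC₃⟩ := exists_norm_cFun_le hΩ hφt hφ hz₀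
  -- radii for which `z + u` stays in `Ω`, and `|c| ≤ κ |u|² / 2` for `|u| < ε`
  set ρ := r₁ / 3 with hρ
  have hKΩ : Metric.closedBall z₀ ρ ⊆ Ω := fun z hz => hball (by
    have := mem_closedBall_iff_norm.1 hz
    rw [mem_ball_iff_norm]; linarith)
  have hsm : ∀ z ∈ Ω, ∀ i j, ContDiffAt ℝ ∞ (fun z => leviMatrix φ z i j) z :=
    fun z hz => contDiffAt_leviMatrix (contDiffAt_of_diag hΩ hφt hφ hz)
  obtain ⟨κ, hκ, hquad⟩ := exists_quad_lower_bound (isCompact_closedBall z₀ ρ)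
    (G := leviMatrix φ) (fun i j z hz => (hsm z (hKΩ hz) i j).continuousAt.continuousWithinAt)
    (fun z hz => hpos z (hKΩ hz))
  refine ⟨min (min (ρ / 2) (r₂ / 2)) (κ / (2 * (|C₃| + 1))), by positivity, fun ε hε hεr N => ?_⟩
  have hε1 : ε ≤ ρ / 2 := hεr.trans ((min_le_left _ _).trans (min_le_left _ _))
  have hε2 : ε ≤ r₂ / 2 := hεr.trans ((min_le_left _ _).trans (min_le_right _ _))
  have hε3 : ε ≤ κ / (2 * (|C₃| + 1)) := hεr.trans (min_le_right _ _)
  have hεC : (|C₃| + 1) * ε ≤ κ / 2 := by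
    calc (|C₃| + 1) * ε ≤ (|C₃| + 1) * (κ / (2 * (|C₃| + 1))) := by gcongr
      _ = κ / 2 := by field_simp
  have hin : ∀ z ∈ Metric.ball z₀ ρ, ∀ u, ‖u‖ < ρ → z ∈ Ω ∧ z + u ∈ Ω := by
    intro z hz u hu
    have hz' := mem_ball_iff_norm.1 hz
    refine ⟨hball (mem_ball_iff_norm.2 (by linarith)), hball (mem_ball_iff_norm.2 ?_)⟩
    rw [add_sub_right_comm]
    exact (norm_add_le _ _).trans_lt (by linarith)
  have hKO : Metric.closedBall z₀ ε ⊆ Metric.ball z₀ ρ :=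
    Metric.closedBall_subset_ball (by linarith)
  set a : (Fin n → ℂ) → (Fin n → ℂ) → ℂ := fun z u => dFun ft gt z u * cFun' φ φt' z u with ha
  have has : ∀ z ∈ Metric.ball z₀ ρ, ∀ u, ‖u‖ < ρ →
      ContDiffAt ℝ ∞ (Function.uncurry a) (z, u) := fun z hz u hu =>
    contDiffAt_amplitude hΩ hφt hφ hφt' hft hgt (hin z hz u hu).1 (hin z hz u hu).2
  obtain ⟨A, hA⟩ := ((isCompact_closedBall z₀ ε).prod
    (isCompact_closedBall (0 : Fin n → ℂ) ε)).exists_bound_of_continuousOn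
    (f := Function.uncurry a) fun p hp => (has p.1 (hKO hp.1) p.2 (by
      have := mem_closedBall_zero_iff.1 hp.2
      linarith)).continuousAt.continuousWithinAt
  obtain ⟨C, hC⟩ := laplace_expansion_uniform (O := Metric.ball z₀ ρ) (c := cFun φ φt) (a := a)
    (G := leviMatrix φ) (A := A) (C₃ := C₃)
    (isCompact_closedBall z₀ ε) hKO (fun z hz => hsm z (hKΩ (Metric.ball_subset_closedBall hz)))
    (fun z hz => hpos z (hKΩ (Metric.ball_subset_closedBall hz))) hκ
    (fun z hz => hquad z (Metric.ball_subset_closedBall (hKO hz))) hε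
    (fun z hz u hu => contDiffAt_cFun hΩ hφt hφ (hin z hz u (by linarith)).1
      (hin z hz u (by linarith)).2)
    (fun z hz u hu => has z hz u (by linarith))
    (fun z hz u hu => hC₃ z (by have := mem_closedBall_iff_norm.1 hz; linarith) u (by linarith))
    (fun z hz u hu => by
      refine (hC₃ z (by have := mem_closedBall_iff_norm.1 hz; linarith) u (by linarith)).trans ?_
      calc C₃ * ‖u‖ ^ 3 ≤ (|C₃| + 1) * ‖u‖ ^ 3 := by
            gcongr; linarith [le_abs_self C₃]
        _ = ((|C₃| + 1) * ‖u‖) * ‖u‖ ^ 2 := by ring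
        _ ≤ ((|C₃| + 1) * ε) * ‖u‖ ^ 2 := by gcongr
        _ ≤ κ / 2 * ‖u‖ ^ 2 := by gcongr)
    (fun z hz u hu => hA (z, u) ⟨hz, mem_closedBall_zero_iff.2 hu.le⟩) N
  refine ⟨C, fun k hk z hz => ?_⟩
  refine le_trans (le_of_eq ?_) (hC k hk z hz)
  congr 2
  · congr 2
    ext u
    congr 3
    simp only [cFun, quad]
    ring
  · rw [Finset.mul_sum]
    refine Finset.sum_congr rfl fun l _ => ?_
    rw [localCoeff, bFun, mul_left_comm]
    simp only [ha, mul_assoc]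

end LocalExpansion

/-! ### Kernels and traces in rank one -/

section RankOne

variable {V V' : Type*} [AddCommGroup V] [Module ℂ V] [AddCommGroup V'] [Module ℂ V']

theorem trace_eq_of_finrank_eq_one (hV : Module.finrank ℂ V = 1) {A : V →ₗ[ℂ] V} {v : V}
    (hv : v ≠ 0) {α : ℂ} (h : A v = α • v) : LinearMap.trace ℂ V A = α := by
  have : Module.Finite ℂ V := Module.finite_of_finrank_eq_succ hV
  obtain ⟨c, hc, -⟩ := LinearMap.existsUnique_eq_smul_id_of_finrank_eq_one hV A
  have hc' : A = c • LinearMap.id := hc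
  have : c • v = α • v := by rw [← h, hc']; simp
  rw [hc', map_smul, LinearMap.trace_id, hV, smul_left_injective ℂ hv this]
  simp

theorem eq_trace_smul_id (hV : Module.finrank ℂ V = 1) (A : V →ₗ[ℂ] V) :
    A = LinearMap.trace ℂ V A • LinearMap.id := by
  have : Module.Finite ℂ V := Module.finite_of_finrank_eq_succ hV
  obtain ⟨c, hc, -⟩ := LinearMap.existsUnique_eq_smul_id_of_finrank_eq_one hV A
  have hc' : A = c • LinearMap.id := hc
  rw [hc', map_smul, LinearMap.trace_id, hV]
  simp

theorem finrank_tensorPower_tensor (hV : Module.finrank ℂ V = 1) (hV' : Module.finrank ℂ V' = 1)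
    (k : ℕ) : Module.finrank ℂ ((⨂[ℂ] _ : Fin k, V) ⊗[ℂ] V') = 1 := by
  have : Module.Finite ℂ V := Module.finite_of_finrank_eq_succ hV
  let b := Module.finBasisOfFinrankEq ℂ V hV
  rw [Module.finrank_tensorProduct, hV', mul_one,
    Module.finrank_eq_card_basis (Basis.piTensorProduct fun _ : Fin k => b)]
  simp

theorem trace_map_tensorPower (hV : Module.finrank ℂ V = 1) (hV' : Module.finrank ℂ V' = 1)
    (A : V →ₗ[ℂ] V) (A' : V' →ₗ[ℂ] V') (k : ℕ) :
    LinearMap.trace ℂ ((⨂[ℂ] _ : Fin k, V) ⊗[ℂ] V')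
        (TensorProduct.map (PiTensorProduct.map fun _ : Fin k => A) A')
      = LinearMap.trace ℂ V A ^ k * LinearMap.trace ℂ V' A' := by
  have : Module.Finite ℂ ((⨂[ℂ] _ : Fin k, V) ⊗[ℂ] V') :=
    Module.finite_of_finrank_eq_succ (finrank_tensorPower_tensor hV hV' k)
  set α := LinearMap.trace ℂ V A with hα
  set α' := LinearMap.trace ℂ V' A' with hα'
  have h1 : PiTensorProduct.map (fun _ : Fin k => A)
      = α ^ k • (LinearMap.id : (⨂[ℂ] _ : Fin k, V) →ₗ[ℂ] _) := by
    refine PiTensorProduct.ext (MultilinearMap.ext fun x => ?_)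
    have : (fun i => A (x i)) = fun i => α • x i := by
      ext i; conv_lhs => rw [eq_trace_smul_id hV A]
      rfl
    simp only [LinearMap.compMultilinearMap_apply, PiTensorProduct.map_tprod, this]
    rw [MultilinearMap.map_smul_univ]
    simp
  rw [h1, eq_trace_smul_id hV' A', ← hα', TensorProduct.map_smul_left,
    TensorProduct.map_smul_right, TensorProduct.map_id, map_smul, map_smul, LinearMap.trace_id,
    finrank_tensorPower_tensor hV hV']
  simp

end RankOne

section Kernel

variable {n : ℕ} {M : Type*}
  {L : M → Type*} [∀ x, NormedAddCommGroup (L x)] [∀ x, InnerProductSpace ℂ (L x)]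
  {L' : M → Type*} [∀ x, NormedAddCommGroup (L' x)] [∀ x, InnerProductSpace ℂ (L' x)]

/-- The contraction `E(x, ȳ) · E(y, x̄)` of a section of `L ⊠ L̄` with its transpose, as a complex
number. For the canonical extension it is `exp (-ψ)`, with `ψ` the diastasis. -/
noncomputable def kernelTrace (E : Kernel L) (p : M × M) : ℂ :=
  LinearMap.trace ℂ (L p.1) ((E p.1 p.2 : L p.2 →ₗ[ℂ] L p.1) ∘ₗ (E p.2 p.1 : L p.1 →ₗ[ℂ] L p.2))

theorem finrank_fiber [TopologicalSpace M] [TopologicalSpace (Bundle.TotalSpace ℂ L)]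
    [FiberBundle ℂ L] [VectorBundle ℂ ℂ L] (x : M) : Module.finrank ℂ (L x) = 1 := by
  rw [((trivializationAt ℂ L x).continuousLinearEquivAt ℂ x
    (FiberBundle.mem_baseSet_trivializationAt ℂ L x)).toLinearEquiv.finrank_eq]
  simp

theorem norm_kernelTrace_le (hL : ∀ x, Module.finrank ℂ (L x) = 1) (E : Kernel L) (p : M × M) :
    ‖kernelTrace E p‖ ≤ ‖E p.1 p.2‖ * ‖E p.2 p.1‖ := by
  have h := eq_trace_smul_id (hL p.1)
    ((E p.1 p.2 : L p.2 →ₗ[ℂ] L p.1) ∘ₗ (E p.2 p.1 : L p.1 →ₗ[ℂ] L p.2))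
  have : Nontrivial (L p.1) := Module.nontrivial_of_finrank_eq_succ (hL p.1)
  obtain ⟨v, hv⟩ := exists_ne (0 : L p.1)
  have h2 : E p.1 p.2 (E p.2 p.1 v) = kernelTrace E p • v := DFunLike.congr_fun h v
  have hv' := norm_pos_iff.2 hv
  refine le_of_mul_le_mul_right ?_ hv'
  rw [← norm_smul, ← h2, mul_assoc]
  exact (ContinuousLinearMap.le_opNorm _ _).trans
    (mul_le_mul_of_nonneg_left (ContinuousLinearMap.le_opNorm _ _) (norm_nonneg _))

theorem kernelTrace_eq_of_rankOne (hL : ∀ x, Module.finrank ℂ (L x) = 1) {x y : M} {v : L x}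
    {w : L y} (hv : v ≠ 0) {a b : ℂ} (ha : E x y = a • InnerProductSpace.rankOne ℂ v w)
    (hb : E y x = b • InnerProductSpace.rankOne ℂ w v) :
    kernelTrace E (x, y) = a * b * ((‖v‖ ^ 2 : ℝ) : ℂ) * ((‖w‖ ^ 2 : ℝ) : ℂ) := by
  refine trace_eq_of_finrank_eq_one (hL x) hv ?_
  simp only [LinearMap.comp_apply, ContinuousLinearMap.coe_coe, ha, hb,
    _root_.smul_apply, InnerProductSpace.rankOne_apply,
    inner_self_eq_norm_sq_to_K, smul_smul, map_smul]
  congr 1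
  push_cast
  simp only [Complex.coe_algebraMap]
  ring

theorem trace_toeplitzKernel_comp (hL : ∀ x, Module.finrank ℂ (L x) = 1)
    (hL' : ∀ x, Module.finrank ℂ (L' x) = 1) (ρ : M × M → ℝ) (E : Kernel L) (E' : Kernel L')
    (ft gt : M × M → ℂ) (k : ℕ) (x y : M) :
    LinearMap.trace ℂ (PowFiber L L' k x)
        (toeplitzKernel n ρ E E' ft k x y ∘ₗ toeplitzKernel n ρ E E' gt k y x)
      = ((k : ℂ) / (2 * (Real.pi : ℂ))) ^ (2 * n) * ((ρ (x, y) : ℂ) * (ρ (y, x) : ℂ) *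
          (ft (x, y) * gt (y, x) * (kernelTrace E (x, y) ^ k * kernelTrace E' (x, y)))) := by
  rw [toeplitzKernel, toeplitzKernel, LinearMap.smul_comp, LinearMap.comp_smul,
    ← TensorProduct.map_comp, ← PiTensorProduct.map_comp, map_smul, map_smul,
    trace_map_tensorPower (hL x) (hL' x)]
  simp only [kernelTrace, smul_eq_mul]
  ring

end Kernel

/-! ### Holomorphic kernels in frames and charts -/

section HolKernel

variable {n : ℕ} {M : Type*} [TopologicalSpace M] [ChartedSpace (Fin n → ℂ) M]

theorem SesquiHolOn.sesquiAnalyticOn {W : Set (M × M)} {F : M × M → ℂ} (hF : SesquiHolOn n W F)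
    {e : OpenPartialHomeomorph M (Fin n → ℂ)}
    (he : e ∈ IsManifold.maximalAtlas 𝓘(ℂ, Fin n → ℂ) ω M) {Ω : Set (Fin n → ℂ)}
    (hΩ : Ω ⊆ e.target) (hW : ∀ z ∈ Ω, ∀ w ∈ Ω, (e.symm z, e.symm w) ∈ W) :
    SesquiAnalyticOn Ω (inChart n e F) := fun z hz w hw =>
  hF e he e he (z, star w)
    ⟨hΩ hz, by simpa using hΩ hw, by simpa using hW z hz w hw⟩

theorem SesquiHolOn.continuousOn [IsManifold 𝓘(ℂ, Fin n → ℂ) ω M] {W : Set (M × M)}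
    {F : M × M → ℂ} (hF : SesquiHolOn n W F) : ContinuousOn F W := by
  rintro ⟨x, y⟩ hxy
  set e := chartAt (Fin n → ℂ) x
  set e' := chartAt (Fin n → ℂ) y
  have hx : x ∈ e.source := mem_chart_source _ x
  have hy : y ∈ e'.source := mem_chart_source _ y
  have h := (hF e (IsManifold.chart_mem_maximalAtlas x) e' (IsManifold.chart_mem_maximalAtlas y)
    (e x, star (e' y)) ⟨e.map_source hx, by simpa using e'.map_source hy,
      by simpa [e.left_inv hx, e'.left_inv hy] using hxy⟩).continuousAt
  have h1 : ContinuousAt (fun q : M × M => (e q.1, star (e' q.2))) (x, y) := by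
    have h2 : ContinuousAt (fun q : M × M => e q.1) (x, y) :=
      ContinuousAt.comp (f := Prod.fst) (x := (x, y)) (e.continuousAt hx) continuousAt_fst
    have h3 : ContinuousAt (fun q : M × M => e' q.2) (x, y) :=
      ContinuousAt.comp (f := Prod.snd) (x := (x, y)) (e'.continuousAt hy) continuousAt_snd
    exact h2.prodMk h3.star
  have h4 := ContinuousAt.comp (f := fun q : M × M => (e q.1, star (e' q.2))) (x := (x, y)) h h1
  refine (h4.congr ?_).continuousWithinAt
  filter_upwards [(e.open_source.prod e'.open_source).mem_nhds ⟨hx, hy⟩] with q hq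
  simp [e.left_inv hq.1, e'.left_inv hq.2]

variable {L : M → Type*} [∀ x, NormedAddCommGroup (L x)] [∀ x, InnerProductSpace ℂ (L x)]
  [TopologicalSpace (Bundle.TotalSpace ℂ L)] [FiberBundle ℂ L]

omit [∀ x, InnerProductSpace ℂ (L x)] in
theorem IsHolFrameOn.mono {U V : Set M} {s : ∀ x, L x} (hs : IsHolFrameOn n L U s) (h : V ⊆ U) :
    IsHolFrameOn n L V s := ⟨hs.1.mono h, fun x hx => hs.2 x (h hx)⟩

theorem exists_isHolFrameOn [VectorBundle ℂ ℂ L] [IsManifold 𝓘(ℂ, Fin n → ℂ) ω M]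
    [ContMDiffVectorBundle ω ℂ L 𝓘(ℂ, Fin n → ℂ)] (x : M) :
    ∃ U : Set M, IsOpen U ∧ x ∈ U ∧ ∃ s : ∀ x, L x, IsHolFrameOn n L U s := by
  set T := trivializationAt ℂ L x
  let b : Module.Basis (Fin 1) ℂ ℂ := Module.Basis.singleton (Fin 1) ℂ
  refine ⟨T.baseSet, T.open_baseSet, FiberBundle.mem_baseSet_trivializationAt ℂ L x,
    T.localFrame b 0, T.contMDiffOn_localFrame_baseSet ω b 0, fun y hy => ?_⟩
  rw [T.localFrame_apply_of_mem_baseSet b hy]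
  exact (T.basisAt b hy).ne_zero 0

/-- Charts with a frame over their whole domain exist near each point: restrict a chart to the base
of a trivialization. -/
theorem exists_chart_isHolFrameOn [VectorBundle ℂ ℂ L] [IsManifold 𝓘(ℂ, Fin n → ℂ) ω M]
    [ContMDiffVectorBundle ω ℂ L 𝓘(ℂ, Fin n → ℂ)] {V : Set M} (hV : IsOpen V) {x : M}
    (hx : x ∈ V) :
    ∃ e ∈ IsManifold.maximalAtlas 𝓘(ℂ, Fin n → ℂ) ω M, x ∈ e.source ∧ e.source ⊆ V ∧
      ∃ s : ∀ x, L x, IsHolFrameOn n L e.source s := by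
  obtain ⟨U, hU, hxU, s, hs⟩ := exists_isHolFrameOn (n := n) (L := L) x
  have hUV := hU.inter hV
  refine ⟨(chartAt (Fin n → ℂ) x).restr (U ∩ V), ?_, ?_, ?_, s, hs.mono ?_⟩
  · exact restr_mem_maximalAtlas _ (IsManifold.chart_mem_maximalAtlas x) hUV
  · rw [OpenPartialHomeomorph.restr_source, hUV.interior_eq]
    exact ⟨mem_chart_source _ x, hxU, hx⟩
  · rw [OpenPartialHomeomorph.restr_source, hUV.interior_eq]
    exact fun y hy => hy.2.2
  · rw [OpenPartialHomeomorph.restr_source, hUV.interior_eq]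
    exact fun y hy => hy.2.1

variable {W : Set (M × M)} {E : Kernel L}

/-- If `E` is the identity on the diagonal, its coefficient in a frame `v` is `|v|⁻²` there. -/
theorem IsCanonicalExtension.coeff_diag (hE : IsCanonicalExtension n L W E) {x : M} {v : L x}
    (hv : v ≠ 0) {a : ℂ} (ha : E x x = a • InnerProductSpace.rankOne ℂ v v) :
    a = ((‖v‖ ^ 2 : ℝ) : ℂ)⁻¹ := by
  have h := congrArg (fun A : L x →L[ℂ] L x => A v) (ha.symm.trans (hE.2 x))
  simp only [_root_.smul_apply, InnerProductSpace.rankOne_apply,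
    ContinuousLinearMap.id_apply, inner_self_eq_norm_sq_to_K, smul_smul] at h
  have h1 : a * (‖v‖ : ℂ) ^ 2 = 1 := by
    have : (a * (‖v‖ : ℂ) ^ 2) • v = (1 : ℂ) • v := by simpa using h
    exact smul_left_injective ℂ hv this
  push_cast
  exact eq_inv_of_mul_eq_one_left h1

theorem IsCanonicalExtension.continuousOn_norm_sq [IsManifold 𝓘(ℂ, Fin n → ℂ) ω M]
    (hE : IsCanonicalExtension n L W E) (hdiag : ∀ x, (x, x) ∈ W) {U : Set M} (hU : IsOpen U)
    {s : ∀ x, L x} (hs : IsHolFrameOn n L U s) :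
    ContinuousOn (fun x => ((‖s x‖ ^ 2 : ℝ) : ℂ)) U := by
  obtain ⟨a, ha, haE⟩ := hE.1 U U s s hU hU hs hs
  have h1 : ContinuousOn (fun x => (a (x, x))⁻¹) U := by
    refine (ha.continuousOn.comp (continuous_id.prodMk continuous_id).continuousOn
      fun x hx => ⟨hdiag x, hx, hx⟩).inv₀ fun x hx => ?_
    have h2 := hE.coeff_diag (hs.2 x hx) (haE x x ⟨hdiag x, hx, hx⟩)
    simp only [Function.comp_apply, id_eq, h2]
    have := norm_ne_zero_iff.2 (hs.2 x hx)
    simpa using this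
  refine h1.congr fun x hx => ?_
  simp only [hE.coeff_diag (hs.2 x hx) (haE x x ⟨hdiag x, hx, hx⟩), inv_inv]

/-- In local frames, `E(x, ȳ) · E(y, x̄)` is the product of two holomorphic coefficients and of the
squared norms of the frames, which are continuous because they are the inverses of the coefficients
on the diagonal. -/
theorem continuousOn_kernelTrace [VectorBundle ℂ ℂ L] [IsManifold 𝓘(ℂ, Fin n → ℂ) ω M]
    [ContMDiffVectorBundle ω ℂ L 𝓘(ℂ, Fin n → ℂ)] (hW : IsOpen W) (hdiag : ∀ x, (x, x) ∈ W)
    (hE : IsCanonicalExtension n L W E) :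
    ContinuousOn (kernelTrace E) (W ∩ Prod.swap ⁻¹' W) := by
  rintro ⟨x, y⟩ ⟨hxy, hyx⟩
  obtain ⟨U, hU, hxU, s, hs⟩ := exists_isHolFrameOn (n := n) (L := L) x
  obtain ⟨V, hV, hyV, t, ht⟩ := exists_isHolFrameOn (n := n) (L := L) y
  obtain ⟨a, ha, haE⟩ := hE.1 U V s t hU hV hs ht
  obtain ⟨b, hb, hbE⟩ := hE.1 V U t s hV hU ht hs
  have hO : IsOpen (W ∩ Prod.swap ⁻¹' W ∩ U ×ˢ V) :=
    (hW.inter (hW.preimage continuous_swap)).inter (hU.prod hV)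
  have h1 : ContinuousOn (fun p : M × M => a p * b p.swap * ((‖s p.1‖ ^ 2 : ℝ) : ℂ)
      * ((‖t p.2‖ ^ 2 : ℝ) : ℂ)) (W ∩ Prod.swap ⁻¹' W ∩ U ×ˢ V) := by
    refine ((ha.continuousOn.mono ?_ |>.mul (hb.continuousOn.comp continuous_swap.continuousOn
      ?_)).mul ((hE.continuousOn_norm_sq hdiag hU hs).comp continuous_fst.continuousOn ?_)).mul
      ((hE.continuousOn_norm_sq hdiag hV ht).comp continuous_snd.continuousOn ?_)
    · exact fun p hp => ⟨hp.1.1, hp.2⟩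
    · exact fun p hp => ⟨hp.1.2, hp.2.2, hp.2.1⟩
    · exact fun p hp => hp.2.1
    · exact fun p hp => hp.2.2
  have h2 := (h1.congr (g := kernelTrace E) fun p hp => by
    obtain ⟨p1, p2⟩ := p
    exact kernelTrace_eq_of_rankOne (fun x => finrank_fiber x) (hs.2 p1 hp.2.1)
      (haE p1 p2 ⟨hp.1.1, hp.2⟩) (hbE p2 p1 ⟨hp.1.2, hp.2.2, hp.2.1⟩))
  exact (h2.continuousAt (hO.mem_nhds ⟨⟨hxy, hyx⟩, hxU, hyV⟩)).continuousWithinAt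

/-- In the presence of a kernel `E` as above, the weight of the metric has a sesquiholomorphic
extension near each point, namely the logarithm of the coefficient of `E`. -/
theorem exists_potential [IsManifold 𝓘(ℂ, Fin n → ℂ) ω M]
    (hdiag : ∀ x, (x, x) ∈ W) (hE : IsCanonicalExtension n L W E)
    {e : OpenPartialHomeomorph M (Fin n → ℂ)}
    (he : e ∈ IsManifold.maximalAtlas 𝓘(ℂ, Fin n → ℂ) ω M) {s : ∀ x, L x}
    (hs : IsHolFrameOn n L e.source s) {z₀ : Fin n → ℂ} (hz₀ : z₀ ∈ e.target) :
    ∃ Ω : Set (Fin n → ℂ), IsOpen Ω ∧ z₀ ∈ Ω ∧ Ω ⊆ e.target ∧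
      ∃ φt : (Fin n → ℂ) → (Fin n → ℂ) → ℂ, SesquiAnalyticOn Ω φt ∧
        ∀ z ∈ Ω, φt z z = weightIn n L e s z := by
  obtain ⟨a, ha, haE⟩ := hE.1 e.source e.source s s e.open_source e.open_source hs hs
  have hdiag' : ∀ z ∈ e.target, a (e.symm z, e.symm z) = ((‖s (e.symm z)‖ ^ 2 : ℝ) : ℂ)⁻¹ :=
    fun z hz => hE.coeff_diag (hs.2 _ (e.map_target hz))
      (haE _ _ ⟨hdiag _, e.map_target hz, e.map_target hz⟩)
  set H : (Fin n → ℂ) × (Fin n → ℂ) → ℂ := fun p => a (e.symm p.1, e.symm (star p.2)) with hH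
  have hpos : ∀ z ∈ e.target, 0 < (‖s (e.symm z)‖ ^ 2)⁻¹ := fun z hz => by
    have := norm_pos_iff.2 (hs.2 _ (e.map_target hz))
    positivity
  have hHa : AnalyticAt ℂ H (z₀, star z₀) := ha e he e he _
    ⟨hz₀, by simpa using hz₀, by simpa using ⟨hdiag _, e.map_target hz₀⟩⟩
  have hH0 : H (z₀, star z₀) ∈ Complex.slitPlane := by
    simp only [hH, star_star, hdiag' z₀ hz₀]
    rw [← Complex.ofReal_inv]
    exact Complex.ofReal_mem_slitPlane.2 (hpos z₀ hz₀)
  have hev := hHa.eventually_analyticAt.and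
    (hHa.continuousAt.eventually (Complex.isOpen_slitPlane.mem_nhds hH0))
  obtain ⟨r, hr, hball⟩ := Metric.eventually_nhds_iff.1 hev
  refine ⟨Metric.ball z₀ r ∩ e.target, Metric.isOpen_ball.inter e.open_target,
    ⟨Metric.mem_ball_self hr, hz₀⟩, inter_subset_right, fun z w => Complex.log (H (z, star w)),
    fun z hz w hw => ?_, fun z hz => ?_⟩
  · have h1 := @hball (z, star w) (by
      rw [Prod.dist_eq, max_lt_iff]
      refine ⟨hz.1, ?_⟩
      rw [dist_eq_norm, ← star_sub, norm_star, ← dist_eq_norm]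
      exact hw.1)
    have h2 := h1.1.clog h1.2
    simpa using h2
  · simp only [hH, star_star, hdiag' z hz.2, weightIn, weight]
    rw [← Complex.ofReal_inv, ← Complex.ofReal_log (hpos z hz.2).le, Real.log_inv]

/-- The coefficient of `E` is `exp φ̃`, hence its contraction with its transpose is `exp (-ψ)`. -/
theorem eventually_kernelTrace_eq [VectorBundle ℂ ℂ L] (hW : IsOpen W)
    (hdiag : ∀ x, (x, x) ∈ W) (hE : IsCanonicalExtension n L W E)
    {e : OpenPartialHomeomorph M (Fin n → ℂ)}
    (he : e ∈ IsManifold.maximalAtlas 𝓘(ℂ, Fin n → ℂ) ω M) {s : ∀ x, L x}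
    (hs : IsHolFrameOn n L e.source s) {Ω : Set (Fin n → ℂ)} (hΩ : IsOpen Ω)
    (hΩe : Ω ⊆ e.target) {φt : (Fin n → ℂ) → (Fin n → ℂ) → ℂ} (hφt : SesquiAnalyticOn Ω φt)
    (hφ : ∀ z ∈ Ω, φt z z = weightIn n L e s z) {z₀ : Fin n → ℂ} (hz₀ : z₀ ∈ Ω) :
    ∀ᶠ p in 𝓝 (z₀, z₀), kernelTrace E (e.symm p.1, e.symm p.2)
      = Complex.exp (-diastasis φt p.1 p.2) := by
  obtain ⟨a, ha, haE⟩ := hE.1 e.source e.source s s e.open_source e.open_source hs hs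
  have hdiag' : ∀ z ∈ e.target, a (e.symm z, e.symm z) = ((‖s (e.symm z)‖ ^ 2 : ℝ) : ℂ)⁻¹ :=
    fun z hz => hE.coeff_diag (hs.2 _ (e.map_target hz))
      (haE _ _ ⟨hdiag _, e.map_target hz, e.map_target hz⟩)
  have hexp : ∀ z ∈ Ω, Complex.exp (φt z z) = ((‖s (e.symm z)‖ ^ 2 : ℝ) : ℂ)⁻¹ := by
    intro z hz
    have := norm_pos_iff.2 (hs.2 _ (e.map_target (hΩe hz)))
    rw [hφ z hz, weightIn, weight, ← Complex.ofReal_exp, Real.exp_neg,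
      Real.exp_log (by positivity), Complex.ofReal_inv]
  have hHa : AnalyticAt ℂ (fun p : (Fin n → ℂ) × (Fin n → ℂ) =>
      a (e.symm p.1, e.symm (star p.2)) - Complex.exp (φt p.1 (star p.2))) (z₀, star z₀) :=
    (ha e he e he _ ⟨hΩe hz₀, by simpa using hΩe hz₀,
      by simpa using ⟨hdiag _, e.map_target (hΩe hz₀)⟩⟩).sub (hφt z₀ hz₀ z₀ hz₀).cexp
  have h1 := eventually_eq_zero_of_comp_star hHa (by
    filter_upwards [hΩ.mem_nhds hz₀] with z hz
    simp only [star_star]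
    rw [hdiag' z (hΩe hz), hexp z hz, sub_self])
  have hc1 : Tendsto (fun p : (Fin n → ℂ) × (Fin n → ℂ) => (p.1, star p.2)) (𝓝 (z₀, z₀))
      (𝓝 (z₀, star z₀)) :=
    (continuous_fst.prodMk continuous_snd.star).tendsto' _ _ rfl
  have hc2 : Tendsto (fun p : (Fin n → ℂ) × (Fin n → ℂ) => (p.2, star p.1)) (𝓝 (z₀, z₀))
      (𝓝 (z₀, star z₀)) :=
    (continuous_snd.prodMk continuous_fst.star).tendsto' _ _ rfl
  have hWe : ∀ᶠ p : (Fin n → ℂ) × (Fin n → ℂ) in 𝓝 (z₀, z₀),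
      (e.symm p.1, e.symm p.2) ∈ W ∩ Prod.swap ⁻¹' W := by
    have hc : ContinuousAt (fun p : (Fin n → ℂ) × (Fin n → ℂ) => (e.symm p.1, e.symm p.2))
        (z₀, z₀) :=
      (ContinuousAt.comp (f := Prod.fst) (x := (z₀, z₀)) (e.continuousAt_symm (hΩe hz₀))
        continuousAt_fst).prodMk (ContinuousAt.comp (f := Prod.snd) (x := (z₀, z₀))
        (e.continuousAt_symm (hΩe hz₀)) continuousAt_snd)
    exact hc.eventually ((hW.inter (hW.preimage continuous_swap)).mem_nhds
      ⟨hdiag _, hdiag _⟩)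
  filter_upwards [hc1.eventually h1, hc2.eventually h1, hWe,
    (hΩ.prod hΩ).mem_nhds ⟨hz₀, hz₀⟩] with p hp1 hp2 hpW hpΩ
  obtain ⟨z, w⟩ := p
  have hz : z ∈ Ω := hpΩ.1
  have hw : w ∈ Ω := hpΩ.2
  simp only [star_star, sub_eq_zero] at hp1 hp2
  have hze := e.map_target (hΩe hz)
  have hwe := e.map_target (hΩe hw)
  rw [kernelTrace_eq_of_rankOne (fun x => finrank_fiber x) (hs.2 _ hze)
    (haE _ _ ⟨hpW.1, hze, hwe⟩) (haE _ _ ⟨hpW.2, hwe, hze⟩), hp1, hp2,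
    ← inv_inv (((‖s (e.symm z)‖ ^ 2 : ℝ) : ℂ)), ← inv_inv (((‖s (e.symm w)‖ ^ 2 : ℝ) : ℂ)),
    ← hexp z hz, ← hexp w hw, ← Complex.exp_neg, ← Complex.exp_neg, ← Complex.exp_add,
    ← Complex.exp_add, ← Complex.exp_add]
  congr 1
  simp only [diastasis]
  ring

end HolKernel

/-! ### The Levi form and changes of charts -/

section ChartChange

variable {n : ℕ} {M : Type*} [TopologicalSpace M] [ChartedSpace (Fin n → ℂ) M]
  {L : M → Type*} [∀ x, NormedAddCommGroup (L x)] [∀ x, InnerProductSpace ℂ (L x)]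
  [TopologicalSpace (Bundle.TotalSpace ℂ L)] [FiberBundle ℂ L] [VectorBundle ℂ ℂ L]
  {W : Set (M × M)} {E : Kernel L}

/-- The Levi form is the second order part of `1 - E(x, ȳ) · E(y, x̄)`, which depends on no chart
and no frame. -/
theorem tendsto_kernelTrace_quad [IsManifold 𝓘(ℂ, Fin n → ℂ) ω M] (hW : IsOpen W)
    (hdiag : ∀ x, (x, x) ∈ W) (hE : IsCanonicalExtension n L W E)
    {e : OpenPartialHomeomorph M (Fin n → ℂ)}
    (he : e ∈ IsManifold.maximalAtlas 𝓘(ℂ, Fin n → ℂ) ω M) {s : ∀ x, L x}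
    (hs : IsHolFrameOn n L e.source s) {z₀ : Fin n → ℂ} (hz₀ : z₀ ∈ e.target)
    {v : ℝ → (Fin n → ℂ)} {w : Fin n → ℂ}
    (hv : Tendsto (fun t => t⁻¹ • v t) (𝓝[>] 0) (𝓝 w)) :
    Tendsto (fun t : ℝ => (1 - kernelTrace E (e.symm z₀, e.symm (z₀ + v t))) / (t : ℂ) ^ 2)
      (𝓝[>] 0) (𝓝 (quad (leviMatrix (weightIn n L e s) z₀) w)) := by
  obtain ⟨Ω, hΩ, hz₀Ω, hΩe, φt, hφt, hφ⟩ := exists_potential hdiag hE he hs hz₀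
  set G := leviMatrix (weightIn n L e s) z₀ with hG
  obtain ⟨r, hr, C, hC⟩ := exists_norm_cFun_le hΩ hφt hφ hz₀Ω
  have htpos : ∀ᶠ t : ℝ in 𝓝[>] 0, 0 < t := self_mem_nhdsWithin
  have ht0 : Tendsto (fun t : ℝ => t) (𝓝[>] 0) (𝓝 0) := nhdsWithin_le_nhds
  have hvt : ∀ t : ℝ, 0 < t → v t = t • (t⁻¹ • v t) := fun t ht => by
    rw [smul_smul, mul_inv_cancel₀ ht.ne', one_smul]
  have hv0 : Tendsto v (𝓝[>] 0) (𝓝 0) := by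
    have := ht0.smul hv
    rw [zero_smul] at this
    refine this.congr' ?_
    filter_upwards [htpos] with t ht using (hvt t ht).symm
  set D : ℝ → ℂ := fun t => diastasis φt z₀ (z₀ + v t) with hD
  have hDt : Tendsto (fun t => D t / (t : ℂ) ^ 2) (𝓝[>] 0) (𝓝 (quad G w)) := by
    have h1 : Tendsto (fun t => cFun (weightIn n L e s) φt z₀ (v t) / (t : ℂ) ^ 2) (𝓝[>] 0)
        (𝓝 0) := by
      have h2 : Tendsto (fun t : ℝ => C * (t * ‖t⁻¹ • v t‖ ^ 3)) (𝓝[>] 0) (𝓝 0) := by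
        have := (ht0.mul (hv.norm.pow 3)).const_mul C
        simpa using this
      refine squeeze_zero_norm' ?_ h2
      filter_upwards [htpos, hv0.norm.eventually (gt_mem_nhds (by simpa using hr))] with t ht hvr
      rw [norm_div, norm_pow, Complex.norm_real, Real.norm_of_nonneg ht.le,
        div_le_iff₀ (by positivity)]
      refine (hC z₀ (by simpa using hr) (v t) hvr).trans (le_of_eq ?_)
      rw [norm_smul, norm_inv, Real.norm_of_nonneg ht.le]
      field_simp
    have h3 : Tendsto (fun t => quad G (t⁻¹ • v t)) (𝓝[>] 0) (𝓝 (quad G w)) :=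
      ((continuous_quad G).tendsto w).comp hv
    have h4 := h3.sub h1
    rw [sub_zero] at h4
    refine h4.congr' ?_
    filter_upwards [htpos] with t ht
    have ht' : (t : ℂ) ≠ 0 := by exact_mod_cast ht.ne'
    have h5 : quad G (v t) = (t : ℂ) ^ 2 * quad G (t⁻¹ • v t) := by
      conv_lhs => rw [hvt t ht, quad_smul]
    have h6 : cFun (weightIn n L e s) φt z₀ (v t) = quad G (v t) - D t := rfl
    rw [h6, h5]
    field_simp
    ring
  have hD0 : Tendsto D (𝓝[>] 0) (𝓝 0) := by
    have h1 : Tendsto (fun t : ℝ => (t : ℂ) ^ 2) (𝓝[>] 0) (𝓝 0) := by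
      have := ((Complex.continuous_ofReal.tendsto 0).comp ht0).pow 2
      simpa using this
    have h2 := h1.mul hDt
    rw [zero_mul] at h2
    refine h2.congr' ?_
    filter_upwards [htpos] with t ht
    have ht' : (t : ℂ) ≠ 0 := by exact_mod_cast ht.ne'
    field_simp
  have hrem : Tendsto (fun t => (Complex.exp (-D t) - 1 - (-D t)) / (t : ℂ) ^ 2) (𝓝[>] 0)
      (𝓝 0) := by
    have h1 : Tendsto (fun t => ‖D t‖ * ‖D t / (t : ℂ) ^ 2‖) (𝓝[>] 0) (𝓝 0) := by
      have := hD0.norm.mul hDt.norm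
      simpa using this
    refine squeeze_zero_norm' ?_ h1
    filter_upwards [hD0.norm.eventually (ge_mem_nhds (by simp : ‖(0 : ℂ)‖ < 1))] with t ht
    have h2 := Complex.norm_exp_sub_one_sub_id_le (x := -D t) (by simpa using ht)
    rw [norm_div, norm_div, mul_div_assoc']
    gcongr
    simpa [sq] using h2
  have hfin := hDt.sub hrem
  rw [sub_zero] at hfin
  refine hfin.congr' ?_
  have hτ : ∀ᶠ t in 𝓝[>] (0 : ℝ), kernelTrace E (e.symm z₀, e.symm (z₀ + v t))
      = Complex.exp (-D t) := by
    have h1 : Tendsto (fun t => (z₀, z₀ + v t)) (𝓝[>] 0) (𝓝 (z₀, z₀)) := by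
      have := (tendsto_const_nhds (x := z₀)).prodMk_nhds
        ((tendsto_const_nhds (x := z₀)).add hv0)
      simpa using this
    exact h1.eventually (eventually_kernelTrace_eq hW hdiag hE he hs hΩ hΩe hφt hφ hz₀Ω)
  filter_upwards [hτ] with t ht
  rw [ht]
  ring

variable {e e' : OpenPartialHomeomorph M (Fin n → ℂ)}

theorem hasFDerivAt_chartChange [IsManifold 𝓘(ℂ, Fin n → ℂ) ω M]
    (he : e ∈ IsManifold.maximalAtlas 𝓘(ℂ, Fin n → ℂ) ω M)
    (he' : e' ∈ IsManifold.maximalAtlas 𝓘(ℂ, Fin n → ℂ) ω M) {z : Fin n → ℂ}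
    (hz : z ∈ e.target) (hz' : e.symm z ∈ e'.source) :
    HasFDerivAt (fun w => e' (e.symm w)) (fderiv ℝ (fun w => e' (e.symm w)) z) z := by
  have hO : IsOpen (e.target ∩ e.symm ⁻¹' e'.source) :=
    e.continuousOn_symm.isOpen_inter_preimage e.open_target e'.open_source
  have h1 : ContMDiffOn 𝓘(ℂ, Fin n → ℂ) 𝓘(ℂ, Fin n → ℂ) ω (e' ∘ e.symm)
      (e.target ∩ e.symm ⁻¹' e'.source) :=
    (contMDiffOn_of_mem_maximalAtlas he').comp
      ((contMDiffOn_symm_of_mem_maximalAtlas he).mono inter_subset_left) fun w hw => hw.2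
  have h2 := ((contMDiffOn_iff_contDiffOn.1 h1).contDiffAt (hO.mem_nhds ⟨hz, hz'⟩))
  have h3 := (h2.differentiableAt (by simp)).restrictScalars ℝ
  exact h3.hasFDerivAt

theorem det_fderiv_chartChange_ne_zero [IsManifold 𝓘(ℂ, Fin n → ℂ) ω M]
    (he : e ∈ IsManifold.maximalAtlas 𝓘(ℂ, Fin n → ℂ) ω M)
    (he' : e' ∈ IsManifold.maximalAtlas 𝓘(ℂ, Fin n → ℂ) ω M) {z : Fin n → ℂ}
    (hz : z ∈ e.target) (hz' : e.symm z ∈ e'.source) :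
    (fderiv ℝ (fun w => e' (e.symm w)) z).det ≠ 0 := by
  have h1 := hasFDerivAt_chartChange he he' hz hz'
  have hz2 : e'.symm (e' (e.symm z)) = e.symm z := e'.left_inv hz'
  have h2 := hasFDerivAt_chartChange he' he (e'.map_source hz')
    (by rw [hz2]; exact e.map_target hz)
  have h3 := h2.comp z h1
  have h4 : ((fun w => e (e'.symm w)) ∘ fun w => e' (e.symm w)) =ᶠ[𝓝 z] id := by
    have hO : IsOpen (e.target ∩ e.symm ⁻¹' e'.source) :=
      e.continuousOn_symm.isOpen_inter_preimage e.open_target e'.open_source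
    filter_upwards [hO.mem_nhds ⟨hz, hz'⟩] with w hw
    simp [e'.left_inv hw.2, e.right_inv hw.1]
  have h5 := (h3.congr_of_eventuallyEq h4.symm).unique (hasFDerivAt_id z)
  intro h0
  have h6 := congrArg ContinuousLinearMap.det h5
  simp only [ContinuousLinearMap.det, ContinuousLinearMap.toLinearMap_comp, LinearMap.det_comp]
    at h6 h0
  rw [h0, mul_zero] at h6
  simp at h6

/-- The Levi form is transported by the differentials of the changes of charts, and does not depend
on the frame. -/
theorem quad_leviMatrix_chartChange [IsManifold 𝓘(ℂ, Fin n → ℂ) ω M] (hW : IsOpen W)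
    (hdiag : ∀ x, (x, x) ∈ W) (hE : IsCanonicalExtension n L W E)
    (he : e ∈ IsManifold.maximalAtlas 𝓘(ℂ, Fin n → ℂ) ω M)
    (he' : e' ∈ IsManifold.maximalAtlas 𝓘(ℂ, Fin n → ℂ) ω M) {s s' : ∀ x, L x}
    (hs : IsHolFrameOn n L e.source s) (hs' : IsHolFrameOn n L e'.source s') {z : Fin n → ℂ}
    (hz : z ∈ e.target) (hz' : e.symm z ∈ e'.source) (u : Fin n → ℂ) :
    quad (leviMatrix (weightIn n L e s) z) u
      = quad (leviMatrix (weightIn n L e' s') (e' (e.symm z)))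
          (fderiv ℝ (fun w => e' (e.symm w)) z u) := by
  have hD := hasFDerivAt_chartChange he he' hz hz'
  have htpos : ∀ᶠ t : ℝ in 𝓝[>] 0, 0 < t := self_mem_nhdsWithin
  have h1 : Tendsto (fun t : ℝ => t⁻¹ • (t • u)) (𝓝[>] 0) (𝓝 u) := by
    refine tendsto_const_nhds.congr' ?_
    filter_upwards [htpos] with t ht
    rw [smul_smul, inv_mul_cancel₀ ht.ne', one_smul]
  have h2 : Tendsto (fun t : ℝ => t⁻¹ • (e' (e.symm (z + t • u)) - e' (e.symm z))) (𝓝[>] 0)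
      (𝓝 (fderiv ℝ (fun w => e' (e.symm w)) z u)) := by
    have := (hD.hasLineDerivAt u).tendsto_slope_zero_right
    simpa using this
  have h3 := tendsto_kernelTrace_quad hW hdiag hE he hs hz h1
  have h4 := tendsto_kernelTrace_quad hW hdiag hE he' hs' (e'.map_source hz') h2
  refine tendsto_nhds_unique (h3.congr' ?_) h4
  have hO : IsOpen (e.target ∩ e.symm ⁻¹' e'.source) :=
    e.continuousOn_symm.isOpen_inter_preimage e.open_target e'.open_source
  have h5 : Tendsto (fun t : ℝ => z + t • u) (𝓝[>] 0) (𝓝 z) := by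
    have : Continuous fun t : ℝ => z + t • u := by fun_prop
    exact (this.tendsto' 0 z (by simp)).mono_left nhdsWithin_le_nhds
  filter_upwards [h5.eventually (hO.mem_nhds ⟨hz, hz'⟩)] with t ht
  rw [add_sub_cancel, e'.left_inv hz', e'.left_inv ht.2]

theorem det_leviMatrix_chartChange [IsManifold 𝓘(ℂ, Fin n → ℂ) ω M] (hL : IsPositive n L)
    (hW : IsOpen W) (hdiag : ∀ x, (x, x) ∈ W) (hE : IsCanonicalExtension n L W E)
    (he : e ∈ IsManifold.maximalAtlas 𝓘(ℂ, Fin n → ℂ) ω M)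
    (he' : e' ∈ IsManifold.maximalAtlas 𝓘(ℂ, Fin n → ℂ) ω M) {s s' : ∀ x, L x}
    (hs : IsHolFrameOn n L e.source s) (hs' : IsHolFrameOn n L e'.source s') {z : Fin n → ℂ}
    (hz : z ∈ e.target) (hz' : e.symm z ∈ e'.source) :
    (liouvilleDensity (weightIn n L e s) z).re
      = |(fderiv ℝ (fun w => e' (e.symm w)) z).det|
          * (liouvilleDensity (weightIn n L e' s') (e' (e.symm z))).re := by
  have h := det_eq_abs_det_mul_of_quad_comp (hL e he s hs z hz)
    (hL e' he' s' hs' _ (e'.map_source hz'))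
    (f := (fderiv ℝ (fun w => e' (e.symm w)) z : (Fin n → ℂ) →ₗ[ℝ] (Fin n → ℂ)))
    (det_fderiv_chartChange_ne_zero he he' hz hz')
    (fun u => quad_leviMatrix_chartChange hW hdiag hE he he' hs hs' hz hz' u)
  rw [liouvilleDensity, liouvilleDensity, h, Complex.re_ofReal_mul]

end ChartChange

/-! ### The Liouville measure in charts -/

section Liouville

variable {n : ℕ} {M : Type*} [TopologicalSpace M] [MeasurableSpace M]
  {L : M → Type*} [∀ x, NormedAddCommGroup (L x)]

variable (L) in
/-- The expression in the chart `e`, with the frame `s`, of the Liouville measure, seen as a measure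
of `M` which is zero outside the domain of the chart. -/
noncomputable def chartLiouville (e : OpenPartialHomeomorph M (Fin n → ℂ)) (s : ∀ x, L x) :
    Measure M :=
  ((((2 : ENNReal) ^ n • volume).restrict e.target).withDensity
      (fun z => ENNReal.ofReal (liouvilleDensity (weightIn n L e s) z).re)).map e.symm

variable [BorelSpace M] {e e' : OpenPartialHomeomorph M (Fin n → ℂ)} {s s' : ∀ x, L x}

theorem aemeasurable_symm (g : (Fin n → ℂ) → ENNReal) :
    AEMeasurable e.symm ((((2 : ENNReal) ^ n • volume).restrict e.target).withDensity g) :=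
  (e.continuousOn_symm.aemeasurable e.open_target.measurableSet).mono_ac
    (withDensity_absolutelyContinuous _ _)

theorem chartLiouville_apply {A : Set M} (hA : MeasurableSet A) :
    chartLiouville L e s A = (2 : ENNReal) ^ n * ∫⁻ z in e.target ∩ e.symm ⁻¹' A,
      ENNReal.ofReal (liouvilleDensity (weightIn n L e s) z).re := by
  rw [chartLiouville, Measure.map_apply_of_aemeasurable (aemeasurable_symm _) hA,
    withDensity_apply', Measure.restrict_restrict' e.open_target.measurableSet,
    Measure.restrict_smul, lintegral_smul_measure, inter_comm, smul_eq_mul]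

theorem measurableSet_target_inter_preimage {A : Set M} (hA : MeasurableSet A) :
    MeasurableSet (e.target ∩ e.symm ⁻¹' A) := by
  have h := (continuousOn_iff_continuous_domRestrict.1 e.continuousOn_symm).measurable hA
  have := (MeasurableEmbedding.subtype_coe e.open_target.measurableSet).measurableSet_image.2 h
  convert this using 1
  ext z
  simp [and_comm]

theorem chartLiouville_inter_source {A : Set M} (hA : MeasurableSet A) :
    chartLiouville L e s (A ∩ e.source) = chartLiouville L e s A := by
  rw [chartLiouville_apply hA, chartLiouville_apply (hA.inter e.open_source.measurableSet)]
  congr 3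
  ext z
  simp only [mem_inter_iff, mem_preimage]
  exact ⟨fun h => ⟨h.1, h.2.1⟩, fun h => ⟨h.1, h.2, e.map_target h.1⟩⟩

variable [ChartedSpace (Fin n → ℂ) M] [∀ x, InnerProductSpace ℂ (L x)]
  [TopologicalSpace (Bundle.TotalSpace ℂ L)] [FiberBundle ℂ L] [VectorBundle ℂ ℂ L]
  [IsManifold 𝓘(ℂ, Fin n → ℂ) ω M] {W : Set (M × M)} {E : Kernel L}

/-- The local expressions of the Liouville measure agree where both are defined. -/
theorem chartLiouville_eq (hL : IsPositive n L)
    (hW : IsOpen W) (hdiag : ∀ x, (x, x) ∈ W) (hE : IsCanonicalExtension n L W E)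
    (he : e ∈ IsManifold.maximalAtlas 𝓘(ℂ, Fin n → ℂ) ω M)
    (he' : e' ∈ IsManifold.maximalAtlas 𝓘(ℂ, Fin n → ℂ) ω M)
    (hs : IsHolFrameOn n L e.source s) (hs' : IsHolFrameOn n L e'.source s') {A : Set M}
    (hA : MeasurableSet A) (hAe : A ⊆ e.source) (hAe' : A ⊆ e'.source) :
    chartLiouville L e s A = chartLiouville L e' s' A := by
  rw [chartLiouville_apply hA, chartLiouville_apply hA]
  congr 1
  set B := e.target ∩ e.symm ⁻¹' A with hB
  have himg : e'.target ∩ e'.symm ⁻¹' A = (fun w => e' (e.symm w)) '' B := by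
    ext w
    constructor
    · rintro ⟨hw, hwA⟩
      have hwA' : e'.symm w ∈ A := hwA
      refine ⟨e (e'.symm w), ⟨e.map_source (hAe hwA), ?_⟩, ?_⟩
      · rw [mem_preimage, e.left_inv (hAe hwA)]; exact hwA
      · simp only [e.left_inv (hAe hwA'), e'.right_inv hw]
    · rintro ⟨z, ⟨hz, hzA⟩, rfl⟩
      have hzA' : e.symm z ∈ A := hzA
      refine ⟨e'.map_source (hAe' hzA'), ?_⟩
      rw [mem_preimage, e'.left_inv (hAe' hzA')]; exact hzA
  have hBm : MeasurableSet B := measurableSet_target_inter_preimage hA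
  have hinj : InjOn (fun w => e' (e.symm w)) B := by
    intro z hz w hw h
    exact e.symm.injOn hz.1 hw.1 (e'.injOn (hAe' hz.2) (hAe' hw.2) h)
  rw [himg, lintegral_image_eq_lintegral_abs_det_fderiv_mul volume hBm
    (fun z hz => (hasFDerivAt_chartChange he he' hz.1 (hAe' hz.2)).hasFDerivWithinAt) hinj]
  refine setLIntegral_congr_fun hBm fun z hz => ?_
  rw [det_leviMatrix_chartChange hL hW hdiag hE he he' hs hs' hz.1 (hAe' hz.2),
    ENNReal.ofReal_mul (abs_nonneg _)]

/-- The supremum which defines the Liouville measure does not add anything to the local expression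
of the measure over the domain of the chart. -/
theorem liouvilleMeasure_restrict_source (hL : IsPositive n L)
    (hW : IsOpen W) (hdiag : ∀ x, (x, x) ∈ W) (hE : IsCanonicalExtension n L W E)
    (he : e ∈ IsManifold.maximalAtlas 𝓘(ℂ, Fin n → ℂ) ω M)
    (hs : IsHolFrameOn n L e.source s) :
    (liouvilleMeasure n L).restrict e.source = chartLiouville L e s := by
  have hle : ∀ e₁ ∈ IsManifold.maximalAtlas 𝓘(ℂ, Fin n → ℂ) ω M, ∀ s₁ : ∀ x, L x,
      IsHolFrameOn n L e₁.source s₁ → chartLiouville L e₁ s₁ ≤ liouvilleMeasure n L :=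
    fun e₁ he₁ s₁ hs₁ => le_iSup₂_of_le e₁ he₁ (le_iSup₂_of_le s₁ hs₁ le_rfl)
  have hsm := e.open_source.measurableSet
  -- a measure which dominates all the local ones
  have hν : liouvilleMeasure n L
      ≤ chartLiouville L e s + (liouvilleMeasure n L).restrict e.sourceᶜ := by
    refine iSup₂_le fun e₁ he₁ => iSup₂_le fun s₁ hs₁ => ?_
    change chartLiouville L e₁ s₁ ≤ _
    refine Measure.le_iff.2 fun A hA => ?_
    rw [← measure_inter_add_sdiff A hsm, Measure.add_apply, Measure.restrict_apply hA]
    refine add_le_add ?_ ?_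
    · rw [← chartLiouville_inter_source (hA.inter hsm),
        chartLiouville_eq hL hW hdiag hE he₁ he hs₁ hs
          ((hA.inter hsm).inter e₁.open_source.measurableSet) inter_subset_right
          fun x hx => hx.1.2]
      exact measure_mono fun x hx => hx.1.1
    · exact hle e₁ he₁ s₁ hs₁ _
  refine le_antisymm (Measure.le_iff.2 fun A hA => ?_) (Measure.le_iff.2 fun A hA => ?_)
  · rw [Measure.restrict_apply hA]
    refine (hν _).trans ?_
    rw [Measure.add_apply, Measure.restrict_apply (hA.inter hsm), inter_assoc,
      inter_compl_self, inter_empty, measure_empty, add_zero]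
    exact measure_mono inter_subset_left
  · rw [Measure.restrict_apply hA, ← chartLiouville_inter_source hA]
    exact hle e he s hs _

omit [MeasurableSpace M] [BorelSpace M] [VectorBundle ℂ ℂ L] in
theorem continuousOn_liouvilleDensity (hdiag : ∀ x, (x, x) ∈ W)
    (hE : IsCanonicalExtension n L W E)
    (he : e ∈ IsManifold.maximalAtlas 𝓘(ℂ, Fin n → ℂ) ω M)
    (hs : IsHolFrameOn n L e.source s) :
    ContinuousOn (liouvilleDensity (weightIn n L e s)) e.target := by
  intro z hz
  obtain ⟨Ω, hΩ, hzΩ, hΩe, φt, hφt, hφ⟩ := exists_potential hdiag hE he hs hz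
  exact (contDiffAt_det fun i j => contDiffAt_leviMatrix
    (contDiffAt_of_diag hΩ hφt hφ hzΩ) i j).continuousAt.continuousWithinAt

theorem isFiniteMeasure_liouvilleMeasure [CompactSpace M]
    [ContMDiffVectorBundle ω ℂ L 𝓘(ℂ, Fin n → ℂ)] (hL : IsPositive n L)
    (hW : IsOpen W) (hdiag : ∀ x, (x, x) ∈ W) (hE : IsCanonicalExtension n L W E) :
    IsFiniteMeasure (liouvilleMeasure n L) := by
  have : IsLocallyFiniteMeasure (liouvilleMeasure n L) := by
    refine ⟨fun x => ?_⟩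
    obtain ⟨e, he, hxe, -, s, hs⟩ := exists_chart_isHolFrameOn (n := n) (L := L) isOpen_univ
      (mem_univ x)
    obtain ⟨r, hr, hball⟩ := Metric.nhds_basis_closedBall.mem_iff.1
      (e.open_target.mem_nhds (e.map_source hxe))
    obtain ⟨C, hC⟩ := (isCompact_closedBall (e x) r).exists_bound_of_continuousOn
      ((continuousOn_liouvilleDensity hdiag hE he hs).mono hball)
    have hO : IsOpen (e.source ∩ e ⁻¹' Metric.ball (e x) r) :=
      e.continuousOn.isOpen_inter_preimage e.open_source Metric.isOpen_ball
    refine ⟨_, hO.mem_nhds ⟨hxe, Metric.mem_ball_self hr⟩, ?_⟩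
    rw [← inter_eq_self_of_subset_left (inter_subset_left :
      e.source ∩ e ⁻¹' Metric.ball (e x) r ⊆ e.source),
      ← Measure.restrict_apply hO.measurableSet,
      liouvilleMeasure_restrict_source hL hW hdiag hE he hs,
      chartLiouville_apply hO.measurableSet]
    refine ENNReal.mul_lt_top (by simp) ?_
    have hsub : e.target ∩ e.symm ⁻¹' (e.source ∩ e ⁻¹' Metric.ball (e x) r)
        ⊆ Metric.closedBall (e x) r := by
      rintro z ⟨hz, -, hzb⟩
      rw [mem_preimage, e.right_inv hz] at hzb
      exact Metric.ball_subset_closedBall hzb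
    refine (lintegral_mono_set hsub).trans_lt ?_
    refine (setLIntegral_mono' (g := fun _ => ENNReal.ofReal C) measurableSet_closedBall
      fun z hz => ENNReal.ofReal_le_ofReal
        ((Complex.re_le_norm _).trans (hC z hz))).trans_lt ?_
    rw [setLIntegral_const]
    exact ENNReal.mul_lt_top ENNReal.ofReal_lt_top measure_closedBall_lt_top
  infer_instance

/-- Integration over a coordinate ball, in coordinates centred at its centre. -/
theorem setIntegral_liouvilleMeasure (hL : IsPositive n L)
    (hW : IsOpen W) (hdiag : ∀ x, (x, x) ∈ W) (hE : IsCanonicalExtension n L W E)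
    (he : e ∈ IsManifold.maximalAtlas 𝓘(ℂ, Fin n → ℂ) ω M)
    (hs : IsHolFrameOn n L e.source s) {z : Fin n → ℂ} {ε : ℝ} (hball : Metric.ball z ε ⊆ e.target)
    {F : M → ℂ} (hF : Continuous F) :
    ∫ y in e.source ∩ e ⁻¹' Metric.ball z ε, F y ∂(liouvilleMeasure n L)
      = 2 ^ n * ∫ u in Metric.ball 0 ε,
          F (e.symm (z + u)) * liouvilleDensity (weightIn n L e s) (z + u) := by
  have hO : IsOpen (e.source ∩ e ⁻¹' Metric.ball z ε) :=
    e.continuousOn.isOpen_inter_preimage e.open_source Metric.isOpen_ball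
  have hpre : e.symm ⁻¹' (e.source ∩ e ⁻¹' Metric.ball z ε) ∩ e.target = Metric.ball z ε := by
    ext w
    constructor
    · rintro ⟨⟨-, hw⟩, hwt⟩
      rwa [mem_preimage, e.right_inv hwt] at hw
    · intro hw
      refine ⟨⟨e.map_target (hball hw), ?_⟩, hball hw⟩
      rwa [mem_preimage, e.right_inv (hball hw)]
  have h1 : (liouvilleMeasure n L).restrict (e.source ∩ e ⁻¹' Metric.ball z ε)
      = (chartLiouville L e s).restrict (e.source ∩ e ⁻¹' Metric.ball z ε) := by
    rw [← liouvilleMeasure_restrict_source hL hW hdiag hE he hs,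
      Measure.restrict_restrict hO.measurableSet,
      inter_eq_self_of_subset_left inter_subset_left]
  have hδ := (continuousOn_liouvilleDensity hdiag hE he hs).mono hball
  rw [h1, chartLiouville, setIntegral_map hO.measurableSet hF.aestronglyMeasurable
    (aemeasurable_symm _), restrict_withDensity',
    Measure.restrict_restrict' e.open_target.measurableSet, hpre,
    integral_withDensity_eq_integral_toReal_smul₀ ?_ (ae_of_all _ fun _ => ENNReal.ofReal_lt_top),
    Measure.restrict_smul, integral_smul_measure]
  · have h2 : Metric.ball (0 : Fin n → ℂ) ε = (fun u => z + u) ⁻¹' Metric.ball z ε := by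
      ext u; simp
    rw [h2, (measurePreserving_add_left volume z).setIntegral_preimage_emb
      (measurableEmbedding_addLeft z)
      (fun w => F (e.symm w) * liouvilleDensity (weightIn n L e s) w)]
    rw [show ((2 : ENNReal) ^ n).toReal = 2 ^ n by simp, Complex.real_smul]
    push_cast
    congr 1
    refine setIntegral_congr_fun measurableSet_ball fun w hw => ?_
    have hdet := (hL e he s hs w (hball hw)).det_pos
    obtain ⟨hre, him⟩ := Complex.pos_iff.1 hdet
    have h3 : (((liouvilleDensity (weightIn n L e s) w).re : ℝ) : ℂ)
        = liouvilleDensity (weightIn n L e s) w :=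
      Complex.ext (by simp) (by simpa [liouvilleDensity] using him)
    rw [ENNReal.toReal_ofReal
      (show 0 ≤ (liouvilleDensity (weightIn n L e s) w).re from hre.le), Complex.real_smul, h3, mul_comm]
  · rw [Measure.restrict_smul]
    exact (AEMeasurable.ennreal_ofReal (Complex.measurable_re.comp_aemeasurable
      (hδ.aemeasurable measurableSet_ball))).smul_measure _

end Liouville

/-! ### The expansion near a point -/

section Decay

theorem exists_pow_mul_pow_le {q : ℝ} (hq0 : 0 ≤ q) (hq1 : q < 1) (n N : ℕ) :
    ∃ C : ℝ, 0 ≤ C ∧ ∀ k : ℕ, 1 ≤ k → (k : ℝ) ^ n * q ^ k ≤ C * (k : ℝ) ^ (-(N : ℤ) - 1) := by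
  have h := tendsto_pow_const_mul_const_pow_of_abs_lt_one (n + (N + 1))
    (by rwa [abs_of_nonneg hq0] : |q| < 1)
  obtain ⟨C, hC⟩ := h.bddAbove_range
  have hC' : ∀ k : ℕ, (k : ℝ) ^ (n + (N + 1)) * q ^ k ≤ C := fun k => hC ⟨k, rfl⟩
  refine ⟨C, le_trans (by positivity) (hC' 0), fun k hk => ?_⟩
  have hk' : (0 : ℝ) < k := by exact_mod_cast hk
  have h1 : (k : ℝ) ^ (-(N : ℤ) - 1) = ((k : ℝ) ^ (N + 1))⁻¹ := by
    rw [← zpow_natCast, ← zpow_neg]; congr 1; push_cast; ring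
  rw [h1, ← div_eq_mul_inv, le_div_iff₀ (by positivity)]
  refine le_trans (le_of_eq ?_) (hC' k)
  rw [pow_add]; ring

/-- The coefficients of an expansion in powers of `k⁻¹` are determined by the expanded sequence. -/
theorem expansion_coeff_unique {n : ℕ} {r a b : ℕ → ℂ}
    (ha : ∀ N : ℕ, ∃ C : ℝ, ∀ k : ℕ, 1 ≤ k →
      ‖r k - ((k : ℂ) / (2 * (Real.pi : ℂ))) ^ n *
        ∑ l ∈ Finset.range (N + 1), (k : ℂ) ^ (-(l : ℤ)) * a l‖ ≤ C * (k : ℝ) ^ ((n : ℤ) - N - 1))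
    (hb : ∀ N : ℕ, ∃ C : ℝ, ∀ k : ℕ, 1 ≤ k →
      ‖r k - ((k : ℂ) / (2 * (Real.pi : ℂ))) ^ n *
        ∑ l ∈ Finset.range (N + 1), (k : ℂ) ^ (-(l : ℤ)) * b l‖ ≤ C * (k : ℝ) ^ ((n : ℤ) - N - 1))
    (N : ℕ) : a N = b N := by
  obtain ⟨C, hC⟩ := ha N
  obtain ⟨C', hC'⟩ := hb N
  -- expansions in powers of `k⁻¹ = h²`, with `k = i + 1`
  set h : ℕ → ℝ := fun i => (√((i : ℝ) + 1))⁻¹ with hh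
  have hpos : ∀ i, 0 < h i := fun i => by positivity
  have hsq : ∀ i, h i ^ 2 = ((i + 1 : ℕ) : ℝ)⁻¹ := fun i => by
    simp only [hh, inv_pow]
    rw [Real.sq_sqrt (by positivity)]
    push_cast; rfl
  have hlim : Tendsto h atTop (𝓝 0) := by
    refine tendsto_inv_atTop_zero.comp (Real.tendsto_sqrt_atTop.comp ?_)
    exact tendsto_atTop_add_const_right _ _ tendsto_natCast_atTop_atTop
  refine sub_eq_zero.1 (coeff_eq_zero_of_isBigO (a := fun l => a l - b l) (P := N + 1)
    (r := 2 * (N + 1)) (C := (2 * Real.pi) ^ n * (C + C')) hpos hlim (fun i => ?_)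
    (Nat.lt_succ_self N) (by omega))
  set k := i + 1 with hk
  have hk1 : 1 ≤ k := by omega
  have hk' : (0 : ℝ) < k := by exact_mod_cast hk1
  have hpow : ∀ l : ℕ, (h i : ℂ) ^ (2 * l) = (k : ℂ) ^ (-(l : ℤ)) := fun l => by
    rw [pow_mul, ← Complex.ofReal_pow, hsq, zpow_neg, zpow_natCast, ← inv_pow,
      Complex.ofReal_inv, Complex.ofReal_natCast]
  have hpow' : h i ^ (2 * (N + 1)) = (k : ℝ) ^ (-(N : ℤ) - 1) := by
    rw [pow_mul, hsq, inv_pow, ← zpow_natCast, ← zpow_neg]; congr 1; push_cast; ring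
  simp only [hpow, hpow']
  have h1 := norm_sub_le_of_le (hC' k hk1) (hC k hk1)
  have h2 : ((k : ℂ) / (2 * (Real.pi : ℂ))) ^ n *
        ∑ l ∈ Finset.range (N + 1), (k : ℂ) ^ (-(l : ℤ)) * (a l - b l)
      = (r k - ((k : ℂ) / (2 * (Real.pi : ℂ))) ^ n *
        ∑ l ∈ Finset.range (N + 1), (k : ℂ) ^ (-(l : ℤ)) * b l)
        - (r k - ((k : ℂ) / (2 * (Real.pi : ℂ))) ^ n *
        ∑ l ∈ Finset.range (N + 1), (k : ℂ) ^ (-(l : ℤ)) * a l) := by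
    simp only [mul_sub, Finset.sum_sub_distrib]
    ring
  rw [← h2, norm_mul] at h1
  have h3 : ‖((k : ℂ) / (2 * (Real.pi : ℂ))) ^ n‖ = (k : ℝ) ^ n / (2 * Real.pi) ^ n := by
    rw [norm_pow, norm_div, norm_mul, Complex.norm_natCast, Complex.norm_real,
      Real.norm_of_nonneg Real.pi_pos.le, div_pow]
    simp
  have h4 : (k : ℝ) ^ ((n : ℤ) - N - 1) = (k : ℝ) ^ n * (k : ℝ) ^ (-(N : ℤ) - 1) := by
    rw [← zpow_natCast (k : ℝ) n, ← zpow_add₀ hk'.ne']; congr 1; ring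
  rw [h3, h4] at h1
  have hkn : (0 : ℝ) < (k : ℝ) ^ n / (2 * Real.pi) ^ n := by positivity
  refine le_of_mul_le_mul_left (h1.trans (le_of_eq ?_)) hkn
  have : (2 * Real.pi) ^ n ≠ 0 := by positivity
  field_simp
  ring

end Decay

section Cutoff

variable {M : Type*} [TopologicalSpace M] {ρ : M × M → ℝ} {W : Set (M × M)}

/-- The product of a function defined near the diagonal with the two cutoff factors `ρ(x, y)` and
`ρ(y, x)` of the kernels is continuous everywhere. -/
theorem continuous_cutoff_mul (hW : IsOpen W) (hρ : Continuous ρ) (hρW : tsupport ρ ⊆ W)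
    {h : M × M → ℂ} (hh : ContinuousOn h (W ∩ Prod.swap ⁻¹' W)) :
    Continuous fun p : M × M => (ρ p : ℂ) * (ρ p.swap : ℂ) * h p := by
  refine continuous_of_tsupport fun p hp => ?_
  have h1 : tsupport (fun p : M × M => (ρ p : ℂ) * (ρ p.swap : ℂ) * h p)
      ⊆ tsupport ρ ∩ Prod.swap ⁻¹' tsupport ρ := by
    refine closure_minimal (fun q hq => ?_)
      ((isClosed_tsupport ρ).inter ((isClosed_tsupport ρ).preimage continuous_swap))
    simp only [Function.mem_support, ne_eq, mul_eq_zero, not_or, Complex.ofReal_eq_zero] at hq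
    exact ⟨subset_tsupport ρ hq.1.1, subset_tsupport ρ hq.1.2⟩
  have hp' : p ∈ W ∩ Prod.swap ⁻¹' W := ⟨hρW (h1 hp).1, hρW (h1 hp).2⟩
  have h2 := hh.continuousAt ((hW.inter (hW.preimage continuous_swap)).mem_nhds hp')
  exact ((Complex.continuous_ofReal.comp hρ).continuousAt.mul
    (Complex.continuous_ofReal.comp (hρ.comp continuous_swap)).continuousAt).mul h2

/-- By compactness of the support of `ρ`, a bound `|τ| < 1` becomes a bound `|τ| ≤ q < 1` where `ρ`
does not vanish. -/
theorem exists_norm_le_of_lt_one [CompactSpace M] (hρW : tsupport ρ ⊆ W) {τ : M × M → ℂ}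
    (hτ : ContinuousOn τ (W ∩ Prod.swap ⁻¹' W)) {K : Set (M × M)} (hK : IsClosed K)
    (hlt : ∀ p ∈ K ∩ (W ∩ Prod.swap ⁻¹' W), ‖τ p‖ < 1) :
    ∃ q : ℝ, 0 ≤ q ∧ q < 1 ∧ ∀ p ∈ K, ρ p ≠ 0 → ρ p.swap ≠ 0 → ‖τ p‖ ≤ q := by
  set S := K ∩ (tsupport ρ ∩ Prod.swap ⁻¹' tsupport ρ) with hS
  have hSc : IsCompact S := (hK.inter ((isClosed_tsupport ρ).inter
    ((isClosed_tsupport ρ).preimage continuous_swap))).isCompact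
  have hSW : S ⊆ K ∩ (W ∩ Prod.swap ⁻¹' W) := fun p hp => ⟨hp.1, hρW hp.2.1, hρW hp.2.2⟩
  have hmem : ∀ p ∈ K, ρ p ≠ 0 → ρ p.swap ≠ 0 → p ∈ S := fun p hp h1 h2 =>
    ⟨hp, subset_tsupport ρ h1, subset_tsupport ρ h2⟩
  rcases S.eq_empty_or_nonempty with h0 | h0
  · refine ⟨0, le_rfl, one_pos, fun p hp h1 h2 => ?_⟩
    have := hmem p hp h1 h2
    rw [h0] at this
    exact this.elim
  · obtain ⟨p₀, hp₀, hmax⟩ := hSc.exists_isMaxOn h0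
      (hτ.norm.mono fun p hp => (hSW hp).2)
    exact ⟨‖τ p₀‖, norm_nonneg _, hlt p₀ (hSW hp₀), fun p hp h1 h2 => hmax (hmem p hp h1 h2)⟩

end Cutoff

section Local

variable {n : ℕ} {M : Type*} [TopologicalSpace M] [T2Space M] [CompactSpace M]
  [ChartedSpace (Fin n → ℂ) M] [IsManifold 𝓘(ℂ, Fin n → ℂ) ω M]
  [MeasurableSpace M] [BorelSpace M]
  {L : M → Type*} [∀ x, NormedAddCommGroup (L x)] [∀ x, InnerProductSpace ℂ (L x)]
  [TopologicalSpace (Bundle.TotalSpace ℂ L)] [FiberBundle ℂ L] [VectorBundle ℂ ℂ L]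
  [ContMDiffVectorBundle ω ℂ L 𝓘(ℂ, Fin n → ℂ)]
  {L' : M → Type*} [∀ x, NormedAddCommGroup (L' x)] [∀ x, InnerProductSpace ℂ (L' x)]
  [TopologicalSpace (Bundle.TotalSpace ℂ L')] [FiberBundle ℂ L'] [VectorBundle ℂ ℂ L']
  [ContMDiffVectorBundle ω ℂ L' 𝓘(ℂ, Fin n → ℂ)]
  {W : Set (M × M)} {E : Kernel L} {E' : Kernel L'} {ft gt : M × M → ℂ} {ρ : M × M → ℝ}

/-- The expansion near a point, with the coefficients computed in any chart, with any frames and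
any extensions of the weights. The integral over a coordinate ball centred at `x` has the expansion
of `local_expansion`; on the rest of `M` the factor `(E(x, ȳ) · E(y, x̄))ᵏ` is exponentially
small. -/
theorem exists_nhds_compDiag_expansion (hL : IsPositive n L) (hW : IsOpen W)
    (hdiag : ∀ x, (x, x) ∈ W) (hE : IsCanonicalExtension n L W E)
    (hElt : ∀ x y, (x, y) ∈ W → x ≠ y → ‖E x y‖ < 1) (hE' : IsCanonicalExtension n L' W E')
    (hft : SesquiHolOn n W ft) (hgt : SesquiHolOn n W gt) (hρ : Continuous ρ)
    (hρW : tsupport ρ ⊆ W) (hρ1 : ∀ x, ∀ᶠ p in 𝓝 (x, x), ρ p = 1)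
    {e : OpenPartialHomeomorph M (Fin n → ℂ)}
    (he : e ∈ IsManifold.maximalAtlas 𝓘(ℂ, Fin n → ℂ) ω M) {s : ∀ x, L x} {s' : ∀ x, L' x}
    (hs : IsHolFrameOn n L e.source s) (hs' : IsHolFrameOn n L' e.source s')
    {Ω : Set (Fin n → ℂ)} (hΩ : IsOpen Ω) (hΩe : Ω ⊆ e.target)
    (hΩW : ∀ z ∈ Ω, ∀ w ∈ Ω, (e.symm z, e.symm w) ∈ W)
    {φt φt' : (Fin n → ℂ) → (Fin n → ℂ) → ℂ}
    (hφt : SesquiAnalyticOn Ω φt) (hφ : ∀ z ∈ Ω, φt z z = weightIn n L e s z)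
    (hφt' : SesquiAnalyticOn Ω φt') (hφ' : ∀ z ∈ Ω, φt' z z = weightIn n L' e s' z)
    {z₀ : Fin n → ℂ} (hz₀ : z₀ ∈ Ω) :
    ∃ V ∈ 𝓝 (e.symm z₀), ∀ N : ℕ, ∃ C : ℝ, ∀ k : ℕ, 1 ≤ k → ∀ x ∈ V,
      ‖compDiag (liouvilleMeasure n L) k (toeplitzKernel n ρ E E' ft k)
          (toeplitzKernel n ρ E E' gt k) x
        - ((k : ℂ) / (2 * (Real.pi : ℂ))) ^ n *
          ∑ l ∈ Finset.range (N + 1), (k : ℂ) ^ (-(l : ℤ)) *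
            localCoeff (weightIn n L e s) φt φt' (inChart n e ft) (inChart n e gt) l (e x)‖
        ≤ C * (k : ℝ) ^ ((n : ℤ) - N - 1) := by
  have hrk : ∀ x : M, Module.finrank ℂ (L x) = 1 := fun x => finrank_fiber x
  have hrk' : ∀ x : M, Module.finrank ℂ (L' x) = 1 := fun x => finrank_fiber x
  have := isFiniteMeasure_liouvilleMeasure hL hW hdiag hE
  set μ := liouvilleMeasure n L with hμ
  set τ := kernelTrace E with hτdef
  set τ' := kernelTrace E' with hτ'def
  have hτc : ContinuousOn τ (W ∩ Prod.swap ⁻¹' W) := continuousOn_kernelTrace hW hdiag hE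
  have hτ'c : ContinuousOn τ' (W ∩ Prod.swap ⁻¹' W) := continuousOn_kernelTrace hW hdiag hE'
  have hfg : ContinuousOn (fun p : M × M => ft p * gt p.swap) (W ∩ Prod.swap ⁻¹' W) :=
    (hft.continuousOn.mono inter_subset_left).mul
      (hgt.continuousOn.comp continuous_swap.continuousOn inter_subset_right)
  -- the integrand, and its factor which does not depend on `k`
  set χ : M × M → ℂ := fun p => (ρ p : ℂ) * (ρ p.swap : ℂ) * (ft p * gt p.swap * τ' p) with hχ
  set I : ℕ → M × M → ℂ := fun k p =>
    (ρ p : ℂ) * (ρ p.swap : ℂ) * (ft p * gt p.swap * (τ p ^ k * τ' p)) with hI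
  have hχc : Continuous χ := continuous_cutoff_mul hW hρ hρW (hfg.mul hτ'c)
  have hIc : ∀ k, Continuous (I k) := fun k =>
    continuous_cutoff_mul hW hρ hρW (hfg.mul ((hτc.pow k).mul hτ'c))
  obtain ⟨B, hB⟩ := isCompact_univ.exists_bound_of_continuousOn hχc.continuousOn
  have hcomp : ∀ k x, compDiag μ k (toeplitzKernel n ρ E E' ft k) (toeplitzKernel n ρ E E' gt k) x
      = ((k : ℂ) / (2 * (Real.pi : ℂ))) ^ (2 * n) * ∫ y, I k (x, y) ∂μ := fun k x => by
    simp only [compDiag, trace_toeplitzKernel_comp hrk hrk', hI, Prod.swap_prod_mk]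
    rw [integral_const_mul]
  -- the size of the coordinate balls
  obtain ⟨r₀, hr₀, hexp⟩ := local_expansion hΩ hφt hφ hφt'
    (hft.sesquiAnalyticOn he hΩe hΩW) (hgt.sesquiAnalyticOn he hΩe hΩW)
    (fun z hz => hL e he s hs z (hΩe hz)) hz₀
  have hsymm : ContinuousAt (fun p : (Fin n → ℂ) × (Fin n → ℂ) => (e.symm p.1, e.symm p.2))
      (z₀, z₀) :=
    (ContinuousAt.comp (f := Prod.fst) (x := (z₀, z₀)) (e.continuousAt_symm (hΩe hz₀))
      continuousAt_fst).prodMk (ContinuousAt.comp (f := Prod.snd) (x := (z₀, z₀))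
      (e.continuousAt_symm (hΩe hz₀)) continuousAt_snd)
  have hnear := (((eventually_kernelTrace_eq hW hdiag hE he hs hΩ hΩe hφt hφ hz₀).and
    (eventually_kernelTrace_eq hW hdiag hE' he hs' hΩ hΩe hφt' hφ' hz₀)).and
    ((hsymm.eventually (hρ1 (e.symm z₀))).and
    ((continuous_swap.continuousAt.comp hsymm).eventually (hρ1 (e.symm z₀))))).and
    ((hΩ.prod hΩ).mem_nhds ⟨hz₀, hz₀⟩)
  obtain ⟨r₁, hr₁, hr₁near⟩ := Metric.eventually_nhds_iff.1 hnear
  set ε := min r₀ (r₁ / 3) with hε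
  have hεpos : 0 < ε := by positivity
  have hεr₁ : 3 * ε ≤ r₁ := by
    have := min_le_right r₀ (r₁ / 3)
    rw [← hε] at this; linarith
  have hpair : ∀ z ∈ Metric.closedBall z₀ ε, ∀ u ∈ Metric.ball (0 : Fin n → ℂ) ε,
      dist (z, z + u) (z₀, z₀) < r₁ := by
    intro z hz u hu
    have hz' := mem_closedBall_iff_norm.1 hz
    have hu' := mem_ball_zero_iff.1 hu
    rw [Prod.dist_eq, max_lt_iff, dist_eq_norm, dist_eq_norm, add_sub_right_comm]
    exact ⟨by linarith, (norm_add_le _ _).trans_lt (by linarith)⟩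
  have hballt : ∀ z ∈ Metric.closedBall z₀ ε, Metric.ball z ε ⊆ e.target := by
    intro z hz w hw
    have h1 := (hr₁near (hpair z hz (w - z) (by
      rw [mem_ball_zero_iff]; exact mem_ball_iff_norm.1 hw))).2
    rw [add_sub_cancel] at h1
    exact hΩe h1.2
  have hcball : Metric.closedBall z₀ ε ⊆ e.target := fun z hz =>
    hballt z hz (Metric.mem_ball_self hεpos)
  -- decay away from the diagonal
  set K : Set (M × M) := {p | p.1 ∈ e.symm '' Metric.closedBall z₀ ε} \
    {p | p ∈ e.source ×ˢ e.source ∧ e p.2 - e p.1 ∈ Metric.ball 0 ε} with hK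
  have hKc : IsClosed K := by
    have h1 : IsClosed (e.symm '' Metric.closedBall z₀ ε) :=
      ((isCompact_closedBall z₀ ε).image_of_continuousOn
        (e.continuousOn_symm.mono hcball)).isClosed
    have h2 : ContinuousOn (fun p : M × M => e p.2 - e p.1) (e.source ×ˢ e.source) :=
      (e.continuousOn.comp continuous_snd.continuousOn fun p hp => hp.2).sub
        (e.continuousOn.comp continuous_fst.continuousOn fun p hp => hp.1)
    exact (h1.preimage continuous_fst).sdiff
      (h2.isOpen_inter_preimage (e.open_source.prod e.open_source) Metric.isOpen_ball)
  obtain ⟨q, hq0, hq1, hq⟩ := exists_norm_le_of_lt_one hρW hτc hKc (by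
    rintro ⟨x, y⟩ ⟨hxy, hxyW, hyxW⟩
    have hne : x ≠ y := by
      rintro rfl
      obtain ⟨⟨z, hz, rfl⟩, hx2⟩ := hxy
      exact hx2 ⟨⟨e.map_target (hcball hz), e.map_target (hcball hz)⟩, by simpa using hεpos⟩
    have h1 := hElt x y hxyW hne
    have h2 := hElt y x hyxW hne.symm
    exact (norm_kernelTrace_le hrk E (x, y)).trans_lt
      (mul_lt_one_of_nonneg_of_lt_one_left (norm_nonneg _) h1 h2.le))
  have hIK : ∀ k, ∀ p ∈ K, ‖I k p‖ ≤ B * q ^ k := by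
    intro k p hp
    have h1 : I k p = χ p * τ p ^ k := by simp only [hI, hχ]; ring
    have hB0 : ‖χ p‖ ≤ B := hB p (mem_univ _)
    by_cases h2 : ρ p = 0 ∨ ρ p.swap = 0
    · have : I k p = 0 := by rcases h2 with h | h <;> simp [hI, h]
      rw [this, norm_zero]
      exact mul_nonneg ((norm_nonneg _).trans hB0) (pow_nonneg hq0 k)
    · rw [not_or] at h2
      rw [h1, norm_mul, norm_pow]
      exact mul_le_mul hB0 (pow_le_pow_left₀ (norm_nonneg _) (hq p hp h2.1 h2.2) k)
        (by positivity) ((norm_nonneg _).trans hB0)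
  refine ⟨e.source ∩ e ⁻¹' Metric.ball z₀ ε,
    (e.continuousOn.isOpen_inter_preimage e.open_source Metric.isOpen_ball).mem_nhds
      ⟨e.map_target (hΩe hz₀), by
        rw [mem_preimage, e.right_inv (hΩe hz₀)]; exact Metric.mem_ball_self hεpos⟩,
    fun N => ?_⟩
  obtain ⟨C₁, hC₁⟩ := hexp ε hεpos (min_le_left _ _) N
  obtain ⟨C₂, hC₂0, hC₂⟩ := exists_pow_mul_pow_le hq0 hq1 n N
  refine ⟨C₁ + B * μ.real univ * C₂, fun k hk x hx => ?_⟩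
  obtain ⟨hxs, hxb⟩ := hx
  set z := e x with hz
  have hxz : e.symm z = x := e.left_inv hxs
  have hzc : z ∈ Metric.closedBall z₀ ε := Metric.ball_subset_closedBall hxb
  set Nx := e.source ∩ e ⁻¹' Metric.ball z ε with hNx
  have hNo : IsOpen Nx := e.continuousOn.isOpen_inter_preimage e.open_source Metric.isOpen_ball
  have hIx : Continuous fun y => I k (x, y) := (hIc k).comp (Continuous.prodMk_right x)
  have hint : Integrable (fun y => I k (x, y)) μ :=
    hIx.integrable_of_hasCompactSupport (HasCompactSupport.of_compactSpace _)
  -- the contribution of the coordinate ball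
  have hN : ∫ y in Nx, I k (x, y) ∂μ = 2 ^ n * ∫ u in Metric.ball 0 ε,
      Complex.exp (-(k * diastasis φt z (z + u))) *
        (dFun (inChart n e ft) (inChart n e gt) z u * cFun' (weightIn n L e s) φt' z u) := by
    rw [hμ, setIntegral_liouvilleMeasure hL hW hdiag hE he hs (hballt z hzc) hIx]
    congr 1
    refine setIntegral_congr_fun measurableSet_ball fun u hu => ?_
    obtain ⟨⟨⟨h1, h2⟩, h3, h4⟩, -⟩ := hr₁near (hpair z hzc u hu)
    simp only [Function.comp_apply, Prod.swap_prod_mk, hxz] at h1 h2 h3 h4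
    simp only [hI, Prod.swap_prod_mk, h3, h4]
    rw [hτdef, hτ'def, h1, h2, ← Complex.exp_nat_mul]
    simp only [dFun, cFun', inChart, hxz]
    push_cast
    ring_nf
  -- the contribution of the rest
  have hF : ‖∫ y in Nxᶜ, I k (x, y) ∂μ‖ ≤ B * q ^ k * μ.real univ := by
    have hB0 : 0 ≤ B := (norm_nonneg _).trans (hB (x, x) (mem_univ _))
    have hfar : ∀ y ∈ Nxᶜ, ‖I k (x, y)‖ ≤ B * q ^ k := fun y hy =>
      hIK k _ ⟨⟨z, hzc, hxz⟩, fun h => hy ⟨h.1.2, mem_ball_iff_norm.2 (mem_ball_zero_iff.1 h.2)⟩⟩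
    exact (norm_setIntegral_le_of_norm_le_const (measure_lt_top _ _) hfar).trans
      (mul_le_mul_of_nonneg_left (measureReal_mono (subset_univ _)) (by positivity))
  have hk' : (0 : ℝ) < k := by exact_mod_cast hk
  set a : ℂ := ((k : ℂ) / (2 * (Real.pi : ℂ))) ^ n with ha
  have hanorm : ‖a‖ ≤ (k : ℝ) ^ n := by
    rw [ha, norm_pow, norm_div, norm_mul, Complex.norm_natCast, Complex.norm_real,
      Real.norm_of_nonneg Real.pi_pos.le]
    refine pow_le_pow_left₀ (by positivity) (div_le_self hk'.le ?_) n
    have := Real.pi_gt_three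
    simp only [Complex.norm_ofNat]
    linarith
  have hsplit : ∀ S : ℂ, a ^ 2 * ∫ y, I k (x, y) ∂μ = a * S
      + a * ((a * ∫ y in Nx, I k (x, y) ∂μ) - S + a * ∫ y in Nxᶜ, I k (x, y) ∂μ) := fun S => by
    rw [← integral_add_compl hNo.measurableSet hint]
    ring
  rw [hcomp, mul_comm 2 n, pow_mul, ← ha, hsplit, add_sub_cancel_left, norm_mul]
  have h4 : (k : ℝ) ^ ((n : ℤ) - N - 1) = (k : ℝ) ^ n * (k : ℝ) ^ (-(N : ℤ) - 1) := by
    rw [← zpow_natCast (k : ℝ) n, ← zpow_add₀ hk'.ne']; congr 1; ring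
  have h5 := hC₁ k hk z hzc
  rw [mul_comm ((2 : ℂ) ^ n), mul_assoc, ← ha, ← hN] at h5
  have h6 : ‖a * ∫ y in Nxᶜ, I k (x, y) ∂μ‖
      ≤ B * μ.real univ * C₂ * (k : ℝ) ^ (-(N : ℤ) - 1) := by
    have hB0 : 0 ≤ B := (norm_nonneg _).trans (hB (x, x) (mem_univ _))
    rw [norm_mul]
    calc ‖a‖ * ‖∫ y in Nxᶜ, I k (x, y) ∂μ‖
        ≤ (k : ℝ) ^ n * (B * q ^ k * μ.real univ) :=
          mul_le_mul hanorm hF (norm_nonneg _) (by positivity)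
      _ = B * μ.real univ * ((k : ℝ) ^ n * q ^ k) := by ring
      _ ≤ B * μ.real univ * (C₂ * (k : ℝ) ^ (-(N : ℤ) - 1)) :=
          mul_le_mul_of_nonneg_left (hC₂ k hk) (mul_nonneg hB0 measureReal_nonneg)
      _ = _ := by ring
  rw [h4]
  calc _ ≤ (k : ℝ) ^ n * (C₁ * (k : ℝ) ^ (-(N : ℤ) - 1)
        + B * μ.real univ * C₂ * (k : ℝ) ^ (-(N : ℤ) - 1)) :=
        mul_le_mul hanorm ((norm_add_le _ _).trans (add_le_add h5 h6)) (norm_nonneg _)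
          (by positivity)
    _ = _ := by ring

end Local

end BerezinToeplitz

theorem mainTheorem7 {n : ℕ} {M : Type*} [TopologicalSpace M] [T2Space M] [CompactSpace M]
    [ChartedSpace (Fin n → ℂ) M] [IsManifold 𝓘(ℂ, Fin n → ℂ) ω M]
    [MeasurableSpace M] [BorelSpace M]
    -- two Hermitian holomorphic line bundles, the first one positive
    (L : M → Type*) [∀ x, NormedAddCommGroup (L x)] [∀ x, InnerProductSpace ℂ (L x)]
    [TopologicalSpace (Bundle.TotalSpace ℂ L)] [FiberBundle ℂ L] [VectorBundle ℂ ℂ L]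
    [ContMDiffVectorBundle ω ℂ L 𝓘(ℂ, Fin n → ℂ)]
    (L' : M → Type*) [∀ x, NormedAddCommGroup (L' x)] [∀ x, InnerProductSpace ℂ (L' x)]
    [TopologicalSpace (Bundle.TotalSpace ℂ L')] [FiberBundle ℂ L'] [VectorBundle ℂ ℂ L']
    [ContMDiffVectorBundle ω ℂ L' 𝓘(ℂ, Fin n → ℂ)]
    (hL : BerezinToeplitz.IsPositive n L)
    -- a neighbourhood of the diagonal, and holomorphic extensions to it
    (W : Set (M × M)) (hW : IsOpen W) (hdiag : ∀ x : M, (x, x) ∈ W)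
    (E : BerezinToeplitz.Kernel L) (hE : BerezinToeplitz.IsCanonicalExtension n L W E)
    (hElt : ∀ x y : M, (x, y) ∈ W → x ≠ y → ‖E x y‖ < 1)
    (E' : BerezinToeplitz.Kernel L') (hE' : BerezinToeplitz.IsCanonicalExtension n L' W E')
    (f g : M → ℂ) (ft gt : M × M → ℂ)
    (hft : BerezinToeplitz.SesquiHolOn n W ft) (hftf : ∀ x : M, ft (x, x) = f x)
    (hgt : BerezinToeplitz.SesquiHolOn n W gt) (hgtg : ∀ x : M, gt (x, x) = g x)
    -- a smooth cutoff function
    (ρ : M × M → ℝ)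
    (hρ : ContMDiff (𝓘(ℝ, Fin n → ℂ).prod 𝓘(ℝ, Fin n → ℂ)) 𝓘(ℝ, ℝ) ∞ ρ)
    (hρW : HasCompactSupport ρ ∧ tsupport ρ ⊆ W)
    (hρ1 : ∀ x : M, ∀ᶠ p in 𝓝 (x, x), ρ p = 1)
    (r : ℕ → M → ℂ)
    (hr : r = fun k => BerezinToeplitz.compDiag (BerezinToeplitz.liouvilleMeasure n L) k
      (BerezinToeplitz.toeplitzKernel n ρ E E' ft k)
      (BerezinToeplitz.toeplitzKernel n ρ E E' gt k)) :
    (∃ A : ℕ → M → ℂ, BerezinToeplitz.HasDiagExpansion n r A) ∧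
    ∀ A : ℕ → M → ℂ, BerezinToeplitz.HasDiagExpansion n r A →
      -- a chart with connected domain `U`, frames over `U`, and extensions to `U × Ū`
      ∀ e ∈ IsManifold.maximalAtlas 𝓘(ℂ, Fin n → ℂ) ω M,
      IsConnected e.source → e.source ×ˢ e.source ⊆ W →
      ∀ (s : ∀ x, L x) (s' : ∀ x, L' x),
      BerezinToeplitz.IsHolFrameOn n L e.source s →
      BerezinToeplitz.IsHolFrameOn n L' e.source s' →
      ∀ φt φt' : M × M → ℂ,
      BerezinToeplitz.SesquiHolOn n (e.source ×ˢ e.source) φt →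
      (∀ x ∈ e.source, φt (x, x) = BerezinToeplitz.weight L s x) →
      BerezinToeplitz.SesquiHolOn n (e.source ×ˢ e.source) φt' →
      (∀ x ∈ e.source, φt' (x, x) = BerezinToeplitz.weight L' s' x) →
      ∀ (l : ℕ), ∀ x ∈ e.source,
        A l x = BerezinToeplitz.localCoeff (BerezinToeplitz.weightIn n L e s)
          (BerezinToeplitz.inChart n e φt) (BerezinToeplitz.inChart n e φt')
          (BerezinToeplitz.inChart n e ft) (BerezinToeplitz.inChart n e gt) l (e x) := by
  open BerezinToeplitz Filter in
  have hloc : ∀ e ∈ IsManifold.maximalAtlas 𝓘(ℂ, Fin n → ℂ) ω M,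
      ∀ (s : ∀ x, L x) (s' : ∀ x, L' x), IsHolFrameOn n L e.source s →
      IsHolFrameOn n L' e.source s' → ∀ Ω : Set (Fin n → ℂ), IsOpen Ω → Ω ⊆ e.target →
      (∀ z ∈ Ω, ∀ w ∈ Ω, (e.symm z, e.symm w) ∈ W) →
      ∀ φt φt' : (Fin n → ℂ) → (Fin n → ℂ) → ℂ, SesquiAnalyticOn Ω φt →
      (∀ z ∈ Ω, φt z z = weightIn n L e s z) → SesquiAnalyticOn Ω φt' →
      (∀ z ∈ Ω, φt' z z = weightIn n L' e s' z) → ∀ z₀ ∈ Ω,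
      ∃ V ∈ 𝓝 (e.symm z₀), ∀ N : ℕ, ∃ C : ℝ, ∀ k : ℕ, 1 ≤ k → ∀ x ∈ V,
        ‖r k x - ((k : ℂ) / (2 * (Real.pi : ℂ))) ^ n *
          ∑ l ∈ Finset.range (N + 1), (k : ℂ) ^ (-(l : ℤ)) *
            localCoeff (weightIn n L e s) φt φt' (inChart n e ft) (inChart n e gt) l (e x)‖
        ≤ C * (k : ℝ) ^ ((n : ℤ) - N - 1) := by
    subst hr
    exact fun e he s s' hs hs' Ω hΩ hΩe hΩW φt φt' hφt hφ hφt' hφ' z₀ hz₀ =>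
      exists_nhds_compDiag_expansion hL hW hdiag hE hElt hE' hft hgt hρ.continuous hρW.2 hρ1 he
        hs hs' hΩ hΩe hΩW hφt hφ hφt' hφ' hz₀
  constructor
  · -- near each point there is an expansion, and its coefficients do not depend on the choices
    have hpt : ∀ x₀ : M, ∃ (a : ℕ → M → ℂ), ∃ V ∈ 𝓝 x₀, ∀ N : ℕ, ∃ C : ℝ, ∀ k : ℕ, 1 ≤ k →
        ∀ x ∈ V, ‖r k x - ((k : ℂ) / (2 * (Real.pi : ℂ))) ^ n *
          ∑ l ∈ Finset.range (N + 1), (k : ℂ) ^ (-(l : ℤ)) * a l x‖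
        ≤ C * (k : ℝ) ^ ((n : ℤ) - N - 1) := by
      intro x₀
      obtain ⟨U, hU, hxU, s, hs⟩ := BerezinToeplitz.exists_isHolFrameOn (n := n) (L := L) x₀
      obtain ⟨e, he, hxe, heU, s', hs'⟩ :=
        BerezinToeplitz.exists_chart_isHolFrameOn (n := n) (L := L') hU hxU
      have hse := hs.mono heU
      have hz₀ := e.map_source hxe
      obtain ⟨Ω₁, hΩ₁, hz₁, hΩ₁e, φt, hφt, hφ⟩ :=
        BerezinToeplitz.exists_potential hdiag hE he hse hz₀
      obtain ⟨Ω₂, hΩ₂, hz₂, -, φt', hφt', hφ'⟩ :=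
        BerezinToeplitz.exists_potential hdiag hE' he hs' hz₀
      have hx₀ : e.symm (e x₀) = x₀ := e.left_inv hxe
      obtain ⟨O, hOx, hOW⟩ : ∃ O ∈ 𝓝 x₀, O ×ˢ O ⊆ W := by
        have h := hW.mem_nhds (hdiag x₀)
        rw [nhds_prod_eq] at h
        obtain ⟨O, hO, hOW⟩ := Filter.mem_prod_self_iff.1 h
        exact ⟨O, hO, hOW⟩
      have hpre : e.symm ⁻¹' O ∈ 𝓝 (e x₀) :=
        (e.continuousAt_symm hz₀).preimage_mem_nhds (by rwa [hx₀])
      obtain ⟨Ω₃, hΩ₃O, hΩ₃, hz₃⟩ := mem_nhds_iff.1 hpre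
      obtain ⟨V, hV, h⟩ := hloc e he s s' hse hs' (Ω₁ ∩ Ω₂ ∩ Ω₃) ((hΩ₁.inter hΩ₂).inter hΩ₃)
        (fun z hz => hΩ₁e hz.1.1) (fun z hz w hw => hOW ⟨hΩ₃O hz.2, hΩ₃O hw.2⟩) φt φt'
        (hφt.mono fun z hz => hz.1.1) (fun z hz => hφ z hz.1.1)
        (hφt'.mono fun z hz => hz.1.2) (fun z hz => hφ' z hz.1.2) (e x₀) ⟨⟨hz₁, hz₂⟩, hz₃⟩
      exact ⟨_, V, by rwa [hx₀] at hV, h⟩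
    choose a V hV hexp using hpt
    have hagree : ∀ x₀, ∀ x ∈ V x₀, ∀ l, a x₀ l x = a x l x := fun x₀ x hx l =>
      BerezinToeplitz.expansion_coeff_unique (r := fun k => r k x) (a := fun l => a x₀ l x)
        (b := fun l => a x l x)
        (fun N => (hexp x₀ N).imp fun C hC k hk => hC k hk x hx)
        (fun N => (hexp x N).imp fun C hC k hk => hC k hk x (mem_of_mem_nhds (hV x))) l
    refine ⟨fun l x => a x l x, fun N => ?_⟩
    choose C hC using fun x₀ => hexp x₀ N
    obtain ⟨t, ht⟩ := CompactSpace.elim_nhds_subcover V hV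
    refine ⟨∑ y ∈ t, |C y|, fun k hk x => ?_⟩
    obtain ⟨x₀, hx₀t, hx⟩ : ∃ y ∈ t, x ∈ V y := by
      have : x ∈ ⋃ y ∈ t, V y := by rw [ht]; trivial
      simpa using this
    have h1 := hC x₀ k hk x hx
    simp only [hagree x₀ x hx] at h1
    refine h1.trans (mul_le_mul_of_nonneg_right ?_ (by positivity))
    exact (le_abs_self _).trans
      (Finset.single_le_sum (f := fun y => |C y|) (fun y _ => abs_nonneg _) hx₀t)
  · intro A hA e he _ heW s s' hs hs' φt φt' hφt hφ hφt' hφ' l x hx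
    have hee : ∀ z ∈ e.target, ∀ w ∈ e.target,
        (e.symm z, e.symm w) ∈ e.source ×ˢ e.source := fun z hz w hw =>
      ⟨e.map_target hz, e.map_target hw⟩
    obtain ⟨V, hV, h⟩ := hloc e he s s' hs hs' e.target e.open_target subset_rfl
      (fun z hz w hw => heW (hee z hz w hw)) _ _ (hφt.sesquiAnalyticOn he subset_rfl hee)
      (fun z hz => hφ _ (e.map_target hz)) (hφt'.sesquiAnalyticOn he subset_rfl hee)
      (fun z hz => hφ' _ (e.map_target hz)) (e x) (e.map_source hx)
    rw [e.left_inv hx] at hV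
    exact BerezinToeplitz.expansion_coeff_unique (r := fun k => r k x)
      (fun N => (hA N).imp fun C hC k hk => hC k hk x)
      (fun N => (h N).imp fun C hC k hk => hC k hk x (mem_of_mem_nhds hV)) l
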